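/- Let $d\ge 2$. Let $\phi:\mathbb{R}^d\to[0,\infty)$ be measurable with $\phi(-x)=\phi(x)$ and $\phi\le j$, where $j:\mathbb{R}^d\to[0,\infty)$ is radial and radially non-increasing (away from the origin) and $\int_{\mathbb{R}^d}(1\wedge|x|)\,j(x)\,dx<\infty$. Let $\mathfrak{C}$ be the class of closures of open subsets of $\mathbb{R}^d$ with compact $C^2$ boundary, let $\mathcal{H}^m$ be the $m$-dimensional Hausdorff measure (in its usual normalization), and put $\kappa_{d-2}=\mathcal{H}^{d-2}(\mathbb{S}^{d-2})$. For $E\in\mathfrak{C}$ and $x\in\partial E$ define $$H_\phi(x,E)=\frac1{\kappa_{d-2}}\lim_{r\downarrow0}\int_{B_r(x)^c}\bigl(\chi_{E^c}(y)-\chi_E(y)\bigr)\phi(x-y)\,dy,\qquad \mathrm{Per}_\phi(E)=\int_E\int_{E^c}\phi(x-y)\,dy\,dx .$$ Then the truncated integrals converge absolutely and the limit defining $H_\phi(x,E)$ exists and is finite for all $E\in\mathfrak{C}$, $x\in\partial E$, and, up to the normalizing constant $\kappa_{d-2}$, $H_\phi$ is the first variation of $\mathrm{Per}_\phi$, in the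 following sense. Let $E\in\mathfrak{C}$, $\varepsilon_0>0$, and let $(\Phi_\varepsilon)_{|\varepsilon|<\varepsilon_0}$ be $C^2$ diffeomorphisms of $\mathbb{R}^d$ onto itself such that $(\varepsilon,x)\mapsto\Phi_\varepsilon(x)$ is of class $C^2$ and $\Phi_0(x)=x$ for all $x$. Put $\psi=\frac{\partial\Phi_\varepsilon}{\partial\varepsilon}\big|_{\varepsilon=0}$ and let $\nu$ be the outer unit normal of $\partial E$. Then $\mathrm{Per}_\phi(\Phi_\varepsilon(E))<\infty$ for $|\varepsilon|<\varepsilon_0$, the function $H_\phi(\cdot,E)\,\psi\cdot\nu$ is $\mathcal{H}^{d-1}$-integrable on $\partial E$, the function $\varepsilon\mapsto\mathrm{Per}_\phi(\Phi_\varepsilon(E))$ is differentiable at $\varepsilon=0$, and $$\frac{d}{d\varepsilon}\mathrm{Per}_\phi(\Phi_\varepsilon(E))\Big|_{\varepsilon=0}=\int_{\partial E}\kappa_{d-2}\,H_\phi(x,E)\,\psi(x)\cdot\nu(x)\,d\mathcal{H}^{d-1}(x).$$ -/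

import Mathlib

open MeasureTheory Filter
open scoped Topology ENNReal Manifold Gradient

noncomputable section

namespace NonlocalCurvature

/-- Euclidean space `ℝ^d`. -/
abbrev Space (d : ℕ) : Type := EuclideanSpace ℝ (Fin d)

/-- `φ : ℝ^d → [0,∞)` is even, measurable, and bounded by a function `j : ℝ^d → [0,∞)` that is radial
and radially non-increasing on `ℝ^d ∖ {0}` and satisfies `∫ (1 ∧ |x|) j(x) dx < ∞`.
The monotonicity condition contains the radial symmetry (take `‖x‖ = ‖y‖ ≠ 0`); the value of `j` at
the origin is not constrained, so `j` may blow up there. -/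
structure IsAdmissibleKernel {d : ℕ} (φ j : Space d → ℝ) : Prop where
  measurable : Measurable φ
  nonneg : ∀ x, 0 ≤ φ x
  even : ∀ x, φ (-x) = φ x
  le_profile : ∀ x, φ x ≤ j x
  profile_nonneg : ∀ x, 0 ≤ j x
  profile_antitone : ∀ x y, x ≠ 0 → ‖x‖ ≤ ‖y‖ → j y ≤ j x
  profile_integrable : Integrable (fun x => min 1 ‖x‖ * j x) volume

/-- The open set `U` has boundary of class `C²`: near each boundary point, `U` is the
sublevel set `{f < 0}` of a `C²` function `f` with non-vanishing gradient. -/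
def HasC2Boundary {d : ℕ} (U : Set (Space d)) : Prop :=
  ∀ x ∈ frontier U, ∃ f : Space d → ℝ,
    ContDiffAt ℝ 2 f x ∧ ∇ f x ≠ 0 ∧ ∀ᶠ y in 𝓝 x, (y ∈ U ↔ f y < 0)

/-- The class `ℭ` of closures of open sets with compact `C²` boundary. -/
def ClassC (d : ℕ) : Set (Set (Space d)) :=
  {E | ∃ U : Set (Space d),
    IsOpen U ∧ IsCompact (frontier U) ∧ HasC2Boundary U ∧ E = closure U}

/-- `n` is the outer unit normal of `E` at `x ∈ ∂E`: `n = ∇f(x) / |∇f(x)|` for a `C²` function `f`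
with `f x = 0`, `∇f(x) ≠ 0` and `E = {f ≤ 0}` near `x`. -/
def IsOuterUnitNormal {d : ℕ} (E : Set (Space d)) (x n : Space d) : Prop :=
  ∃ f : Space d → ℝ, ContDiffAt ℝ 2 f x ∧ f x = 0 ∧ ∇ f x ≠ 0 ∧
    (∀ᶠ y in 𝓝 x, (y ∈ E ↔ f y ≤ 0)) ∧ n = ‖∇ f x‖⁻¹ • ∇ f x

open Classical in
/-- The outer unit normal of `E` at `x` (zero if there is none). -/
def outerNormal {d : ℕ} (E : Set (Space d)) (x : Space d) : Space d :=
  if h : ∃ n, IsOuterUnitNormal E x n then h.choose else 0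

/-- `χ̃_E = χ_{E^c} - χ_E`. -/
def signedIndicator {d : ℕ} (E : Set (Space d)) (y : Space d) : ℝ :=
  Eᶜ.indicator 1 y - E.indicator 1 y

/-- `κ_m = ℋ^m(𝕊^m)`, the surface measure of the unit sphere of `ℝ^{m+1}`. The measure `μHE[m]` is the
`m`-dimensional Hausdorff measure in its usual normalization (equal to Lebesgue measure on `ℝ^m`). -/
def kappa (m : ℕ) : ℝ :=
  (μHE[m] (Metric.sphere (0 : Space (m + 1)) 1)).toReal

/-- `∫_{B_r(x)^c} χ̃_E(y) φ(x-y) dy`. -/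
def truncatedCurvature {d : ℕ} (φ : Space d → ℝ) (x : Space d) (E : Set (Space d)) (r : ℝ) : ℝ :=
  ∫ y in (Metric.ball x r)ᶜ, signedIndicator E y * φ (x - y)

/-- The nonlocal mean curvature
`H_φ(x,E) = (1/κ_{d-2}) lim_{r ↓ 0} ∫_{B_r(x)^c} χ̃_E(y) φ(x-y) dy`. -/
def nonlocalMeanCurvature {d : ℕ} (φ : Space d → ℝ) (x : Space d) (E : Set (Space d)) : ℝ :=
  (kappa (d - 2))⁻¹ * limUnder (𝓝[>] (0 : ℝ)) (truncatedCurvature φ x E)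

/-- The nonlocal perimeter `Per_φ(E) = ∫_E ∫_{E^c} φ(x-y) dy dx ∈ [0,∞]`. -/
def nonlocalPerimeter {d : ℕ} (φ : Space d → ℝ) (E : Set (Space d)) : ℝ≥0∞ :=
  ∫⁻ x in E, ∫⁻ y in Eᶜ, ENNReal.ofReal (φ (x - y))

/-- A one-parameter family `(Φ_ε)`, `|ε| < ε₀`, of diffeomorphisms of `ℝ^d`, of class `C²` in `(ε, x)`,
with `Φ_0 = id`. (Only the values for `|ε| < ε₀` matter.) -/
structure IsC2Family {d : ℕ} (ε₀ : ℝ)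
    (Φ : ℝ → (Space d ≃ₘ^2⟮𝓘(ℝ, Space d), 𝓘(ℝ, Space d)⟯ Space d)) : Prop where
  pos : 0 < ε₀
  contDiffOn : ContDiffOn ℝ 2 (fun p : ℝ × Space d => Φ p.1 p.2)
    (Set.Ioo (-ε₀) ε₀ ×ˢ Set.univ)
  zero : ∀ x, Φ 0 x = x

/-- `H` is the first variation of `Per`: for every `E ∈ ℭ` and every `C²` one-parameter family
of diffeomorphisms with `Φ_0 = id` and initial velocity `ψ`,
`d/dε Per(Φ_ε(E)) |_{ε=0} = ∫_{∂E} H(x,E) ψ(x)·ν(x) dℋ^{d-1}(x)`,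
where both sides are meaningful: the perimeters are finite and the integrand is integrable. -/
def IsFirstVariation {d : ℕ} (Per : Set (Space d) → ℝ≥0∞) (H : Space d → Set (Space d) → ℝ) : Prop :=
  ∀ E ∈ ClassC d, ∀ (ε₀ : ℝ)
    (Φ : ℝ → (Space d ≃ₘ^2⟮𝓘(ℝ, Space d), 𝓘(ℝ, Space d)⟯ Space d)), IsC2Family ε₀ Φ →
    (∀ ε ∈ Set.Ioo (-ε₀) ε₀, Per (Φ ε '' E) ≠ ⊤) ∧
    IntegrableOn
      (fun x => H x E * inner ℝ (deriv (fun ε => Φ ε x) 0) (outerNormal E x))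
      (frontier E) μHE[d - 1] ∧
    HasDerivAt (fun ε => (Per (Φ ε '' E)).toReal)
      (∫ x in frontier E,
        H x E * inner ℝ (deriv (fun ε => Φ ε x) 0) (outerNormal E x) ∂μHE[d - 1]) 0

end NonlocalCurvature

end

/-! The kernel is truncated to `φ_r = φ` on `|z| ≥ r`, zero inside. This kernel is integrable, so
its perimeter can be differentiated directly; the work is in letting `r ↓ 0`.

For an even integrable kernel `K` put `V_S(x) = ∫ χ̃_S(y) K(x-y) dy`. Symmetrizing in `(x,y)` gives
the exact formula `Per_K(F) - Per_K(E) = ∫ (χ_F - χ_E) (V_E + V_F)/2`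
(`toReal_nonlocalPerimeter_sub`). For `F = Φ_ε(E)` the volume of `F Δ E` is `O(ε)`, and `V_F → V_E`
uniformly, so up to `o(ε)` the difference is `∫ (χ_F - χ_E) V_E` with `V_E` continuous. The
transport theorem differentiates this and produces `∫_{∂E} V_E ψ·ν`; for `K = φ_r` the potential
`V_E` is the truncated curvature. The transport theorem is proved in graph charts: Fubini, the
fundamental theorem of calculus in the vertical variable, the kinematic condition `∂_ε f = ψ·N`, and
the area formula for graphs, which is obtained by differentiating the projected Hausdorff measure.

To pass to the limit, fix a boundary point `x`. By evenness the contributions of `x+z` and `x-z`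
cancel unless `z` lies in the flat region `|z·ν| ≤ C|z|²`. Since `j` is radially non-increasing, a
dyadic comparison of annuli bounds the integral of `j` over the flat part of `B_r` by a constant
times `∫_{B_r} |z| j`, which tends to zero (`lintegral_flat_le`). By compactness `C` can be taken
uniform over `∂Φ_ε(E)` for all small `ε`. Hence the truncated curvatures converge, uniformly in the
point and in `ε`. Shifting time gives the derivative of the truncated perimeter at every small `ε`;
these derivatives converge uniformly, the truncated perimeters converge pointwise, and so limit and
derivative may be exchanged.

Finiteness of the perimeter comes from `Per_φ(E) = ∫ φ(z) |{x ∈ E, x-z ∉ E}| dz`: the volume is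
`O(|z|)` by a tube estimate, and it is bounded because in dimension at least two either `E` or its
complement has finite volume. -/

namespace NonlocalCurvature

/-! ### Orthogonal splittings of the ambient space -/

/-- An orthogonal splitting of `ℝ^(n+1)` into `ℝ^n` and a line. -/
structure IsSplitting {n : ℕ} (e : (Space n × ℝ) ≃L[ℝ] Space (n + 1)) : Prop where
  measurePreserving : MeasurePreserving e volume volume
  norm_sq : ∀ p, ‖e p‖ ^ 2 = ‖p.1‖ ^ 2 + p.2 ^ 2

/-- An arbitrary isometry sends the vertical unit vector to some vector of the same norm as `ν`; the
reflection in the hyperplane orthogonal to their difference then carries it to `ν`. -/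
theorem exists_isSplitting {n : ℕ} (ν : Space (n + 1)) (hν : ‖ν‖ = 1) :
    ∃ e : (Space n × ℝ) ≃L[ℝ] Space (n + 1), IsSplitting e ∧ e (0, 1) = ν := by
  have hfin : Module.finrank ℝ (WithLp 2 (Space n × ℝ)) = Module.finrank ℝ (Space (n + 1)) := by
    rw [LinearEquiv.finrank_eq (WithLp.linearEquiv 2 ℝ (Space n × ℝ))]
    simp
  let g : WithLp 2 (Space n × ℝ) ≃ₗᵢ[ℝ] Space (n + 1) :=
    (stdOrthonormalBasis ℝ _).equiv (stdOrthonormalBasis ℝ _) (finCongr hfin)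
  let w : WithLp 2 (Space n × ℝ) := WithLp.toLp 2 (0, 1)
  have hw : ‖g w‖ = ‖ν‖ := by
    rw [g.norm_map, hν, WithLp.prod_norm_eq_of_L2]
    simp [w]
  let h : WithLp 2 (Space n × ℝ) ≃ₗᵢ[ℝ] Space (n + 1) :=
    g.trans (Submodule.reflection (Submodule.span ℝ {g w - ν})ᗮ)
  refine ⟨(WithLp.prodContinuousLinearEquiv 2 ℝ (Space n) ℝ).symm.trans
    h.toContinuousLinearEquiv, ⟨?_, ?_⟩, ?_⟩
  · exact h.measurePreserving.comp (WithLp.volume_preserving_toLp _ _)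
  · intro p
    change ‖h (WithLp.toLp 2 p)‖ ^ 2 = _
    rw [h.norm_map, WithLp.prod_norm_sq_eq_of_L2]
    simp
  · change Submodule.reflection (Submodule.span ℝ {g w - ν})ᗮ (g w) = ν
    exact Submodule.reflection_sub hw

namespace IsSplitting

variable {n : ℕ} {e : (Space n × ℝ) ≃L[ℝ] Space (n + 1)}

theorem inner_eq (he : IsSplitting e) (p q : Space n × ℝ) :
    inner ℝ (e p) (e q) = inner ℝ p.1 q.1 + p.2 * q.2 := by
  have h := he.norm_sq (p + q)
  rw [map_add, norm_add_sq_real, he.norm_sq, he.norm_sq, Prod.fst_add, Prod.snd_add,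
    norm_add_sq_real] at h
  linarith

theorem norm_fst_le (he : IsSplitting e) (p : Space n × ℝ) : ‖p.1‖ ≤ ‖e p‖ := by
  have := he.norm_sq p
  exact abs_le_of_sq_le_sq' (by nlinarith [sq_nonneg p.2]) (norm_nonneg _) |>.2

theorem abs_snd_le (he : IsSplitting e) (p : Space n × ℝ) : |p.2| ≤ ‖e p‖ := by
  have := he.norm_sq p
  exact abs_le_of_sq_le_sq (by nlinarith [sq_nonneg ‖p.1‖]) (norm_nonneg _)

end IsSplitting

/-! ### Defining functions, C² domains and the outer normal -/

section Gradient

variable {d : ℕ}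

theorem inner_gradient {f : Space d → ℝ} (x v : Space d) : inner ℝ (∇ f x) v = fderiv ℝ f x v :=
  InnerProductSpace.toDual_symm_apply

theorem gradient_ne_zero_iff {f : Space d → ℝ} {x : Space d} :
    ∇ f x ≠ 0 ↔ fderiv ℝ f x ≠ 0 := by
  simp [gradient]

end Gradient

/-- `F` is a `C²` local defining function of the closed set `E` at the boundary point `p`. -/
structure IsDefiningAt {d : ℕ} (E : Set (Space d)) (F : Space d → ℝ) (p : Space d) : Prop where
  contDiffAt : ContDiffAt ℝ 2 F p
  eq_zero : F p = 0
  fderiv_ne_zero : fderiv ℝ F p ≠ 0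
  mem_iff : ∀ᶠ y in 𝓝 p, (y ∈ E ↔ F y ≤ 0)

/-- Closed sets with compact boundary that are locally sublevel sets of `C²` functions. -/
structure IsC2Domain {d : ℕ} (E : Set (Space d)) : Prop where
  isClosed : IsClosed E
  isCompact_frontier : IsCompact (frontier E)
  exists_isDefiningAt : ∀ p ∈ frontier E, ∃ F, IsDefiningAt E F p

section Defining

variable {d : ℕ} {E : Set (Space d)} {F : Space d → ℝ} {p : Space d}

/-- Otherwise `p` would be a local minimum, and the derivative would vanish there. -/
theorem frequently_neg_of_fderiv_ne_zero (h0 : F p = 0) (hF : fderiv ℝ F p ≠ 0) :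
    ∃ᶠ z in 𝓝 p, F z < 0 := by
  intro h
  apply hF
  apply IsLocalMin.fderiv_eq_zero
  filter_upwards [h] with z hz
  rw [h0]
  exact not_lt.1 hz

theorem frequently_pos_of_fderiv_ne_zero (h0 : F p = 0) (hF : fderiv ℝ F p ≠ 0) :
    ∃ᶠ z in 𝓝 p, 0 < F z := by
  intro h
  apply hF
  apply IsLocalMax.fderiv_eq_zero
  filter_upwards [h] with z hz
  rw [h0]
  exact not_lt.1 hz

theorem eventually_fderiv_ne_zero (hF : ContDiffAt ℝ 2 F p) (hF' : fderiv ℝ F p ≠ 0) :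
    ∀ᶠ y in 𝓝 p, fderiv ℝ F y ≠ 0 :=
  (hF.continuousAt_fderiv (by norm_num)).eventually_ne hF'

theorem eventually_contDiffAt {G : Type*} [NormedAddCommGroup G] [NormedSpace ℝ G] {q : G}
    {H : Type*} [NormedAddCommGroup H] [NormedSpace ℝ H] {f : G → H}
    (hF : ContDiffAt ℝ 2 f q) : ∀ᶠ y in 𝓝 q, ContDiffAt ℝ 2 f y :=
  hF.eventually (by simp)

/-- A nearby zero of `F` has non-vanishing derivative, so it is accumulated by points with `F < 0`
and belongs to the closure. Conversely, continuity keeps the closure out of `{F > 0}`. -/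
theorem isDefiningAt_closure {U : Set (Space d)} (hU : IsOpen U) (hp : p ∈ frontier U)
    (hF : ContDiffAt ℝ 2 F p) (hF' : fderiv ℝ F p ≠ 0) (h : ∀ᶠ y in 𝓝 p, (y ∈ U ↔ F y < 0)) :
    IsDefiningAt (closure U) F p := by
  have hle : ∀ y, ContinuousAt F y → (∀ᶠ z in 𝓝 y, (z ∈ U ↔ F z < 0)) → y ∈ closure U →
      F y ≤ 0 := by
    intro y hc hy hyU
    by_contra! hpos
    have := mem_closure_iff_frequently.1 hyU
    apply this
    filter_upwards [hy, hc.eventually (lt_mem_nhds hpos)] with z hz1 hz2 hz3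
    exact absurd (hz1.1 hz3) (not_lt.2 hz2.le)
  have h0 : F p = 0 := by
    refine le_antisymm (hle p hF.continuousAt h (frontier_subset_closure hp)) ?_
    by_contra! hneg
    have := h.self_of_nhds.2 hneg
    rw [hU.frontier_eq] at hp
    exact hp.2 this
  refine ⟨hF, h0, hF', ?_⟩
  filter_upwards [h.eventually_nhds, eventually_contDiffAt hF,
    eventually_fderiv_ne_zero hF hF'] with y hy hc hy'
  refine ⟨hle y hc.continuousAt hy, fun hy0 => ?_⟩
  rcases hy0.lt_or_eq with hlt | heq
  · exact subset_closure (hy.self_of_nhds.2 hlt)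
  · refine mem_closure_iff_frequently.2 ?_
    refine (frequently_neg_of_fderiv_ne_zero heq hy').mp ?_
    filter_upwards [hy] with z hz using hz.2

theorem IsDefiningAt.eventually (h : IsDefiningAt E F p) :
    ∀ᶠ y in 𝓝 p, F y = 0 → IsDefiningAt E F y := by
  filter_upwards [h.mem_iff.eventually_nhds, eventually_contDiffAt h.contDiffAt,
    eventually_fderiv_ne_zero h.contDiffAt h.fderiv_ne_zero] with y h1 h2 h3 h4
  exact ⟨h2, h4, h3, h1⟩

theorem IsDefiningAt.mem_frontier (h : IsDefiningAt E F p) : p ∈ frontier E := by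
  refine ⟨subset_closure (h.mem_iff.self_of_nhds.2 h.eq_zero.le), fun hint => ?_⟩
  refine frequently_pos_of_fderiv_ne_zero h.eq_zero h.fderiv_ne_zero ?_
  filter_upwards [mem_interior_iff_mem_nhds.1 hint, h.mem_iff] with z hz1 hz2
  exact not_lt.2 (hz2.1 hz1)

theorem eq_zero_of_mem_frontier (h : ∀ᶠ y in 𝓝 p, (y ∈ E ↔ F y ≤ 0)) (hc : ContinuousAt F p)
    (hp : p ∈ frontier E) : F p = 0 := by
  rcases lt_trichotomy (F p) 0 with hlt | heq | hgt
  · refine absurd (mem_interior_iff_mem_nhds.2 ?_) hp.2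
    filter_upwards [h, hc.eventually (gt_mem_nhds hlt)] with z hz1 hz2
    exact hz1.2 hz2.le
  · exact heq
  · refine absurd ?_ (mem_closure_iff_frequently.1 hp.1)
    filter_upwards [h, hc.eventually (lt_mem_nhds hgt)] with z hz1 hz2 hz3
    exact absurd (hz1.1 hz3) (not_le.2 hz2)

theorem IsDefiningAt.eventually_mem_frontier_iff (h : IsDefiningAt E F p) :
    ∀ᶠ y in 𝓝 p, (y ∈ frontier E ↔ F y = 0) := by
  filter_upwards [h.mem_iff.eventually_nhds, eventually_contDiffAt h.contDiffAt,
    h.eventually] with y h1 h2 h3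
  exact ⟨eq_zero_of_mem_frontier h1 h2.continuousAt, fun hy => (h3 hy).mem_frontier⟩

theorem isC2Domain_of_mem_classC (hE : E ∈ ClassC d) : IsC2Domain E := by
  obtain ⟨U, hU, hc, hb, rfl⟩ := hE
  refine ⟨isClosed_closure, hc.of_isClosed_subset isClosed_frontier frontier_closure_subset, ?_⟩
  intro p hp
  obtain ⟨F, hF, hF', hm⟩ := hb p (frontier_closure_subset hp)
  exact ⟨F, isDefiningAt_closure hU (frontier_closure_subset hp) hF (gradient_ne_zero_iff.1 hF') hm⟩

/-- Halfspace comparison: the derivatives of two defining functions are positively proportional. -/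
theorem IsDefiningAt.fderiv_nonpos {F₁ F₂ : Space d → ℝ} (h₁ : IsDefiningAt E F₁ p)
    (h₂ : IsDefiningAt E F₂ p) {v : Space d} (hv : fderiv ℝ F₁ p v < 0) : fderiv ℝ F₂ p v ≤ 0 := by
  by_contra! hpos
  have hline : HasDerivAt (fun t : ℝ => p + t • v) v 0 := by
    simpa using ((hasDerivAt_id (0 : ℝ)).smul_const v).const_add p
  have hd : ∀ {F : Space d → ℝ}, IsDefiningAt E F p →
      HasDerivAt (fun t : ℝ => F (p + t • v)) (fderiv ℝ F p v) 0 := by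
    intro F h
    have h1 : HasFDerivAt F (fderiv ℝ F p) (p + (0 : ℝ) • v) := by
      simpa using (h.contDiffAt.differentiableAt (by norm_num)).hasFDerivAt
    exact h1.comp_hasDerivAt (0 : ℝ) hline
  have e1 := (hasDerivAt_iff_tendsto_slope_zero.1 (hd h₁)).eventually (gt_mem_nhds hv)
  have e2 := (hasDerivAt_iff_tendsto_slope_zero.1 (hd h₂)).eventually (lt_mem_nhds hpos)
  have hc : Tendsto (fun t : ℝ => p + t • v) (𝓝 0) (𝓝 p) := by
    simpa using hline.continuousAt.tendsto
  have e3 := (hc.eventually (h₁.mem_iff.and h₂.mem_iff)).filter_mono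
    (nhdsWithin_le_nhds : 𝓝[>] (0 : ℝ) ≤ 𝓝 0)
  have hle : 𝓝[>] (0 : ℝ) ≤ 𝓝[≠] 0 := nhdsWithin_mono _ fun x hx => ne_of_gt hx
  obtain ⟨t, ⟨⟨h1, h2⟩, h3⟩, ht⟩ :=
    ((e1.filter_mono hle).and (e2.filter_mono hle)).and e3 |>.and self_mem_nhdsWithin |>.exists
  have ht : 0 < t := ht
  simp only [zero_add, zero_smul, add_zero, h₁.eq_zero, h₂.eq_zero, sub_zero, smul_eq_mul] at h1 h2
  have h1' : F₁ (p + t • v) < 0 := by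
    by_contra! hh
    exact absurd h1 (not_lt.2 (by positivity))
  have h2' : 0 < F₂ (p + t • v) := by
    by_contra! hh
    exact absurd h2 (not_lt.2 (mul_nonpos_of_nonneg_of_nonpos (by positivity) hh))
  exact absurd (h3.2.1 (h3.1.2 h1'.le)) (not_le.2 h2')

theorem IsDefiningAt.isOuterUnitNormal (h : IsDefiningAt E F p) :
    IsOuterUnitNormal E p (‖∇ F p‖⁻¹ • ∇ F p) :=
  ⟨F, h.contDiffAt, h.eq_zero, gradient_ne_zero_iff.2 h.fderiv_ne_zero, h.mem_iff, rfl⟩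

/-- Distinct unit vectors `m`, `k` have `⟨m, k⟩ < 1`, so moving along `k - m` strictly decreases the
first defining function and strictly increases the second, which is impossible. This makes the
choice in `outerNormal` harmless. -/
theorem IsOuterUnitNormal.unique {n₁ n₂ : Space d} (h₁ : IsOuterUnitNormal E p n₁)
    (h₂ : IsOuterUnitNormal E p n₂) : n₁ = n₂ := by
  obtain ⟨F₁, hc₁, hz₁, hg₁, hm₁, rfl⟩ := h₁
  obtain ⟨F₂, hc₂, hz₂, hg₂, hm₂, rfl⟩ := h₂
  have d₁ : IsDefiningAt E F₁ p := ⟨hc₁, hz₁, gradient_ne_zero_iff.1 hg₁, hm₁⟩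
  have d₂ : IsDefiningAt E F₂ p := ⟨hc₂, hz₂, gradient_ne_zero_iff.1 hg₂, hm₂⟩
  set a := ∇ F₁ p
  set b := ∇ F₂ p
  have ha : 0 < ‖a‖ := norm_pos_iff.2 hg₁
  have hb : 0 < ‖b‖ := norm_pos_iff.2 hg₂
  set m := ‖a‖⁻¹ • a with hm
  set k := ‖b‖⁻¹ • b with hk
  have nm : ‖m‖ = 1 := by rw [hm, norm_smul, norm_inv, norm_norm, inv_mul_cancel₀ ha.ne']
  have nk : ‖k‖ = 1 := by rw [hk, norm_smul, norm_inv, norm_norm, inv_mul_cancel₀ hb.ne']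
  by_contra hne
  have hlt : inner ℝ m k < 1 := (inner_lt_one_iff_real_of_norm_eq_one nm nk).2 hne
  have hA : a = ‖a‖ • m := by rw [hm, smul_smul, mul_inv_cancel₀ ha.ne', one_smul]
  have hB : b = ‖b‖ • k := by rw [hk, smul_smul, mul_inv_cancel₀ hb.ne', one_smul]
  have h := d₁.fderiv_nonpos d₂ (v := k - m) ?_
  · rw [← inner_gradient] at h
    change inner ℝ b (k - m) ≤ 0 at h
    rw [hB, inner_smul_left, inner_sub_right, real_inner_self_eq_norm_sq, nk,
      real_inner_comm] at h
    simp only [conj_trivial] at h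
    nlinarith
  · rw [← inner_gradient]
    change inner ℝ a (k - m) < 0
    rw [hA, inner_smul_left, inner_sub_right, real_inner_self_eq_norm_sq, nm]
    simp only [conj_trivial]
    nlinarith

theorem IsDefiningAt.outerNormal_eq (h : IsDefiningAt E F p) :
    outerNormal E p = ‖∇ F p‖⁻¹ • ∇ F p := by
  have hex : ∃ n, IsOuterUnitNormal E p n := ⟨_, h.isOuterUnitNormal⟩
  rw [outerNormal, dif_pos hex]
  exact hex.choose_spec.unique h.isOuterUnitNormal

/-- One function `F` defines `E` at all boundary points near `p`, so the normal is there the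
continuous field `∇F / |∇F|`. -/
theorem IsC2Domain.continuousOn_outerNormal (hE : IsC2Domain E) :
    ContinuousOn (outerNormal E) (frontier E) := by
  intro p hp
  obtain ⟨F, h⟩ := hE.exists_isDefiningAt p hp
  have hg : ContinuousAt (∇ F) p :=
    (InnerProductSpace.toDual ℝ (Space d)).symm.continuous.continuousAt.comp
      (h.contDiffAt.continuousAt_fderiv (by norm_num))
  have hc : ContinuousAt (fun y => ‖∇ F y‖⁻¹ • ∇ F y) p :=
    (hg.norm.inv₀ (norm_ne_zero_iff.2 (gradient_ne_zero_iff.2 h.fderiv_ne_zero))).smul hg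
  refine hc.continuousWithinAt.congr_of_eventuallyEq ?_ h.outerNormal_eq
  filter_upwards [nhdsWithin_le_nhds h.eventually,
    nhdsWithin_le_nhds h.eventually_mem_frontier_iff, self_mem_nhdsWithin] with y h1 h2 h3
  exact (h1 (h2.1 h3)).outerNormal_eq

theorem norm_outerNormal_le (E : Set (Space d)) (x : Space d) : ‖outerNormal E x‖ ≤ 1 := by
  rw [outerNormal]
  split_ifs with h
  · obtain ⟨F, _, _, hg, _, hn⟩ := h.choose_spec
    rw [hn, norm_smul, norm_inv, norm_norm, inv_mul_cancel₀ (norm_ne_zero_iff.2 hg)]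
  · simp

/-- `C²` domains are preserved by `C²` diffeomorphisms. -/
theorem IsC2Domain.image (hE : IsC2Domain E)
    (Φ : Space d ≃ₘ^2⟮𝓘(ℝ, Space d), 𝓘(ℝ, Space d)⟯ Space d) : IsC2Domain (Φ '' E) := by
  have hfr : frontier (Φ '' E) = Φ '' frontier E := (Φ.toHomeomorph.image_frontier E).symm
  refine ⟨(Φ.toHomeomorph.isClosed_image).2 hE.isClosed, ?_, ?_⟩
  · rw [hfr]
    exact hE.isCompact_frontier.image Φ.continuous
  · rw [hfr]
    rintro _ ⟨p, hp, rfl⟩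
    obtain ⟨F, h⟩ := hE.exists_isDefiningAt p hp
    have hs : ContDiff ℝ 2 Φ.symm := Φ.symm.contMDiff.contDiff
    have hΦ : ContDiff ℝ 2 Φ := Φ.contMDiff.contDiff
    have hsp : Φ.symm (Φ p) = p := Φ.symm_apply_apply p
    have hF : ContDiffAt ℝ 2 F (Φ.symm (Φ p)) := by rw [hsp]; exact h.contDiffAt
    refine ⟨F ∘ Φ.symm, hF.comp _ hs.contDiffAt, by simp [h.eq_zero], ?_, ?_⟩
    · intro h0
      have hcomp : F = (F ∘ Φ.symm) ∘ Φ := by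
        ext x; simp
      apply h.fderiv_ne_zero
      rw [hcomp, fderiv_comp, h0, ContinuousLinearMap.zero_comp]
      · exact (hF.comp _ hs.contDiffAt).differentiableAt (by norm_num)
      · exact hΦ.contDiffAt.differentiableAt (by norm_num)
    · have hc : Tendsto Φ.symm (𝓝 (Φ p)) (𝓝 p) := by
        simpa [hsp] using hs.continuous.tendsto (Φ p)
      filter_upwards [hc.eventually h.mem_iff] with y hy
      rw [Function.comp_apply, ← hy]
      constructor
      · rintro ⟨x, hx, rfl⟩
        simpa using hx
      · intro hx
        exact ⟨_, hx, by simp⟩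

theorem frontier_image_diffeo (E : Set (Space d))
    (Φ : Space d ≃ₘ^2⟮𝓘(ℝ, Space d), 𝓘(ℝ, Space d)⟯ Space d) :
    frontier (Φ '' E) = Φ '' frontier E :=
  (Φ.toHomeomorph.image_frontier E).symm

end Defining


/-! ### Families of diffeomorphisms: inverses and time shifts -/

section Family

variable {d : ℕ} {ε₀ : ℝ} {Φ : ℝ → (Space d ≃ₘ^2⟮𝓘(ℝ, Space d), 𝓘(ℝ, Space d)⟯ Space d)}

theorem contDiff_diffeo (Ψ : Space d ≃ₘ^2⟮𝓘(ℝ, Space d), 𝓘(ℝ, Space d)⟯ Space d) :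
    ContDiff ℝ 2 Ψ := Ψ.contMDiff.contDiff

theorem isInvertible_fderiv_diffeo (Ψ : Space d ≃ₘ^2⟮𝓘(ℝ, Space d), 𝓘(ℝ, Space d)⟯ Space d)
    (x : Space d) : (fderiv ℝ Ψ x).IsInvertible := by
  have h1 : DifferentiableAt ℝ Ψ x := (contDiff_diffeo Ψ).contDiffAt.differentiableAt (by norm_num)
  have h2 : DifferentiableAt ℝ Ψ.symm (Ψ x) :=
    (contDiff_diffeo Ψ.symm).contDiffAt.differentiableAt (by norm_num)
  have h1' : DifferentiableAt ℝ Ψ (Ψ.symm (Ψ x)) := by simpa using h1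
  refine ContinuousLinearMap.IsInvertible.of_inverse (g := fderiv ℝ Ψ.symm (Ψ x)) ?_ ?_
  · have := fderiv_comp (Ψ x) h1' h2
    rw [Ψ.symm_apply_apply] at this
    rw [← this]
    have hid : Ψ ∘ Ψ.symm = id := by ext1 y; simp
    rw [hid, fderiv_id]
  · rw [← fderiv_comp x h2 h1]
    have hid : Ψ.symm ∘ Ψ = id := by ext1 y; simp
    rw [hid, fderiv_id]

namespace IsC2Family

theorem contDiffAt (h : IsC2Family ε₀ Φ) {ε : ℝ} (hε : ε ∈ Set.Ioo (-ε₀) ε₀) (x : Space d) :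
    ContDiffAt ℝ 2 (fun p : ℝ × Space d => Φ p.1 p.2) (ε, x) :=
  h.contDiffOn.contDiffAt (prod_mem_nhds (isOpen_Ioo.mem_nhds hε) univ_mem)

theorem zero_mem (h : IsC2Family ε₀ Φ) : (0 : ℝ) ∈ Set.Ioo (-ε₀) ε₀ :=
  ⟨neg_lt_zero.2 h.pos, h.pos⟩

theorem coe_zero (h : IsC2Family ε₀ Φ) : ⇑(Φ 0) = id := funext h.zero

theorem symm_zero (h : IsC2Family ε₀ Φ) (x : Space d) : (Φ 0).symm x = x := by
  conv_lhs => rw [← h.zero x]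
  exact (Φ 0).symm_apply_apply x

/-- Joint regularity of the inverses follows from the implicit function theorem for `Φ_ε(x) - y =
0`, whose derivative in `x` is the invertible `DΦ_ε(x)`. -/
theorem contDiffAt_symm (h : IsC2Family ε₀ Φ) {ε : ℝ} (hε : ε ∈ Set.Ioo (-ε₀) ε₀) (y : Space d) :
    ContDiffAt ℝ 2 (fun p : ℝ × Space d => (Φ p.1).symm p.2) (ε, y) := by
  set x := (Φ ε).symm y with hx
  let f : (ℝ × Space d) × Space d → Space d := fun q => Φ q.1.1 q.2 - q.1.2
  have hf : ContDiffAt ℝ 2 f ((ε, y), x) := by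
    refine ContDiffAt.sub ?_ (by fun_prop)
    exact (h.contDiffAt hε x).comp ((ε, y), x)
      (f := fun q : (ℝ × Space d) × Space d => (q.1.1, q.2)) (by fun_prop)
  have hinr : fderiv ℝ f ((ε, y), x) ∘L .inr ℝ (ℝ × Space d) (Space d) = fderiv ℝ (Φ ε) x := by
    have h1 : HasFDerivAt (fun z : Space d => f ((ε, y), z))
        (fderiv ℝ f ((ε, y), x) ∘L .inr ℝ (ℝ × Space d) (Space d)) x :=
      (hf.differentiableAt (by norm_num)).hasFDerivAt.comp x (hasFDerivAt_prodMk_right _ _)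
    have h2 : HasFDerivAt (fun z : Space d => f ((ε, y), z)) (fderiv ℝ (Φ ε) x) x :=
      ((contDiff_diffeo (Φ ε)).contDiffAt.differentiableAt (by norm_num)).hasFDerivAt.sub_const y
    exact h1.unique h2
  have hinv : (fderiv ℝ f ((ε, y), x) ∘L .inr ℝ (ℝ × Space d) (Space d)).IsInvertible := by
    rw [hinr]; exact isInvertible_fderiv_diffeo _ _
  have h0 : f ((ε, y), x) = 0 := by simp [f, hx]
  have hg := hf.contDiffAt_implicitFunction (by norm_num) hinv
  refine hg.congr_of_eventuallyEq ?_
  filter_upwards [hf.eventually_apply_implicitFunction (by norm_num) hinv] with q hq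
  rw [h0, sub_eq_zero] at hq
  rw [← hq]
  exact (Φ q.1).symm_apply_apply _

/-- Restarting the flow at time `ε` turns statements about the derivative at time zero into
statements at any time in the interval. -/
theorem shift (h : IsC2Family ε₀ Φ) {ε : ℝ} (hε : ε ∈ Set.Ioo (-ε₀) ε₀) :
    IsC2Family (ε₀ - |ε|) (fun η => (Φ ε).symm.trans (Φ (ε + η))) := by
  refine ⟨sub_pos.2 (abs_lt.2 hε), ?_, fun x => ?_⟩
  · rintro ⟨η, x⟩ ⟨hη, -⟩
    have hmem : ε + η ∈ Set.Ioo (-ε₀) ε₀ := by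
      have h1 := neg_abs_le ε
      have h2 := le_abs_self ε
      have h3 : -(ε₀ - |ε|) < η := hη.1
      have h4 : η < ε₀ - |ε| := hη.2
      constructor <;> linarith
    refine ContDiffAt.contDiffWithinAt ?_
    refine (h.contDiffAt hmem ((Φ ε).symm x)).comp (η, x)
      (f := fun q : ℝ × Space d => (ε + q.1, (Φ ε).symm q.2)) ?_
    refine ContDiffAt.prodMk (by fun_prop) ?_
    exact ((contDiff_diffeo (Φ ε).symm).contDiffAt).comp (η, x) contDiffAt_snd
  · simp

end IsC2Family

/-- With the constant family, facts about a fixed domain become special cases of facts about moving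
domains. -/
theorem isC2Family_refl (d : ℕ) :
    IsC2Family 1 (fun _ : ℝ => Diffeomorph.refl 𝓘(ℝ, Space d) (Space d) 2) :=
  ⟨one_pos, contDiff_snd.contDiffOn, fun _ => rfl⟩

end Family

/-! ### Moving graph charts and the kinematic condition -/

/-- Near `(0, p)`, in the splitting `e`, the moving set `A ε` is the subgraph of `f (ε, ·)`. -/
structure IsGraphChart {n : ℕ} (A : ℝ → Set (Space (n + 1))) (p : Space (n + 1))
    (e : (Space n × ℝ) ≃L[ℝ] Space (n + 1)) (f : ℝ × Space n → ℝ) : Prop where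
  isSplitting : IsSplitting e
  contDiffAt : ContDiffAt ℝ 2 f (0, (e.symm p).1)
  apply_base : f (0, (e.symm p).1) = (e.symm p).2
  mem_iff : ∀ᶠ q : ℝ × (Space n × ℝ) in 𝓝 (0, e.symm p),
    (e q.2 ∈ A q.1 ↔ q.2.2 ≤ f (q.1, q.2.1))

/-- A scalar function increasing in the last variable is nonpositive exactly below its implicit
function. -/
theorem exists_subgraph {X : Type*} [NormedAddCommGroup X] [NormedSpace ℝ X] [CompleteSpace X]
    {H : X × ℝ → ℝ} {u : X × ℝ} (hH : ContDiffAt ℝ 2 H u) (h0 : H u = 0)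
    (hpos : 0 < fderiv ℝ H u (0, 1)) :
    ∃ f : X → ℝ, ContDiffAt ℝ 2 f u.1 ∧ f u.1 = u.2 ∧ ∀ᶠ q in 𝓝 u, (H q ≤ 0 ↔ q.2 ≤ f q.1) := by
  set c := fderiv ℝ H u (0, 1)
  have hinv : (fderiv ℝ H u ∘L .inr ℝ X ℝ).IsInvertible := by
    refine ContinuousLinearMap.IsInvertible.of_inverse
      (g := c⁻¹ • ContinuousLinearMap.id ℝ ℝ) ?_ ?_ <;>
    · ext
      simp [c, inv_mul_cancel₀ hpos.ne']
  refine ⟨hH.implicitFunction (by norm_num) hinv,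
    hH.contDiffAt_implicitFunction (by norm_num) hinv,
    hH.implicitFunction_apply_self (by norm_num) hinv, ?_⟩
  set f := hH.implicitFunction (by norm_num) hinv with hf
  have hfc : ContinuousAt f u.1 :=
    (hH.contDiffAt_implicitFunction (by norm_num) hinv).continuousAt
  have hfu : f u.1 = u.2 := hH.implicitFunction_apply_self (by norm_num) hinv
  have hgood : ∀ᶠ q in 𝓝 u, DifferentiableAt ℝ H q ∧ 0 < fderiv ℝ H q (0, 1) := by
    have hcf : ContinuousAt (fun q => fderiv ℝ H q (0, 1)) u :=
      (hH.continuousAt_fderiv (by norm_num)).clm_apply continuousAt_const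
    filter_upwards [eventually_contDiffAt hH, hcf.eventually (lt_mem_nhds hpos)] with q h1 h2
    exact ⟨h1.differentiableAt (by norm_num), h2⟩
  obtain ⟨ρ, hρ, hball⟩ := Metric.eventually_nhds_iff_ball.1 hgood
  have e1 : ∀ᶠ q : X × ℝ in 𝓝 u, q.1 ∈ Metric.ball u.1 ρ :=
    continuousAt_fst.eventually (Metric.ball_mem_nhds _ hρ)
  have e2 : ∀ᶠ q : X × ℝ in 𝓝 u, q.2 ∈ Metric.ball u.2 ρ :=
    continuousAt_snd.eventually (Metric.ball_mem_nhds _ hρ)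
  have e3 : ∀ᶠ q : X × ℝ in 𝓝 u, f q.1 ∈ Metric.ball u.2 ρ := by
    have : ContinuousAt (fun q : X × ℝ => f q.1) u := hfc.comp continuousAt_fst
    exact this.eventually (Metric.isOpen_ball.mem_nhds (by simpa [hfu] using hρ))
  have e4 : ∀ᶠ q : X × ℝ in 𝓝 u, H (q.1, f q.1) = 0 := by
    have := continuousAt_fst.eventually
      (hH.eventually_apply_implicitFunction (by norm_num) hinv)
    rwa [h0] at this
  filter_upwards [e1, e2, e3, e4] with q h1 h2 h3 h4
  have hmem : ∀ s ∈ Metric.ball u.2 ρ, (q.1, s) ∈ Metric.ball u ρ := fun s hs => by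
    rw [← Prod.eta u, ← ball_prod_same]
    exact ⟨h1, hs⟩
  have hd : ∀ s ∈ Metric.ball u.2 ρ,
      HasDerivAt (fun s => H (q.1, s)) (fderiv ℝ H (q.1, s) (0, 1)) s := fun s hs =>
    (hball _ (hmem s hs)).1.hasFDerivAt.comp_hasDerivAt s
      ((hasDerivAt_const s q.1).prodMk (hasDerivAt_id s))
  have hmono : StrictMonoOn (fun s => H (q.1, s)) (Metric.ball u.2 ρ) := by
    refine strictMonoOn_of_deriv_pos (convex_ball _ _)
      (fun s hs => (hd s hs).continuousAt.continuousWithinAt) fun s hs => ?_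
    rw [Metric.isOpen_ball.interior_eq] at hs
    rw [(hd s hs).deriv]
    exact (hball _ (hmem s hs)).2
  have := hmono.le_iff_le h2 h3
  rw [h4] at this
  exact this

/-- The vertical direction is taken along the spatial gradient of `G` at `p`, so the vertical
derivative there is positive and `exists_subgraph` applies, with time as one of the parameters. -/
theorem exists_isGraphChart {n : ℕ} {A : ℝ → Set (Space (n + 1))} {p : Space (n + 1)}
    {G : ℝ × Space (n + 1) → ℝ} (hG : ContDiffAt ℝ 2 G (0, p)) (h0 : G (0, p) = 0)
    (hG' : fderiv ℝ G (0, p) ∘L .inr ℝ ℝ (Space (n + 1)) ≠ 0)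
    (hA : ∀ᶠ q in 𝓝 ((0 : ℝ), p), (q.2 ∈ A q.1 ↔ G q ≤ 0)) :
    ∃ e f, IsGraphChart A p e f := by
  set l := fderiv ℝ G (0, p) ∘L .inr ℝ ℝ (Space (n + 1)) with hl
  set w := (InnerProductSpace.toDual ℝ (Space (n + 1))).symm l with hw
  have hw0 : w ≠ 0 := by simpa [w] using hG'
  have hwpos : 0 < ‖w‖ := norm_pos_iff.2 hw0
  obtain ⟨e, he, hν⟩ := exists_isSplitting (‖w‖⁻¹ • w)
    (by rw [norm_smul, norm_inv, norm_norm, inv_mul_cancel₀ hwpos.ne'])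
  have hle : 0 < l (e (0, 1)) := by
    rw [hν, map_smul, ← InnerProductSpace.toDual_symm_apply (𝕜 := ℝ) (y := l), ← hw,
      real_inner_self_eq_norm_sq]
    simp only [smul_eq_mul]
    positivity
  let g : (ℝ × Space n) × ℝ → ℝ × Space (n + 1) := fun q => (q.1.1, e (q.1.2, q.2))
  have hg : ContDiff ℝ 2 g := by
    refine ContDiff.prodMk (by fun_prop) ?_
    exact e.contDiff.comp (by fun_prop)
  set u : (ℝ × Space n) × ℝ := ((0, (e.symm p).1), (e.symm p).2) with hu
  have hgu : g u = (0, p) := by simp [g, u]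
  have hGu : ContDiffAt ℝ 2 G (g u) := by rw [hgu]; exact hG
  have hH : ContDiffAt ℝ 2 (G ∘ g) u := hGu.comp u hg.contDiffAt
  have hpos : 0 < fderiv ℝ (G ∘ g) u (0, 1) := by
    have h1 : HasDerivAt (fun s : ℝ => ((0 : ℝ), e ((e.symm p).1, s))) (0, e (0, 1)) u.2 :=
      (hasDerivAt_const _ _).prodMk (e.hasFDerivAt.comp_hasDerivAt _
        ((hasDerivAt_const _ _).prodMk (hasDerivAt_id _)))
    have h2 : HasDerivAt (fun s : ℝ => (u.1, s)) (0, 1) u.2 :=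
      (hasDerivAt_const _ _).prodMk (hasDerivAt_id _)
    have h3 := (hH.differentiableAt (by norm_num)).hasFDerivAt.comp_hasDerivAt u.2
      (f := fun s : ℝ => (u.1, s)) h2
    have h4 := (hGu.differentiableAt (by norm_num)).hasFDerivAt.comp_hasDerivAt u.2
      (f := fun s : ℝ => ((0 : ℝ), e ((e.symm p).1, s))) h1
    have h5 : fderiv ℝ (G ∘ g) u (0, 1) = fderiv ℝ G (g u) (0, e (0, 1)) := h3.unique h4
    rw [h5, hgu]
    exact hle
  obtain ⟨f, hf, hfu, hmem⟩ := exists_subgraph hH (by simp [hgu, h0]) hpos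
  refine ⟨e, f, he, hf, hfu, ?_⟩
  have hc1 : Tendsto (fun q : ℝ × (Space n × ℝ) => ((q.1, q.2.1), q.2.2)) (𝓝 (0, e.symm p))
      (𝓝 u) := by
    have : Continuous (fun q : ℝ × (Space n × ℝ) => ((q.1, q.2.1), q.2.2)) := by fun_prop
    exact this.tendsto _
  have hc2 : Tendsto (fun q : ℝ × (Space n × ℝ) => (q.1, e q.2)) (𝓝 (0, e.symm p))
      (𝓝 (0, p)) := by
    have : Continuous (fun q : ℝ × (Space n × ℝ) => (q.1, e q.2)) := by fun_prop
    simpa using this.tendsto (0, e.symm p)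
  filter_upwards [hc1.eventually hmem, hc2.eventually hA] with q h1 h2
  rw [h2]
  exact h1

/-- If `F` defines `E` near `p`, then `F(Φ_ε⁻¹ x)` defines `Φ_ε(E)` simultaneously for all small
`ε`. -/
theorem IsC2Domain.exists_isGraphChart {n : ℕ} {E : Set (Space (n + 1))} (hE : IsC2Domain E)
    {ε₀ : ℝ} {Φ : ℝ → (Space (n + 1) ≃ₘ^2⟮𝓘(ℝ, Space (n + 1)), 𝓘(ℝ, Space (n + 1))⟯ Space (n + 1))}
    (hΦ : IsC2Family ε₀ Φ) {p : Space (n + 1)} (hp : p ∈ frontier E) :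
    ∃ e f, IsGraphChart (fun ε => Φ ε '' E) p e f := by
  obtain ⟨F, hF⟩ := hE.exists_isDefiningAt p hp
  have hs := hΦ.contDiffAt_symm hΦ.zero_mem p
  have hs0 : (Φ 0).symm p = p := hΦ.symm_zero p
  have hFs : ContDiffAt ℝ 2 F ((Φ ((0 : ℝ), p).1).symm ((0 : ℝ), p).2) := by
    simpa [hs0] using hF.contDiffAt
  have hcomp : ContDiffAt ℝ 2 (F ∘ fun q : ℝ × Space (n + 1) => (Φ q.1).symm q.2) (0, p) :=
    hFs.comp (0, p) hs
  refine NonlocalCurvature.exists_isGraphChart hcomp (by simp [hs0, hF.eq_zero]) ?_ ?_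
  · intro h0
    apply hF.fderiv_ne_zero
    have h1 := (hcomp.differentiableAt (by norm_num)).hasFDerivAt.comp p
      (hasFDerivAt_prodMk_right (𝕜 := ℝ) (0 : ℝ) p)
    rw [h0] at h1
    have h2 : ((F ∘ fun q : ℝ × Space (n + 1) => (Φ q.1).symm q.2) ∘ fun x => ((0 : ℝ), x)) =
        F := by
      ext x
      simp [hΦ.symm_zero]
    rw [h2] at h1
    exact h1.fderiv
  · have hc : Tendsto (fun q : ℝ × Space (n + 1) => (Φ q.1).symm q.2) (𝓝 (0, p)) (𝓝 p) := by
      simpa [hs0] using hs.continuousAt.tendsto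
    filter_upwards [hc.eventually hF.mem_iff] with q hq
    rw [Function.comp_apply, ← hq]
    constructor
    · rintro ⟨x, hx, hxq⟩
      rw [← hxq]
      simpa using hx
    · intro hx
      exact ⟨_, hx, by simp⟩


section Chart

variable {n : ℕ} {A : ℝ → Set (Space (n + 1))} {p : Space (n + 1)}
  {e : (Space n × ℝ) ≃L[ℝ] Space (n + 1)} {f : ℝ × Space n → ℝ}

/-- The vertical distance of `q.2` to the graph of `f (q.1, ·)`. -/
noncomputable def graphDefect (e : (Space n × ℝ) ≃L[ℝ] Space (n + 1)) (f : ℝ × Space n → ℝ)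
    (q : ℝ × Space (n + 1)) : ℝ :=
  (e.symm q.2).2 - f (q.1, (e.symm q.2).1)

/-- The upward normal `(-∇f, 1)` of the graph of `f (q.1, ·)` above `q.2`. -/
noncomputable def upNormal (e : (Space n × ℝ) ≃L[ℝ] Space (n + 1)) (f : ℝ × Space n → ℝ)
    (q : ℝ × Space n) :
    Space (n + 1) :=
  e (-(InnerProductSpace.toDual ℝ (Space n)).symm (fderiv ℝ f q ∘L .inr ℝ ℝ (Space n)), 1)

theorem inner_upNormal (he : IsSplitting e) (q : ℝ × Space n) (w : Space n × ℝ) :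
    inner ℝ (upNormal e f q) (e w) = w.2 - fderiv ℝ f q (0, w.1) := by
  rw [upNormal, he.inner_eq, inner_neg_left, InnerProductSpace.toDual_symm_apply]
  simp
  ring

theorem inner_upNormal' (he : IsSplitting e) (q : ℝ × Space n) (v : Space (n + 1)) :
    inner ℝ (upNormal e f q) v = (e.symm v).2 - fderiv ℝ f q (0, (e.symm v).1) := by
  rw [← inner_upNormal he, e.apply_symm_apply]

theorem norm_upNormal_sq (he : IsSplitting e) (q : ℝ × Space n) :
    ‖upNormal e f q‖ ^ 2 = 1 + ‖fderiv ℝ f q ∘L .inr ℝ ℝ (Space n)‖ ^ 2 := by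
  rw [upNormal, he.norm_sq]
  simp
  ring

theorem one_le_norm_upNormal (he : IsSplitting e) (q : ℝ × Space n) : 1 ≤ ‖upNormal e f q‖ := by
  have := norm_upNormal_sq (f := f) he q
  nlinarith [norm_nonneg (upNormal e f q), sq_nonneg ‖fderiv ℝ f q ∘L .inr ℝ ℝ (Space n)‖]

theorem hasFDerivAt_graphDefect {q : ℝ × Space (n + 1)}
    (hf : DifferentiableAt ℝ f (q.1, (e.symm q.2).1)) :
    HasFDerivAt (graphDefect e f)
      (((ContinuousLinearMap.snd ℝ (Space n) ℝ ∘L (e.symm : Space (n + 1) →L[ℝ] Space n × ℝ)) ∘L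
          .snd ℝ ℝ (Space (n + 1))) -
        fderiv ℝ f (q.1, (e.symm q.2).1) ∘L ((ContinuousLinearMap.fst ℝ ℝ (Space (n + 1))).prod
          ((ContinuousLinearMap.fst ℝ (Space n) ℝ ∘L (e.symm : Space (n + 1) →L[ℝ] Space n × ℝ)) ∘L
            .snd ℝ ℝ (Space (n + 1))))) q := by
  refine HasFDerivAt.sub ?_ ?_
  · exact ((ContinuousLinearMap.snd ℝ (Space n) ℝ ∘L
      (e.symm : Space (n + 1) →L[ℝ] Space n × ℝ)) ∘L .snd ℝ ℝ (Space (n + 1))).hasFDerivAt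
  · exact hf.hasFDerivAt.comp q (ContinuousLinearMap.hasFDerivAt
      ((ContinuousLinearMap.fst ℝ ℝ (Space (n + 1))).prod
          ((ContinuousLinearMap.fst ℝ (Space n) ℝ ∘L (e.symm : Space (n + 1) →L[ℝ] Space n × ℝ)) ∘L
            .snd ℝ ℝ (Space (n + 1)))))

theorem gradient_graphDefect (he : IsSplitting e) {q : ℝ × Space (n + 1)}
    (hf : DifferentiableAt ℝ f (q.1, (e.symm q.2).1)) :
    ∇ (fun x => graphDefect e f (q.1, x)) q.2 = upNormal e f (q.1, (e.symm q.2).1) := by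
  refine ext_inner_right ℝ fun v => ?_
  have h := (HasFDerivAt.comp (g := graphDefect e f) (f := fun x => (q.1, x)) q.2
    (hasFDerivAt_graphDefect (q := q) hf) (hasFDerivAt_prodMk_right q.1 q.2)).fderiv
  change fderiv ℝ (fun x => graphDefect e f (q.1, x)) q.2 = _ at h
  rw [inner_gradient, inner_upNormal' he, h]
  simp

theorem contDiffAt_graphDefect {q : ℝ × Space (n + 1)}
    (hf : ContDiffAt ℝ 2 f (q.1, (e.symm q.2).1)) : ContDiffAt ℝ 2 (graphDefect e f) q := by
  have h1 : ContDiff ℝ 2 (fun q : ℝ × Space (n + 1) => e.symm q.2) :=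
    e.symm.contDiff.comp contDiff_snd
  refine ContDiffAt.sub h1.snd.contDiffAt ?_
  exact hf.comp q (f := fun q : ℝ × Space (n + 1) => (q.1, (e.symm q.2).1))
    (contDiff_fst.prodMk h1.fst).contDiffAt

namespace IsGraphChart

theorem tendsto_param (p : Space (n + 1)) (e : (Space n × ℝ) ≃L[ℝ] Space (n + 1)) :
    Tendsto (fun q : ℝ × Space (n + 1) => (q.1, (e.symm q.2).1)) (𝓝 (0, p))
      (𝓝 (0, (e.symm p).1)) := by
  have : Continuous (fun q : ℝ × Space (n + 1) => (q.1, (e.symm q.2).1)) := by fun_prop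
  exact this.tendsto _

theorem eventually_mem_iff (h : IsGraphChart A p e f) :
    ∀ᶠ q in 𝓝 ((0 : ℝ), p), (q.2 ∈ A q.1 ↔ graphDefect e f q ≤ 0) := by
  have hc : Tendsto (fun q : ℝ × Space (n + 1) => (q.1, e.symm q.2)) (𝓝 (0, p))
      (𝓝 (0, e.symm p)) := by
    have : Continuous (fun q : ℝ × Space (n + 1) => (q.1, e.symm q.2)) := by fun_prop
    exact this.tendsto _
  filter_upwards [hc.eventually h.mem_iff] with q hq
  rw [e.apply_symm_apply] at hq
  rw [hq, graphDefect, sub_nonpos]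

theorem eventually_isDefiningAt (h : IsGraphChart A p e f) :
    ∀ᶠ q in 𝓝 ((0 : ℝ), p), graphDefect e f q = 0 →
      IsDefiningAt (A q.1) (fun x => graphDefect e f (q.1, x)) q.2 := by
  filter_upwards [h.eventually_mem_iff.eventually_nhds,
    (tendsto_param p e).eventually (eventually_contDiffAt h.contDiffAt)] with q h1 h2 h0
  refine ⟨?_, h0, ?_, ?_⟩
  · exact (contDiffAt_graphDefect h2).comp q.2 (f := fun x => (q.1, x))
      (contDiff_prodMk_right q.1).contDiffAt
  · rw [← gradient_ne_zero_iff, gradient_graphDefect h.isSplitting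
      (h2.differentiableAt (by norm_num)), ← norm_pos_iff]
    exact lt_of_lt_of_le one_pos (one_le_norm_upNormal h.isSplitting _)
  · have : Tendsto (fun x => (q.1, x)) (𝓝 q.2) (𝓝 q) :=
      (Continuous.prodMk_right q.1).tendsto q.2
    exact this.eventually h1

theorem eventually_mem_frontier_iff (h : IsGraphChart A p e f) :
    ∀ᶠ q in 𝓝 ((0 : ℝ), p), (q.2 ∈ frontier (A q.1) ↔ graphDefect e f q = 0) := by
  filter_upwards [h.eventually_mem_iff.eventually_nhds, h.eventually_isDefiningAt,
    (tendsto_param p e).eventually (eventually_contDiffAt h.contDiffAt)] with q h1 h2 h3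
  refine ⟨fun hq => ?_, fun h0 => (h2 h0).mem_frontier⟩
  have ht : Tendsto (fun x => (q.1, x)) (𝓝 q.2) (𝓝 q) :=
    (Continuous.prodMk_right q.1).tendsto q.2
  refine eq_zero_of_mem_frontier (F := fun x => graphDefect e f (q.1, x)) (ht.eventually h1) ?_ hq
  exact ContinuousAt.comp (f := fun x => (q.1, x)) (contDiffAt_graphDefect h3).continuousAt
    (Continuous.prodMk_right q.1).continuousAt

theorem eventually_outerNormal_eq (h : IsGraphChart A p e f) :
    ∀ᶠ q in 𝓝 ((0 : ℝ), p), q.2 ∈ frontier (A q.1) →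
      outerNormal (A q.1) q.2 = ‖upNormal e f (q.1, (e.symm q.2).1)‖⁻¹ •
        upNormal e f (q.1, (e.symm q.2).1) := by
  filter_upwards [h.eventually_isDefiningAt, h.eventually_mem_frontier_iff,
    (tendsto_param p e).eventually (eventually_contDiffAt h.contDiffAt)] with q h1 h2 h3 h4
  rw [(h1 (h2.1 h4)).outerNormal_eq, gradient_graphDefect h.isSplitting
    (h3.differentiableAt (by norm_num))]

end IsGraphChart

/-- Kinematic boundary condition: the vertical speed of the graph is the normal component of the
velocity field. -/
theorem IsGraphChart.eventually_fderiv_eq_inner {E : Set (Space (n + 1))} {ε₀ : ℝ}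
    {Φ : ℝ → (Space (n + 1) ≃ₘ^2⟮𝓘(ℝ, Space (n + 1)), 𝓘(ℝ, Space (n + 1))⟯ Space (n + 1))}
    (hΦ : IsC2Family ε₀ Φ) (h : IsGraphChart (fun ε => Φ ε '' E) p e f) :
    ∀ᶠ x in 𝓝 p, x ∈ frontier E → fderiv ℝ f (0, (e.symm x).1) (1, 0) =
      inner ℝ (deriv (fun ε => Φ ε x) 0) (upNormal e f (0, (e.symm x).1)) := by
  have ht : Tendsto (fun x => ((0 : ℝ), x)) (𝓝 p) (𝓝 (0, p)) :=
    (Continuous.prodMk_right (0 : ℝ)).tendsto p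
  filter_upwards [ht.eventually h.eventually_mem_frontier_iff.eventually_nhds,
    (ht.eventually ((tendsto_param p e).eventually (eventually_contDiffAt h.contDiffAt)))]
    with x h1 h2 hx
  have hΦd : HasDerivAt (fun ε => Φ ε x) (deriv (fun ε => Φ ε x) 0) 0 := by
    refine DifferentiableAt.hasDerivAt ?_
    exact ((hΦ.contDiffAt hΦ.zero_mem x).differentiableAt (by norm_num)).comp (0 : ℝ)
      (f := fun ε : ℝ => (ε, x)) (by fun_prop)
  have hcurve : HasDerivAt (fun ε => (ε, Φ ε x)) (1, deriv (fun ε => Φ ε x) 0) (0 : ℝ) :=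
    (hasDerivAt_id _).prodMk hΦd
  have hc0 : ((0 : ℝ), Φ 0 x) = (0, x) := by rw [hΦ.zero]
  -- A boundary point stays on the moving boundary along its trajectory, so the defect vanishes
  -- identically in time. Differentiating at time zero is the claimed identity.
  have hzero : (graphDefect e f ∘ fun ε => (ε, Φ ε x)) =ᶠ[𝓝 0] fun _ => 0 := by
    have hcont : Tendsto (fun ε => (ε, Φ ε x)) (𝓝 (0 : ℝ)) (𝓝 (0, x)) := by
      have := hcurve.continuousAt.tendsto
      rwa [hc0] at this
    filter_upwards [hcont.eventually h1] with ε hε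
    refine hε.1 ?_
    rw [frontier_image_diffeo]
    exact ⟨x, hx, rfl⟩
  have hD := hasFDerivAt_graphDefect (e := e) (f := f) (q := ((0 : ℝ), x))
    (h2.differentiableAt (by norm_num))
  rw [← hc0] at hD
  have hd := (hD.comp_hasDerivAt (0 : ℝ) hcurve).unique
    ((hasDerivAt_const (0 : ℝ) (0 : ℝ)).congr_of_eventuallyEq hzero)
  rw [real_inner_comm, inner_upNormal' h.isSplitting]
  set v := deriv (fun ε => Φ ε x) 0
  have hlin : fderiv ℝ f (0, (e.symm x).1) (1, (e.symm v).1) =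
      fderiv ℝ f (0, (e.symm x).1) (1, 0) + fderiv ℝ f (0, (e.symm x).1) (0, (e.symm v).1) := by
    rw [← map_add]; simp
  simp [hΦ.zero] at hd
  linarith

end Chart

/-! ### Uniform flatness of the boundary -/

section Flat

theorem signedIndicator_of_mem {d : ℕ} {S : Set (Space d)} {y : Space d} (h : y ∈ S) :
    signedIndicator S y = -1 := by
  simp [signedIndicator, h]

theorem signedIndicator_of_notMem {d : ℕ} {S : Set (Space d)} {y : Space d} (h : y ∉ S) :
    signedIndicator S y = 1 := by
  simp [signedIndicator, h]

theorem abs_signedIndicator {d : ℕ} (S : Set (Space d)) (y : Space d) :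
    |signedIndicator S y| = 1 := by
  by_cases h : y ∈ S
  · simp [signedIndicator_of_mem h]
  · simp [signedIndicator_of_notMem h]

/-- Near the boundary point `x`, the set `S` differs from a halfspace only in the region
`{|z·ν| ≤ C |z|²}`. -/
def FlatAt {d : ℕ} (S : Set (Space d)) (x : Space d) (C r₀ : ℝ) : Prop :=
  ∃ ν : Space d, ‖ν‖ = 1 ∧ ∀ z : Space d, ‖z‖ < r₀ → C * ‖z‖ ^ 2 < |inner ℝ ν z| →
    signedIndicator S (x + z) + signedIndicator S (x - z) = 0

theorem FlatAt.mono {d : ℕ} {S : Set (Space d)} {x : Space d} {C C' r₀ r₀' : ℝ}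
    (h : FlatAt S x C r₀) (hC : C ≤ C') (hr : r₀' ≤ r₀) : FlatAt S x C' r₀' := by
  obtain ⟨ν, hν, h⟩ := h
  refine ⟨ν, hν, fun z hz hz' => h z (hz.trans_le hr) (lt_of_le_of_lt ?_ hz')⟩
  gcongr

/-- The derivative is locally Lipschitz, and the mean value inequality is applied to `f - f'(a)` on
a segment. The constant must not depend on the base point `a`, which later ranges over nearby
boundary points and times. -/
theorem exists_taylor_bound {X : Type*} [NormedAddCommGroup X] [NormedSpace ℝ X] {f : X → ℝ}
    {u : X} (hf : ContDiffAt ℝ 2 f u) : ∃ K : ℝ, 0 ≤ K ∧ ∃ ρ > 0, ∀ a ∈ Metric.ball u ρ,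
      ∀ b ∈ Metric.ball u ρ, |f b - f a - fderiv ℝ f a (b - a)| ≤ K * ‖b - a‖ ^ 2 := by
  have h1 : ContDiffAt ℝ 1 (fderiv ℝ f) u := hf.fderiv_right (by norm_num)
  obtain ⟨K, s, hs, hK⟩ := h1.exists_lipschitzOnWith
  have h2 : ∀ᶠ y in 𝓝 u, DifferentiableAt ℝ f y ∧ y ∈ s := by
    filter_upwards [eventually_contDiffAt hf, hs] with y hy hys
    exact ⟨hy.differentiableAt (by norm_num), hys⟩
  obtain ⟨ρ, hρ, hball⟩ := Metric.eventually_nhds_iff_ball.1 h2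
  refine ⟨K, K.2, ρ, hρ, fun a ha b hb => ?_⟩
  have hseg : segment ℝ a b ⊆ Metric.ball u ρ := (convex_ball u ρ).segment_subset ha hb
  have := (convex_segment a b).norm_image_sub_le_of_norm_hasFDerivWithin_le' (f := f)
    (f' := fun y => fderiv ℝ f y) (φ := fderiv ℝ f a) (C := K * ‖b - a‖)
    (fun y hy => (hball y (hseg hy)).1.hasFDerivAt.hasFDerivWithinAt) (fun y hy => ?_)
    (left_mem_segment ℝ a b) (right_mem_segment ℝ a b)
  · rw [Real.norm_eq_abs] at this
    rw [pow_two, ← mul_assoc]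
    exact this
  · have h3 := hK.dist_le_mul y (hball y (hseg hy)).2 a (hball a ha).2
    rw [dist_eq_norm] at h3
    refine h3.trans ?_
    gcongr
    rw [dist_eq_norm]
    exact norm_sub_le_of_mem_segment hy

variable {n : ℕ}

/-- With `N` the upward normal, `⟨N, z⟩` is the height of `x + z` over the tangent plane. Once it
exceeds the Taylor error `K|z|²` in absolute value, its sign decides membership of `x + z`; the
height of `x - z` has the opposite sign, so exactly one of the two points lies in the set. -/
theorem IsGraphChart.eventually_flatAt {A : ℝ → Set (Space (n + 1))} {p : Space (n + 1)}
    {e : (Space n × ℝ) ≃L[ℝ] Space (n + 1)} {f : ℝ × Space n → ℝ} (h : IsGraphChart A p e f) :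
    ∃ C r₀ : ℝ, 0 ≤ C ∧ 0 < r₀ ∧ ∀ᶠ q in 𝓝 ((0 : ℝ), p), q.2 ∈ frontier (A q.1) →
      FlatAt (A q.1) q.2 C r₀ := by
  obtain ⟨K, hK, ρ, hρ, hT⟩ := exists_taylor_bound h.contDiffAt
  obtain ⟨ρ', hρ', hm⟩ := Metric.eventually_nhds_iff_ball.1 h.mem_iff
  -- Half the radius: the base point and its translates by vectors shorter than `r` all remain in
  -- the Taylor ball and in the chart.
  set r := min ρ ρ' / 2 with hr
  have hmin : 0 < min ρ ρ' := lt_min hρ hρ'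
  have hrpos : 0 < r := by positivity
  have hcont : Tendsto (fun q : ℝ × Space (n + 1) => (q.1, e.symm q.2)) (𝓝 (0, p))
      (𝓝 (0, e.symm p)) := by
    have : Continuous (fun q : ℝ × Space (n + 1) => (q.1, e.symm q.2)) := by fun_prop
    exact this.tendsto _
  refine ⟨K, r, hK, hrpos, ?_⟩
  filter_upwards [h.eventually_mem_frontier_iff, hcont.eventually (Metric.ball_mem_nhds _ hrpos)]
    with q h1 h2 hq
  obtain ⟨ε, x⟩ := q
  simp only at hq h1 h2 ⊢
  have hx := h1.1 hq
  rw [graphDefect, sub_eq_zero] at hx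
  set y := e.symm x with hy
  have hex : e y = x := e.apply_symm_apply x
  have hyb : |ε| < r ∧ ‖y.1 - (e.symm p).1‖ < r ∧ |y.2 - (e.symm p).2| < r := by
    rw [dist_eq_norm] at h2
    have := max_lt_iff.1 h2
    refine ⟨by simpa using this.1, max_lt_iff.1 this.2⟩
  have hN := one_le_norm_upNormal (f := f) h.isSplitting (ε, y.1)
  set N := upNormal e f (ε, y.1) with hNdef
  have hNpos : 0 < ‖N‖ := by linarith
  refine ⟨‖N‖⁻¹ • N, by rw [norm_smul, norm_inv, norm_norm, inv_mul_cancel₀ hNpos.ne'], ?_⟩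
  have key : ∀ w : Space n × ℝ, ‖e w‖ < r →
      (x + e w ∈ A ε ↔ y.2 + w.2 ≤ f (ε, y.1 + w.1)) ∧
      |f (ε, y.1 + w.1) - f (ε, y.1) - fderiv ℝ f (ε, y.1) (0, w.1)| ≤ K * ‖e w‖ ^ 2 := by
    intro w hw
    have hw1 := h.isSplitting.norm_fst_le w
    have hw2 := h.isSplitting.abs_snd_le w
    have hb1 : (ε, y + w) ∈ Metric.ball ((0 : ℝ), e.symm p) (min ρ ρ') := by
      rw [mem_ball_iff_norm]
      refine max_lt ?_ (max_lt ?_ ?_)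
      · change ‖ε - 0‖ < _
        rw [sub_zero, Real.norm_eq_abs]
        linarith [hyb.1]
      · calc ‖y.1 + w.1 - (e.symm p).1‖ = ‖(y.1 - (e.symm p).1) + w.1‖ := by congr 1; abel
          _ ≤ _ := norm_add_le _ _
          _ < min ρ ρ' := by linarith [hyb.2.1]
      · calc |y.2 + w.2 - (e.symm p).2| = |(y.2 - (e.symm p).2) + w.2| := by congr 1; ring
          _ ≤ _ := abs_add_le _ _
          _ < min ρ ρ' := by linarith [hyb.2.2]
    constructor
    · have := hm _ (Metric.ball_subset_ball (min_le_right ρ ρ') hb1)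
      rw [← hex, ← map_add]
      exact this
    · have hab : ∀ v : Space n, ‖v - (e.symm p).1‖ < ρ →
          (ε, v) ∈ Metric.ball ((0 : ℝ), (e.symm p).1) ρ := fun v hv => by
        rw [mem_ball_iff_norm]
        refine max_lt ?_ hv
        change ‖ε - 0‖ < _
        rw [sub_zero, Real.norm_eq_abs]
        linarith [hyb.1, min_le_left ρ ρ']
      have hb2 : ‖y.1 + w.1 - (e.symm p).1‖ < ρ := by
        rw [mem_ball_iff_norm] at hb1
        exact (max_lt_iff.1 (max_lt_iff.1 hb1).2).1.trans_le (min_le_left _ _)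
      have := hT (ε, y.1) (hab _ (by linarith [hyb.2.1, min_le_left ρ ρ'])) (ε, y.1 + w.1)
        (hab _ hb2)
      simp only [Prod.mk_sub_mk, sub_self, add_sub_cancel_left] at this
      refine this.trans ?_
      gcongr
      simpa using hw1
  intro z hz hz'
  set w := e.symm z with hw
  have hez : e w = z := e.apply_symm_apply z
  obtain ⟨m1, t1⟩ := key w (by rwa [hez])
  obtain ⟨m2, t2⟩ := key (-w) (by rwa [map_neg, norm_neg, hez])
  rw [map_neg, norm_neg] at t2
  rw [map_neg, ← sub_eq_add_neg] at m2
  rw [hez] at m1 m2 t1 t2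
  have hin : inner ℝ N z = w.2 - fderiv ℝ f (ε, y.1) (0, w.1) := inner_upNormal' h.isSplitting _ _
  -- Since `|N| ≥ 1`, largeness of `⟨N/|N|, z⟩` implies that of `⟨N, z⟩`.
  have hlarge : K * ‖z‖ ^ 2 < |inner ℝ N z| := by
    refine hz'.trans_le ?_
    rw [inner_smul_left, conj_trivial, abs_mul, abs_inv, abs_norm]
    exact mul_le_of_le_one_left (abs_nonneg _) (inv_le_one_of_one_le₀ hN)
  have hneg : fderiv ℝ f (ε, y.1) (0, (-w).1) = - fderiv ℝ f (ε, y.1) (0, w.1) := by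
    rw [Prod.fst_neg, ← ContinuousLinearMap.map_neg, Prod.neg_mk, neg_zero]
  rw [hneg] at t2
  rw [hin] at hlarge
  rw [abs_le] at t1 t2
  simp only [Prod.snd_neg] at m2
  rcases lt_abs.1 hlarge with hpos | hpos
  · have n1 : x + z ∉ A ε := fun hmem => by linarith [m1.1 hmem]
    have n2 : x - z ∈ A ε := m2.2 (by linarith)
    rw [signedIndicator_of_mem n2, signedIndicator_of_notMem n1]
    norm_num
  · have n1 : x + z ∈ A ε := m1.2 (by linarith)
    have n2 : x - z ∉ A ε := fun hmem => by linarith [m2.1 hmem]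
    rw [signedIndicator_of_mem n1, signedIndicator_of_notMem n2]
    norm_num

/-- Compactness of the boundary: each chart gives constants on a product neighbourhood in time and
space, and finitely many such neighbourhoods suffice. Uniformity in `ε` is what later permits
exchanging the limit with the derivative. -/
theorem IsC2Domain.exists_eventually_flatAt {E : Set (Space (n + 1))} (hE : IsC2Domain E) {ε₀ : ℝ}
    {Φ : ℝ → (Space (n + 1) ≃ₘ^2⟮𝓘(ℝ, Space (n + 1)), 𝓘(ℝ, Space (n + 1))⟯ Space (n + 1))}
    (hΦ : IsC2Family ε₀ Φ) :
    ∃ C r₀ : ℝ, 0 ≤ C ∧ 0 < r₀ ∧ ∀ᶠ ε in 𝓝 (0 : ℝ), ∀ x ∈ frontier E,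
      FlatAt (Φ ε '' E) (Φ ε x) C r₀ := by
  refine hE.isCompact_frontier.induction_on
    (p := fun S => ∃ C r₀ : ℝ, 0 ≤ C ∧ 0 < r₀ ∧ ∀ᶠ ε in 𝓝 (0 : ℝ), ∀ x ∈ S,
      FlatAt (Φ ε '' E) (Φ ε x) C r₀) ?_ ?_ ?_ ?_
  · exact ⟨0, 1, le_rfl, one_pos, by simp⟩
  · rintro S T hST ⟨C, r, hC, hr, h⟩
    exact ⟨C, r, hC, hr, h.mono fun ε hε x hx => hε x (hST hx)⟩
  · rintro S T ⟨C, r, hC, hr, h⟩ ⟨C', r', hC', hr', h'⟩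
    refine ⟨max C C', min r r', le_max_of_le_left hC, lt_min hr hr', ?_⟩
    filter_upwards [h, h'] with ε hε hε' x hx
    rcases hx with hx | hx
    · exact (hε x hx).mono (le_max_left _ _) (min_le_left _ _)
    · exact (hε' x hx).mono (le_max_right _ _) (min_le_right _ _)
  · intro p hp
    obtain ⟨e, f, hch⟩ := hE.exists_isGraphChart hΦ hp
    obtain ⟨C, r, hC, hr, h⟩ := hch.eventually_flatAt
    have hc : Tendsto (fun q : ℝ × Space (n + 1) => (q.1, Φ q.1 q.2)) (𝓝 (0, p)) (𝓝 (0, p)) := by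
      have h1 := (hΦ.contDiffAt hΦ.zero_mem p).continuousAt
      have h2 : ContinuousAt (fun q : ℝ × Space (n + 1) => (q.1, Φ q.1 q.2)) (0, p) :=
        continuousAt_fst.prodMk h1
      simpa [ContinuousAt, hΦ.zero] using h2
    have h3 := hc.eventually h
    rw [nhds_prod_eq, eventually_prod_iff] at h3
    obtain ⟨pa, hpa, pb, hpb, hab⟩ := h3
    refine ⟨{x | pb x} ∩ frontier E, inter_mem (nhdsWithin_le_nhds hpb) self_mem_nhdsWithin,
      C, r, hC, hr, ?_⟩
    filter_upwards [hpa] with ε hε x hx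
    refine hab hε hx.1 ?_
    change Φ ε x ∈ frontier (Φ ε '' E)
    rw [frontier_image_diffeo]
    exact ⟨x, hx.2, rfl⟩

theorem IsC2Domain.exists_flatAt {E : Set (Space (n + 1))} (hE : IsC2Domain E) :
    ∃ C r₀ : ℝ, 0 ≤ C ∧ 0 < r₀ ∧ ∀ x ∈ frontier E, FlatAt E x C r₀ := by
  obtain ⟨C, r, hC, hr, h⟩ := hE.exists_eventually_flatAt (isC2Family_refl (n + 1))
  refine ⟨C, r, hC, hr, fun x hx => ?_⟩
  simpa using h.self_of_nhds x hx

end Flat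

open scoped NNReal


/-! ### The area formula for graphs -/

section Hausdorff

/-- The hypothesis forces `F` to be constant on the fibres of `L`, so `F` factors through `L` by a
`K`-Lipschitz map. With two maps on one parameter set, a graph and its tangent plane can be compared
in both directions. -/
theorem euclideanHausdorffMeasure_image_le {ι X Y : Type*} [MetricSpace X] [MeasurableSpace X]
    [BorelSpace X] [MetricSpace Y] [MeasurableSpace Y] [BorelSpace Y] {F : ι → X} {L : ι → Y}
    {S : Set ι} {K : ℝ≥0} (h : ∀ a ∈ S, ∀ b ∈ S, dist (F a) (F b) ≤ K * dist (L a) (L b)) (m : ℕ) :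
    μHE[m] (F '' S) ≤ (K : ℝ≥0∞) ^ m * μHE[m] (L '' S) := by
  rcases S.eq_empty_or_nonempty with rfl | ⟨s, hs⟩
  · simp
  have : Nonempty ι := ⟨s⟩
  set g := Function.invFunOn L S
  have hg : ∀ a ∈ S, g (L a) ∈ S ∧ L (g (L a)) = L a := fun a ha =>
    ⟨Function.invFunOn_mem ⟨a, ha, rfl⟩, Function.invFunOn_eq ⟨a, ha, rfl⟩⟩
  have himg : F '' S = (F ∘ g) '' (L '' S) := by
    rw [Set.image_image]
    refine Set.image_congr fun a ha => ?_
    have := h a ha _ (hg a ha).1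
    rw [(hg a ha).2, dist_self, mul_zero] at this
    exact dist_le_zero.1 this
  have hlip : LipschitzOnWith K (F ∘ g) (L '' S) := by
    refine LipschitzOnWith.of_dist_le_mul ?_
    rintro _ ⟨a, ha, rfl⟩ _ ⟨b, hb, rfl⟩
    have := h _ (hg a ha).1 _ (hg b hb).1
    rwa [(hg a ha).2, (hg b hb).2] at this
  have := hlip.hausdorffMeasure_image_le (d := m) (by positivity)
  rw [ENNReal.rpow_natCast] at this
  rw [himg, Measure.euclideanHausdorffMeasure_def, Measure.euclideanHausdorffMeasure_def,
    Measure.smul_apply, Measure.smul_apply, ENNReal.smul_def, ENNReal.smul_def, smul_eq_mul,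
    smul_eq_mul, mul_left_comm]
  gcongr

variable {n : ℕ}

theorem euclideanHausdorffMeasure_image_le_volume {X : Type*} [MetricSpace X] [MeasurableSpace X]
    [BorelSpace X] {F : Space n → X} {S : Set (Space n)} {K : ℝ≥0} (h : LipschitzOnWith K F S) :
    μHE[n] (F '' S) ≤ (K : ℝ≥0∞) ^ n * volume S := by
  have := euclideanHausdorffMeasure_image_le (F := F) (L := id) (S := S) (K := K)
    (fun a ha b hb => h.dist_le_mul a ha b hb) n
  rwa [Set.image_id, EuclideanSpace.euclideanHausdorffMeasure_eq_volume] at this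

/-- The linear graph map `v ↦ (v, l v)` in an orthogonal splitting. -/
noncomputable def graphLinear (e : (Space n × ℝ) ≃L[ℝ] Space (n + 1)) (l : Space n →L[ℝ] ℝ) :
    Space n →L[ℝ] Space (n + 1) :=
  (e : (Space n × ℝ) →L[ℝ] Space (n + 1)) ∘L ((ContinuousLinearMap.id ℝ (Space n)).prod l)

/-- The Gram matrix of the images of the standard basis is `1 + u uᵀ`, where `u` represents `l`; its
determinant is `1 + |u|²`. -/
theorem normDet_graphLinear {e : (Space n × ℝ) ≃L[ℝ] Space (n + 1)} (he : IsSplitting e)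
    (l : Space n →L[ℝ] ℝ) :
    (graphLinear e l : Space n →ₗ[ℝ] Space (n + 1)).normDet = √(1 + ‖l‖ ^ 2) := by
  rw [← Real.sqrt_sq (LinearMap.normDet_nonneg _)]
  congr 1
  have h := (graphLinear e l : Space n →ₗ[ℝ] Space (n + 1)).normDet_sq_eq_det_gram
    (EuclideanSpace.basisFun (Fin n) ℝ)
  simp only [RCLike.ofReal_real_eq_id, id_eq] at h
  rw [h]
  set u : Fin n → ℝ := fun i => l (EuclideanSpace.basisFun (Fin n) ℝ i) with hu
  have hgram : Matrix.gram ℝ (fun i => (graphLinear e l : Space n →ₗ[ℝ] Space (n + 1))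
      (EuclideanSpace.basisFun (Fin n) ℝ i)) =
      1 + Matrix.replicateCol Unit u * Matrix.replicateRow Unit u := by
    ext i j
    rw [Matrix.gram_apply]
    change inner ℝ (e (_, _)) (e (_, _)) = _
    rw [he.inner_eq]
    simp only [Matrix.add_apply, Matrix.mul_apply,
      Matrix.replicateCol_apply, Matrix.replicateRow_apply, Finset.univ_unique, Finset.sum_const,
      Finset.card_singleton, one_smul, hu]
    congr 1
    change inner ℝ (EuclideanSpace.basisFun (Fin n) ℝ i) (EuclideanSpace.basisFun (Fin n) ℝ j) =
      (1 : Matrix (Fin n) (Fin n) ℝ) i j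
    rw [OrthonormalBasis.inner_eq_ite, Matrix.one_apply]
  rw [hgram, Matrix.det_one_add_replicateCol_mul_replicateRow]
  congr 1
  have hl : ‖l‖ = ‖(InnerProductSpace.toDual ℝ (Space n)).symm l‖ := by simp
  rw [hl, EuclideanSpace.norm_sq_eq]
  simp only [dotProduct]
  refine Finset.sum_congr rfl fun i _ => ?_
  have : u i = (InnerProductSpace.toDual ℝ (Space n)).symm l i := by
    rw [hu]
    change l (EuclideanSpace.basisFun (Fin n) ℝ i) = _
    rw [← InnerProductSpace.toDual_symm_apply (𝕜 := ℝ), EuclideanSpace.basisFun_apply,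
      EuclideanSpace.inner_single_right]
    simp
  rw [this, Real.norm_eq_abs, sq_abs, pow_two]

theorem norm_le_graphLinear {e : (Space n × ℝ) ≃L[ℝ] Space (n + 1)} (he : IsSplitting e)
    (l : Space n →L[ℝ] ℝ) (v : Space n) : ‖v‖ ≤ ‖graphLinear e l v‖ :=
  he.norm_fst_le (v, l v)

theorem euclideanHausdorffMeasure_graphLinear_image {e : (Space n × ℝ) ≃L[ℝ] Space (n + 1)}
    (he : IsSplitting e) (l : Space n →L[ℝ] ℝ) (S : Set (Space n)) :
    μHE[n] (graphLinear e l '' S) = ENNReal.ofReal (√(1 + ‖l‖ ^ 2)) * volume S := by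
  have h := (graphLinear e l : Space n →ₗ[ℝ] Space (n + 1)
    ).euclideanHausdorffMeasure_image_eq_normDet_mul_volume S
  rw [normDet_graphLinear he, finrank_euclideanSpace_fin] at h
  exact h

section Graph

variable {e : (Space n × ℝ) ≃L[ℝ] Space (n + 1)} {g : Space n → ℝ} {g' : Space n → Space n →L[ℝ] ℝ}
  {B : Set (Space n)}

theorem lipschitzOnWith_graph (e : (Space n × ℝ) ≃L[ℝ] Space (n + 1)) {K : ℝ≥0}
    (hK : LipschitzOnWith K g B) :
    LipschitzOnWith (‖(e : (Space n × ℝ) →L[ℝ] Space (n + 1))‖₊ * max 1 K)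
      (fun y => e (y, g y)) B :=
  e.toContinuousLinearMap.lipschitz.comp_lipschitzOnWith
    ((LipschitzWith.id.lipschitzOnWith).prodMk hK)

/-- Two-sided infinitesimal comparison of a graph with its tangent plane. -/
theorem eventually_graph_measure_bounds (he : IsSplitting e) {x : Space n} {l : Space n →L[ℝ] ℝ}
    (hg : HasStrictFDerivAt g l x) {K : ℝ≥0} (hK : 1 < K) : ∀ᶠ r in 𝓝[>] (0 : ℝ),
      μHE[n] ((fun y => e (y, g y)) '' Metric.closedBall x r) ≤
        (K : ℝ≥0∞) ^ n * (ENNReal.ofReal (√(1 + ‖l‖ ^ 2)) * volume (Metric.closedBall x r)) ∧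
      ENNReal.ofReal (√(1 + ‖l‖ ^ 2)) * volume (Metric.closedBall x r) ≤
        (K : ℝ≥0∞) ^ n * μHE[n] ((fun y => e (y, g y)) '' Metric.closedBall x r) := by
  have hη : (0 : ℝ) < K - 1 := sub_pos.2 (by exact_mod_cast hK)
  -- Strict differentiability controls all pairs of points in the small ball, not only those
  -- containing the centre.
  have h1 := hg.isLittleO.bound hη
  obtain ⟨δ, hδ, hball⟩ := Metric.eventually_nhds_iff_ball.1 h1
  filter_upwards [Ioo_mem_nhdsGT hδ] with r hr
  have hmem : ∀ y ∈ Metric.closedBall x r, ∀ z ∈ Metric.closedBall x r,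
      |g y - g z - l (y - z)| ≤ (K - 1) * ‖y - z‖ := by
    intro y hy z hz
    refine hball (y, z) ?_
    rw [← ball_prod_same]
    exact ⟨Metric.closedBall_subset_ball hr.2 hy, Metric.closedBall_subset_ball hr.2 hz⟩
  have hsub : ∀ y z, e (y, g y) - e (z, g z) - (graphLinear e l y - graphLinear e l z) =
      e (0, g y - g z - l (y - z)) := by
    intro y z
    change e (y, g y) - e (z, g z) - (e (y, l y) - e (z, l z)) = _
    rw [← map_sub, ← map_sub, ← map_sub]
    congr 1
    ext1 <;> simp
  have hvert : ∀ t : ℝ, ‖e ((0 : Space n), t)‖ = |t| := by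
    intro t
    have := he.norm_sq (0, t)
    rw [← abs_norm]
    refine (sq_eq_sq_iff_abs_eq_abs _ _).1 ?_
    simpa using this
  -- The increments of the graph map and of its linearization differ by at most `(K - 1)|y - z|`.
  -- Both are at least `|y - z|` in norm, so each is at most `K` times the other.
  have hdist : ∀ y ∈ Metric.closedBall x r, ∀ z ∈ Metric.closedBall x r,
      ‖e (y, g y) - e (z, g z) - (graphLinear e l y - graphLinear e l z)‖ ≤
        (K - 1) * ‖y - z‖ := by
    intro y hy z hz
    rw [hsub, hvert]
    exact hmem y hy z hz
  constructor
  · rw [← euclideanHausdorffMeasure_graphLinear_image he]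
    refine euclideanHausdorffMeasure_image_le (fun y hy z hz => ?_) n
    have h2 := norm_le_graphLinear he l (y - z)
    rw [map_sub] at h2
    rw [dist_eq_norm, dist_eq_norm]
    have h3 := norm_le_norm_add_norm_sub' (e (y, g y) - e (z, g z))
      (graphLinear e l y - graphLinear e l z)
    have h4 := hdist y hy z hz
    nlinarith
  · rw [← euclideanHausdorffMeasure_graphLinear_image he]
    refine euclideanHausdorffMeasure_image_le (fun y hy z hz => ?_) n
    have h2 := he.norm_fst_le ((y, g y) - (z, g z))
    rw [map_sub] at h2
    change ‖y - z‖ ≤ _ at h2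
    rw [dist_eq_norm, dist_eq_norm]
    have h3 := norm_le_norm_add_norm_sub (e (y, g y) - e (z, g z))
      (graphLinear e l y - graphLinear e l z)
    have h4 := hdist y hy z hz
    nlinarith

theorem tendsto_graph_measure_div (he : IsSplitting e) {x : Space n} {l : Space n →L[ℝ] ℝ}
    (hg : HasStrictFDerivAt g l x) :
    Tendsto (fun r => μHE[n] ((fun y => e (y, g y)) '' Metric.closedBall x r) /
      volume (Metric.closedBall x r)) (𝓝[>] 0) (𝓝 (ENNReal.ofReal (√(1 + ‖l‖ ^ 2)))) := by
  set J := ENNReal.ofReal (√(1 + ‖l‖ ^ 2)) with hJ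
  have hJtop : J ≠ ⊤ := ENNReal.ofReal_ne_top
  have hcont : ∀ c : ℝ≥0∞, c ≠ ⊤ →
      Tendsto (fun K : ℝ≥0 => (K : ℝ≥0∞) ^ n * c) (𝓝[>] 1) (𝓝 c) := by
    intro c hc
    have h1 : Tendsto (fun K : ℝ≥0 => (K : ℝ≥0∞) ^ n * c) (𝓝 1)
        (𝓝 (((1 : ℝ≥0) : ℝ≥0∞) ^ n * c)) :=
      ENNReal.Tendsto.mul_const (((ENNReal.continuous_pow n).comp
        ENNReal.continuous_coe).tendsto 1) (Or.inr hc)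
    simp only [ENNReal.coe_one, one_pow, one_mul] at h1
    exact h1.mono_left nhdsWithin_le_nhds
  have hvol : ∀ r ∈ Set.Ioi (0 : ℝ), volume (Metric.closedBall x r) ≠ 0 ∧
      volume (Metric.closedBall x r) ≠ ⊤ := fun r hr =>
    ⟨(Metric.measure_closedBall_pos volume x hr).ne', measure_closedBall_lt_top.ne⟩
  refine tendsto_order.2 ⟨fun a ha => ?_, fun a ha => ?_⟩
  · obtain ⟨K, hKa, hK⟩ := (((hcont a (ha.trans_le le_top).ne).eventually (gt_mem_nhds ha)).and
      self_mem_nhdsWithin).exists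
    filter_upwards [eventually_graph_measure_bounds he hg hK, self_mem_nhdsWithin] with r h1 hr
    obtain ⟨v0, vt⟩ := hvol r hr
    rw [ENNReal.lt_div_iff_mul_lt (Or.inl v0) (Or.inl vt)]
    by_contra! hle
    refine absurd h1.2 (not_le.2 ?_)
    calc _ ≤ (K : ℝ≥0∞) ^ n * (a * volume (Metric.closedBall x r)) := by gcongr
      _ = (K : ℝ≥0∞) ^ n * a * volume (Metric.closedBall x r) := by ring
      _ < J * volume (Metric.closedBall x r) := by
        rw [ENNReal.mul_lt_mul_iff_left v0 vt]
        exact hKa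
  · obtain ⟨K, hKa, hK⟩ := (((hcont J hJtop).eventually (gt_mem_nhds ha)).and
      self_mem_nhdsWithin).exists
    filter_upwards [eventually_graph_measure_bounds he hg hK, self_mem_nhdsWithin] with r h1 hr
    obtain ⟨v0, vt⟩ := hvol r hr
    rw [ENNReal.div_lt_iff (Or.inl v0) (Or.inl vt)]
    refine lt_of_le_of_lt h1.1 ?_
    rw [← mul_assoc, ENNReal.mul_lt_mul_iff_left v0 vt]
    exact hKa

/-- Area formula for graphs. -/
theorem restrict_graph_eq_map (he : IsSplitting e) (hB : IsOpen B) (hBfin : volume B ≠ ⊤)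
    (hg : ∀ x ∈ B, HasStrictFDerivAt g (g' x) x) {K : ℝ≥0} (hK : LipschitzOnWith K g B) :
    (μHE[n] : Measure (Space (n + 1))).restrict ((fun y => e (y, g y)) '' B) =
      ((volume.restrict B).withDensity fun x => ENNReal.ofReal (√(1 + ‖g' x‖ ^ 2))).map
        (fun y => e (y, g y)) := by
  set F : Space n → Space (n + 1) := fun y => e (y, g y) with hF
  set π : Space (n + 1) → Space n := fun x => (e.symm x).1 with hπ
  have hπc : Continuous π := by fun_prop
  have hπF : ∀ y, π (F y) = y := fun y => by simp [hπ, hF]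
  have hlip : LipschitzOnWith (‖(e : (Space n × ℝ) →L[ℝ] Space (n + 1))‖₊ * max 1 K) F B :=
    lipschitzOnWith_graph e hK
  have hFm : MeasurableSet (F '' B) :=
    hB.measurableSet.image_of_continuousOn_injOn hlip.continuousOn
      (Function.LeftInverse.injective hπF).injOn
  set lam := (volume : Measure (Space n)).restrict B with hlam
  set μ := (μHE[n] : Measure (Space (n + 1))).restrict (F '' B) with hμ
  have hinter : ∀ A : Set (Space n), F '' B ∩ π ⁻¹' A = F '' (A ∩ B) := by
    intro A
    ext z
    constructor
    · rintro ⟨⟨y, hy, rfl⟩, hz⟩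
      rw [Set.mem_preimage, hπF] at hz
      exact ⟨y, ⟨hz, hy⟩, rfl⟩
    · rintro ⟨y, ⟨hyA, hyB⟩, rfl⟩
      refine ⟨⟨y, hyB, rfl⟩, ?_⟩
      rwa [Set.mem_preimage, hπF]
  have hμ1 : ∀ A : Set (Space n), MeasurableSet A → μ.map π A = μHE[n] (F '' (A ∩ B)) := by
    intro A hA
    rw [Measure.map_apply hπc.measurable hA, hμ,
      Measure.restrict_apply (hπc.measurable hA), Set.inter_comm, hinter]
  have hfinite : IsFiniteMeasure (μ.map π) := by
    refine ⟨?_⟩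
    rw [hμ1 _ MeasurableSet.univ, Set.univ_inter]
    refine lt_of_le_of_lt (euclideanHausdorffMeasure_image_le_volume hlip) ?_
    exact ENNReal.mul_lt_top (ENNReal.pow_lt_top ENNReal.coe_lt_top) hBfin.lt_top
  have hlamfin : IsFiniteMeasure lam := ⟨by rw [hlam]; simpa using hBfin.lt_top⟩
  -- The surface measure is projected to the base. There it is absolutely continuous because the
  -- graph map is Lipschitz, its density is computed by Besicovitch differentiation, and the result
  -- is lifted back, using that lifting after projecting is the identity on the graph.
  have hac : μ.map π ≪ lam := by
    refine Measure.AbsolutelyContinuous.mk fun A hA h0 => ?_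
    rw [hlam, Measure.restrict_apply hA] at h0
    rw [hμ1 A hA]
    refine le_antisymm ?_ zero_le
    refine (euclideanHausdorffMeasure_image_le_volume
      (hlip.mono Set.inter_subset_right)).trans ?_
    rw [h0, mul_zero]
  have hrn : (μ.map π).rnDeriv lam =ᵐ[lam] fun x => ENNReal.ofReal (√(1 + ‖g' x‖ ^ 2)) := by
    have hmem : ∀ᵐ x ∂lam, x ∈ B := ae_restrict_mem hB.measurableSet
    filter_upwards [Besicovitch.ae_tendsto_rnDeriv (μ.map π) lam, hmem] with x hx hxB
    refine tendsto_nhds_unique hx ?_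
    refine (tendsto_graph_measure_div he (hg x hxB)).congr' ?_
    obtain ⟨δ, hδ, hδB⟩ := Metric.isOpen_iff.1 hB x hxB
    filter_upwards [Ioo_mem_nhdsGT hδ] with r hr
    have hsub : Metric.closedBall x r ⊆ B :=
      (Metric.closedBall_subset_ball hr.2).trans hδB
    rw [hμ1 _ Metric.isClosed_closedBall.measurableSet, hlam,
      Measure.restrict_apply Metric.isClosed_closedBall.measurableSet,
      Set.inter_eq_self_of_subset_left hsub]
  have hmain : μ.map π = lam.withDensity fun x => ENNReal.ofReal (√(1 + ‖g' x‖ ^ 2)) := by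
    rw [← Measure.withDensity_rnDeriv_eq _ _ hac]
    exact withDensity_congr_ae hrn
  have hFae : AEMeasurable F (μ.map π) :=
    (hlip.continuousOn.aemeasurable hB.measurableSet).mono_ac hac
  rw [← hmain, AEMeasurable.map_map_of_aemeasurable hFae hπc.measurable.aemeasurable]
  have hid : F ∘ π =ᵐ[μ] id := by
    filter_upwards [ae_restrict_mem hFm] with z hz
    obtain ⟨y, hy, rfl⟩ := hz
    simp [hπF]
  rw [Measure.map_congr hid, Measure.map_id]

end Graph

end Hausdorff


/-! ### Tubes around the boundary and finiteness of its area -/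

section Tube

variable {n : ℕ} {E : Set (Space (n + 1))}

/-- The boundary of a `C²` domain is locally a Lipschitz graph. -/
theorem IsC2Domain.exists_lipschitz_graph (hE : IsC2Domain E) {p : Space (n + 1)}
    (hp : p ∈ frontier E) :
    ∃ e : (Space n × ℝ) ≃L[ℝ] Space (n + 1), IsSplitting e ∧ ∃ g : Space n → ℝ, ∃ K : ℝ≥0,
      LipschitzWith K g ∧ ∃ ρ > 0, ∀ x ∈ Metric.ball p ρ, x ∈ frontier E →
        (e.symm x).2 = g (e.symm x).1 := by
  obtain ⟨e, f, h⟩ := hE.exists_isGraphChart (isC2Family_refl (n + 1)) hp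
  have hg : ContDiffAt ℝ 1 (fun y => f (0, y)) (e.symm p).1 :=
    (h.contDiffAt.comp (e.symm p).1 (f := fun y => ((0 : ℝ), y))
      (contDiff_prodMk_right (0 : ℝ)).contDiffAt).of_le (by norm_num)
  obtain ⟨K, s, hs, hK⟩ := hg.exists_lipschitzOnWith
  obtain ⟨g, hg, hgs⟩ := hK.extend_real
  have ht : Tendsto (fun x => ((0 : ℝ), x)) (𝓝 p) (𝓝 (0, p)) :=
    (Continuous.prodMk_right (0 : ℝ)).tendsto p
  have hs' : ∀ᶠ x in 𝓝 p, (e.symm x).1 ∈ s :=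
    (continuous_fst.comp e.symm.continuous).continuousAt hs
  obtain ⟨ρ, hρ, hball⟩ := Metric.eventually_nhds_iff_ball.1
    ((ht.eventually h.eventually_mem_frontier_iff).and hs')
  refine ⟨e, h.isSplitting, g, K, hg, ρ, hρ, fun x hx hxE => ?_⟩
  have h1 := (hball x hx).1.1 (by simpa using hxE)
  rw [graphDefect, sub_eq_zero] at h1
  rw [← hgs (hball x hx).2]
  exact h1

theorem volume_graph_tube_le (x₀ : Space n) (R c : ℝ) {g : Space n → ℝ} (hg : Continuous g) :
    volume {w : Space n × ℝ | w.1 ∈ Metric.ball x₀ R ∧ |w.2 - g w.1| ≤ c} ≤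
      ENNReal.ofReal (2 * c) * volume (Metric.ball x₀ R) := by
  have hm : MeasurableSet {w : Space n × ℝ | w.1 ∈ Metric.ball x₀ R ∧ |w.2 - g w.1| ≤ c} := by
    have h1 : Measurable fun w : Space n × ℝ => |w.2 - g w.1| := by fun_prop
    exact (Metric.isOpen_ball.preimage continuous_fst).measurableSet.inter
      (measurableSet_le h1 measurable_const)
  rw [Measure.volume_eq_prod, Measure.prod_apply hm,
    ← lintegral_indicator_const Metric.isOpen_ball.measurableSet]
  refine lintegral_mono fun x => ?_
  by_cases hx : x ∈ Metric.ball x₀ R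
  · rw [Set.indicator_of_mem hx, ← Real.volume_closedBall (a := g x)]
    refine measure_mono fun t ht => ?_
    rw [Metric.mem_closedBall, Real.dist_eq]
    exact ht.2
  · rw [Set.indicator_of_notMem hx]
    refine le_of_eq ?_
    convert! measure_empty (μ := (volume : Measure ℝ))
    ext t
    exact ⟨fun h => hx h.1, fun h => h.elim⟩

/-- Tubes around the boundary have volume at most proportional to their radius. -/
theorem IsC2Domain.exists_volume_thickening_le (hE : IsC2Domain E) :
    ∃ C ρ : ℝ, 0 ≤ C ∧ 0 < ρ ∧ ∀ r, 0 < r → r < ρ →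
      volume (Metric.thickening r (frontier E)) ≤ ENNReal.ofReal (C * r) := by
  refine hE.isCompact_frontier.induction_on
    (p := fun S => ∃ C ρ : ℝ, 0 ≤ C ∧ 0 < ρ ∧ ∀ r, 0 < r → r < ρ →
      volume (Metric.thickening r S) ≤ ENNReal.ofReal (C * r)) ?_ ?_ ?_ ?_
  · exact ⟨0, 1, le_rfl, one_pos, by simp⟩
  · rintro S T hST ⟨C, ρ, hC, hρ, h⟩
    exact ⟨C, ρ, hC, hρ, fun r h0 hr =>
      (measure_mono (Metric.thickening_subset_of_subset r hST)).trans (h r h0 hr)⟩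
  · rintro S T ⟨C, ρ, hC, hρ, h⟩ ⟨C', ρ', hC', hρ', h'⟩
    refine ⟨C + C', min ρ ρ', add_nonneg hC hC', lt_min hρ hρ', fun r h0 hr => ?_⟩
    rw [Metric.thickening_union, add_mul, ENNReal.ofReal_add (by positivity) (by positivity)]
    exact (measure_union_le _ _).trans (add_le_add (h r h0 (hr.trans_le (min_le_left _ _)))
      (h' r h0 (hr.trans_le (min_le_right _ _))))
  · intro p hp
    obtain ⟨e, he, g, K, hg, ρ, hρ, hgr⟩ := hE.exists_lipschitz_graph hp
    set x₀ := (e.symm p).1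
    set v := (volume (Metric.ball x₀ (2 * ρ))).toReal with hv
    -- A point within `r` of the graph of a `K`-Lipschitz function has vertical defect at most `r +
    -- K r`. As `r < ρ`, its base point lies in the ball of radius `2ρ`.
    refine ⟨Metric.ball p ρ ∩ frontier E,
      inter_mem (nhdsWithin_le_nhds (Metric.ball_mem_nhds p hρ)) self_mem_nhdsWithin,
      2 * (1 + K) * v, ρ, by positivity, hρ, fun r h0 hr => ?_⟩
    rw [← he.measurePreserving.measure_preimage
      Metric.isOpen_thickening.measurableSet.nullMeasurableSet]
    have hsub : e ⁻¹' Metric.thickening r (Metric.ball p ρ ∩ frontier E) ⊆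
        {w : Space n × ℝ | w.1 ∈ Metric.ball x₀ (2 * ρ) ∧ |w.2 - g w.1| ≤ (1 + K) * r} := by
      intro w hw
      obtain ⟨x, ⟨hxb, hxE⟩, hdist⟩ := Metric.mem_thickening_iff.1 hw
      have hx := hgr x hxb hxE
      set y := e.symm x with hy
      have hey : e y = x := e.apply_symm_apply x
      rw [dist_eq_norm, ← hey, ← map_sub] at hdist
      have h1 := (he.norm_fst_le _).trans_lt hdist
      have h2 := (he.abs_snd_le _).trans_lt hdist
      rw [Metric.mem_ball, dist_eq_norm, ← e.apply_symm_apply p, ← hey, ← map_sub] at hxb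
      have h3 := (he.norm_fst_le _).trans_lt hxb
      rw [Prod.fst_sub] at h1 h3
      rw [Prod.snd_sub] at h2
      constructor
      · rw [Metric.mem_ball, dist_eq_norm]
        calc ‖w.1 - x₀‖ = ‖(w.1 - y.1) + (y.1 - x₀)‖ := by congr 1; abel
          _ ≤ _ := norm_add_le _ _
          _ < 2 * ρ := by linarith
      · have h4 := hg.dist_le_mul y.1 w.1
        rw [Real.dist_eq, dist_comm, dist_eq_norm] at h4
        calc |w.2 - g w.1| = |(w.2 - y.2) + (g y.1 - g w.1)| := by rw [hx]; congr 1; ring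
          _ ≤ |w.2 - y.2| + |g y.1 - g w.1| := abs_add_le _ _
          _ ≤ r + K * r := by
            have : (K : ℝ) * ‖w.1 - y.1‖ ≤ K * r := by gcongr
            linarith
          _ = (1 + K) * r := by ring
    refine (measure_mono hsub).trans ((volume_graph_tube_le x₀ _ _ hg.continuous).trans ?_)
    rw [← ENNReal.ofReal_toReal (measure_ball_lt_top (x := x₀) (r := 2 * ρ)).ne, ← hv,
      ← ENNReal.ofReal_mul (by positivity)]
    refine le_of_eq ?_
    congr 1
    ring

theorem IsC2Domain.volume_frontier (hE : IsC2Domain E) : volume (frontier E) = 0 := by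
  obtain ⟨C, ρ, hC, hρ, h⟩ := hE.exists_volume_thickening_le
  refine le_antisymm ?_ zero_le
  have ht : Tendsto (fun r : ℝ => ENNReal.ofReal (C * r)) (𝓝[>] 0) (𝓝 0) := by
    have h1 : Tendsto (fun r : ℝ => C * r) (𝓝 0) (𝓝 (C * 0)) := (continuous_const_mul C).tendsto 0
    have h2 := ENNReal.tendsto_ofReal h1
    rw [mul_zero, ENNReal.ofReal_zero] at h2
    exact h2.mono_left nhdsWithin_le_nhds
  refine ge_of_tendsto ht ?_
  filter_upwards [Ioo_mem_nhdsGT hρ] with r hr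
  exact (measure_mono (Metric.self_subset_thickening hr.1 _)).trans (h r hr.1 hr.2)

theorem IsC2Domain.hausdorff_frontier_lt_top (hE : IsC2Domain E) : μHE[n] (frontier E) < ⊤ := by
  refine hE.isCompact_frontier.measure_lt_top_of_nhdsWithin fun p hp => ?_
  obtain ⟨e, he, g, K, hg, ρ, hρ, hgr⟩ := hE.exists_lipschitz_graph hp
  refine ⟨Metric.ball p ρ ∩ frontier E,
    inter_mem (nhdsWithin_le_nhds (Metric.ball_mem_nhds p hρ)) self_mem_nhdsWithin, ?_⟩
  have hlip := lipschitzOnWith_graph e (hg.lipschitzOnWith (s := Metric.ball (e.symm p).1 ρ))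
  have hsub : Metric.ball p ρ ∩ frontier E ⊆
      (fun y => e (y, g y)) '' Metric.ball (e.symm p).1 ρ := by
    rintro x ⟨hx, hxE⟩
    refine ⟨(e.symm x).1, ?_, ?_⟩
    · have h1 := he.norm_fst_le (e.symm x - e.symm p)
      rw [map_sub, e.apply_symm_apply, e.apply_symm_apply] at h1
      rw [mem_ball_iff_norm] at hx ⊢
      exact h1.trans_lt hx
    · simp only
      rw [← hgr x hx hxE]
      exact e.apply_symm_apply x
  refine lt_of_le_of_lt (measure_mono hsub) ?_
  refine (euclideanHausdorffMeasure_image_le_volume hlip).trans_lt ?_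
  exact ENNReal.mul_lt_top (ENNReal.pow_lt_top ENNReal.coe_lt_top) measure_ball_lt_top

end Tube

/-! ### Radial profiles on flat regions -/

section Radial

variable {n : ℕ}

/-- The dimensional constant in `lintegral_flat_le`. -/
noncomputable def flatConst (n : ℕ) : ℝ :=
  2 ^ n * 16 * 4 ^ (n + 1) * (volume (Metric.ball (0 : Space n) 1)).toReal /
    (volume (Metric.ball (0 : Space (n + 1)) 1)).toReal

theorem flatConst_nonneg (n : ℕ) : 0 ≤ flatConst n := by
  unfold flatConst; positivity

theorem volume_slab_le {ν : Space (n + 1)} (hν : ‖ν‖ = 1) {R c : ℝ} (hR : 0 ≤ R) :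
    volume {z : Space (n + 1) | ‖z‖ ≤ R ∧ |inner ℝ ν z| ≤ c} ≤
      ENNReal.ofReal (R ^ n * (volume (Metric.ball (0 : Space n) 1)).toReal * (2 * c)) := by
  obtain ⟨e, he, rfl⟩ := exists_isSplitting ν hν
  have hm : MeasurableSet {z : Space (n + 1) | ‖z‖ ≤ R ∧ |inner ℝ (e (0, 1)) z| ≤ c} := by
    have h1 : Measurable fun z : Space (n + 1) => |inner ℝ (e (0, 1)) z| := by fun_prop
    exact (measurableSet_le measurable_norm measurable_const).inter
      (measurableSet_le h1 measurable_const)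
  rw [← he.measurePreserving.measure_preimage hm.nullMeasurableSet]
  have hsub : e ⁻¹' {z : Space (n + 1) | ‖z‖ ≤ R ∧ |inner ℝ (e (0, 1)) z| ≤ c} ⊆
      Metric.closedBall (0 : Space n) R ×ˢ Metric.closedBall (0 : ℝ) c := by
    rintro w ⟨h1, h2⟩
    rw [he.inner_eq] at h2
    refine ⟨?_, ?_⟩
    · rw [mem_closedBall_zero_iff]
      exact (he.norm_fst_le w).trans h1
    · rw [mem_closedBall_zero_iff]
      simpa using h2
  refine (measure_mono hsub).trans ?_
  rw [Measure.volume_eq_prod, Measure.prod_prod, Real.volume_closedBall,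
    Measure.addHaar_closedBall _ _ hR, finrank_euclideanSpace_fin,
    ENNReal.ofReal_mul (q := 2 * c) (by positivity),
    ENNReal.ofReal_mul (p := R ^ n) (by positivity),
    ENNReal.ofReal_toReal measure_ball_lt_top.ne]

theorem volume_annulus_ge {s : ℝ} (hs : 0 < s) :
    ENNReal.ofReal ((s / 4) ^ (n + 1) * (volume (Metric.ball (0 : Space (n + 1)) 1)).toReal) ≤
      volume {z : Space (n + 1) | s / 2 < ‖z‖ ∧ ‖z‖ ≤ s} := by
  -- The annulus contains the ball of radius `s/4` around a point in its middle.
  obtain ⟨x, hx⟩ := exists_norm_eq (Space (n + 1)) (show 0 ≤ 3 / 4 * s by positivity)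
  have hsub : Metric.ball x (s / 4) ⊆ {z : Space (n + 1) | s / 2 < ‖z‖ ∧ ‖z‖ ≤ s} := by
    intro z hz
    rw [mem_ball_iff_norm] at hz
    have h1 := abs_norm_sub_norm_le z x
    rw [abs_le, hx] at h1
    constructor <;> linarith
  refine le_trans (le_of_eq ?_) (measure_mono hsub)
  rw [Measure.addHaar_ball volume x (by positivity), finrank_euclideanSpace_fin,
    ENNReal.ofReal_mul (by positivity), ENNReal.ofReal_toReal measure_ball_lt_top.ne]

/-- Let `J` be the value of `j` on the sphere of radius `s`. On the outer annulus `j ≤ J`, and the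
flat part has volume of order `C s^(n+2)`. On the inner annulus `j ≥ J`, `|z|` is of order `s`, and
the volume is of order `s^(n+1)`. Both sides are thus comparable to `J s^(n+2)`. -/
theorem lintegral_flat_annulus_le {j : Space (n + 1) → ℝ}
    (hj0 : ∀ x, 0 ≤ j x) (hj : ∀ x y, x ≠ 0 → ‖x‖ ≤ ‖y‖ → j y ≤ j x) {ν : Space (n + 1)}
    (hν : ‖ν‖ = 1) {C : ℝ} (hC : 0 ≤ C) {s : ℝ} (hs : 0 < s) :
    ∫⁻ z in {z : Space (n + 1) | (s < ‖z‖ ∧ ‖z‖ ≤ 2 * s) ∧ |inner ℝ ν z| ≤ C * ‖z‖ ^ 2},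
        ENNReal.ofReal (j z) ≤
      ENNReal.ofReal (flatConst n * C) *
        ∫⁻ z in {z : Space (n + 1) | s / 2 < ‖z‖ ∧ ‖z‖ ≤ s}, ENNReal.ofReal (‖z‖ * j z) := by
  obtain ⟨x, hx⟩ := exists_norm_eq (Space (n + 1)) hs.le
  have hx0 : x ≠ 0 := norm_pos_iff.1 (by rw [hx]; exact hs)
  set v := (volume (Metric.ball (0 : Space n) 1)).toReal with hv
  set V := (volume (Metric.ball (0 : Space (n + 1)) 1)).toReal with hV
  have hVpos : 0 < V := ENNReal.toReal_pos (Metric.measure_ball_pos volume _ one_pos).ne'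
    measure_ball_lt_top.ne
  have hann : MeasurableSet {z : Space (n + 1) | s / 2 < ‖z‖ ∧ ‖z‖ ≤ s} :=
    (isOpen_lt continuous_const continuous_norm).measurableSet.inter
      (isClosed_le continuous_norm continuous_const).measurableSet
  calc ∫⁻ z in {z : Space (n + 1) | (s < ‖z‖ ∧ ‖z‖ ≤ 2 * s) ∧ |inner ℝ ν z| ≤ C * ‖z‖ ^ 2},
        ENNReal.ofReal (j z)
      ≤ ∫⁻ z in {z : Space (n + 1) | (s < ‖z‖ ∧ ‖z‖ ≤ 2 * s) ∧ |inner ℝ ν z| ≤ C * ‖z‖ ^ 2},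
        ENNReal.ofReal (j x) := by
        refine setLIntegral_mono measurable_const fun z hz => ?_
        exact ENNReal.ofReal_le_ofReal (hj x z hx0 (by rw [hx]; exact hz.1.1.le))
    _ = ENNReal.ofReal (j x) * volume {z : Space (n + 1) | (s < ‖z‖ ∧ ‖z‖ ≤ 2 * s) ∧
          |inner ℝ ν z| ≤ C * ‖z‖ ^ 2} := by rw [setLIntegral_const]
    _ ≤ ENNReal.ofReal (j x) *
          ENNReal.ofReal ((2 * s) ^ n * v * (2 * (C * (2 * s) ^ 2))) := by
        gcongr
        refine (measure_mono ?_).trans (volume_slab_le hν (by positivity))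
        rintro z ⟨⟨-, h1⟩, h2⟩
        refine ⟨h1, h2.trans ?_⟩
        gcongr
    -- `flatConst` is chosen precisely to make this an identity between the slab volume and the
    -- lower bound for the inner annulus.
    _ = ENNReal.ofReal (flatConst n * C) * (ENNReal.ofReal (s / 2 * j x) *
          ENNReal.ofReal ((s / 4) ^ (n + 1) * V)) := by
        rw [← ENNReal.ofReal_mul (hj0 x), ← ENNReal.ofReal_mul (by have := hj0 x; positivity),
          ← ENNReal.ofReal_mul (mul_nonneg (flatConst_nonneg n) hC)]
        congr 1
        rw [flatConst, ← hv, ← hV, div_pow s]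
        field_simp
        ring
    _ ≤ ENNReal.ofReal (flatConst n * C) * (ENNReal.ofReal (s / 2 * j x) *
          volume {z : Space (n + 1) | s / 2 < ‖z‖ ∧ ‖z‖ ≤ s}) := by
        gcongr
        exact volume_annulus_ge hs
    _ = ENNReal.ofReal (flatConst n * C) * ∫⁻ z in {z : Space (n + 1) | s / 2 < ‖z‖ ∧ ‖z‖ ≤ s},
          ENNReal.ofReal (s / 2 * j x) := by rw [setLIntegral_const]
    _ ≤ _ := by
        refine mul_le_mul' le_rfl ?_
        refine setLIntegral_mono' hann fun z hz => ENNReal.ofReal_le_ofReal ?_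
        have hz0 : z ≠ 0 := norm_pos_iff.1 (by linarith [hz.1])
        have hjz := hj z x hz0 (by rw [hx]; exact hz.2)
        have := hj0 x
        have := hz.1
        gcongr

/-- A radially decreasing profile has small integral over the flat region
`{|z·ν| ≤ C |z|²}` of a small ball, uniformly in the direction `ν`. -/
theorem lintegral_flat_le {j : Space (n + 1) → ℝ}
    (hj0 : ∀ x, 0 ≤ j x) (hj : ∀ x y, x ≠ 0 → ‖x‖ ≤ ‖y‖ → j y ≤ j x) {ν : Space (n + 1)}
    (hν : ‖ν‖ = 1) {C : ℝ} (hC : 0 ≤ C) {δ : ℝ} (hδ : 0 < δ) :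
    ∫⁻ z in {z : Space (n + 1) | ‖z‖ < δ ∧ |inner ℝ ν z| ≤ C * ‖z‖ ^ 2}, ENNReal.ofReal (j z) ≤
      ENNReal.ofReal (flatConst n * C) *
        ∫⁻ z in Metric.ball (0 : Space (n + 1)) δ, ENNReal.ofReal (‖z‖ * j z) := by
  -- Dyadic decomposition. The exponent `k + 1` makes the outermost annulus `T 0` end at radius `δ`;
  -- each `T k` is compared with the next annulus inwards, `A k`, and the `A k` are disjoint. The
  -- origin is a null set.
  set s : ℕ → ℝ := fun k => δ * (1 / 2) ^ (k + 1) with hs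
  have hspos : ∀ k, 0 < s k := fun k => by positivity
  set T : ℕ → Set (Space (n + 1)) := fun k =>
    {z | (s k < ‖z‖ ∧ ‖z‖ ≤ 2 * s k) ∧ |inner ℝ ν z| ≤ C * ‖z‖ ^ 2} with hT
  set A : ℕ → Set (Space (n + 1)) := fun k => {z | s k / 2 < ‖z‖ ∧ ‖z‖ ≤ s k} with hA
  have hsub : {z : Space (n + 1) | ‖z‖ < δ ∧ |inner ℝ ν z| ≤ C * ‖z‖ ^ 2} ⊆
      {0} ∪ ⋃ k, T k := by
    rintro z ⟨h1, h2⟩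
    rcases eq_or_ne z 0 with rfl | hz
    · exact Or.inl rfl
    · right
      obtain ⟨k, hk1, hk2⟩ := exists_nat_pow_near_of_lt_one
        (x := ‖z‖ / δ) (y := 1 / 2) (by have := norm_pos_iff.2 hz; positivity)
        ((div_le_one hδ).2 h1.le) (by norm_num) (by norm_num)
      rw [lt_div_iff₀ hδ] at hk1
      rw [div_le_iff₀ hδ] at hk2
      refine Set.mem_iUnion.2 ⟨k, ⟨by rw [hs]; linarith, ?_⟩, h2⟩
      simp only [hs, pow_succ]
      linarith
  have hAm : ∀ k, MeasurableSet (A k) := fun k =>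
    (isOpen_lt continuous_const continuous_norm).measurableSet.inter
      (isClosed_le continuous_norm continuous_const).measurableSet
  have hAd : Pairwise (Function.onFun Disjoint A) := by
    have key : ∀ k l, k < l → Disjoint (A k) (A l) := by
      intro k l hkl
      rw [Set.disjoint_left]
      rintro z hz1 hz2
      have h1 : s l ≤ s k / 2 := by
        have : s k / 2 = δ * (1 / 2) ^ (k + 1 + 1) := by
          simp only [hs, pow_succ]
          ring
        rw [this]
        have h3 : (1 / 2 : ℝ) ^ (l + 1) ≤ (1 / 2) ^ (k + 1 + 1) :=
          pow_le_pow_of_le_one (by norm_num) (by norm_num) (by omega)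
        simp only [hs]
        gcongr
      have := hz1.1
      have := hz2.2
      linarith
    intro k l hkl
    rcases lt_or_gt_of_ne hkl with h | h
    · exact key k l h
    · exact (key l k h).symm
  calc ∫⁻ z in {z : Space (n + 1) | ‖z‖ < δ ∧ |inner ℝ ν z| ≤ C * ‖z‖ ^ 2}, ENNReal.ofReal (j z)
      ≤ ∫⁻ z in {0} ∪ ⋃ k, T k, ENNReal.ofReal (j z) := lintegral_mono_set hsub
    _ ≤ (∫⁻ z in {0}, ENNReal.ofReal (j z)) + ∫⁻ z in ⋃ k, T k, ENNReal.ofReal (j z) :=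
        lintegral_union_le _ _ _
    _ = ∫⁻ z in ⋃ k, T k, ENNReal.ofReal (j z) := by
        rw [setLIntegral_measure_zero _ _ (measure_singleton _), zero_add]
    _ ≤ ∑' k, ∫⁻ z in T k, ENNReal.ofReal (j z) := lintegral_iUnion_le _ _
    _ ≤ ∑' k, ENNReal.ofReal (flatConst n * C) * ∫⁻ z in A k, ENNReal.ofReal (‖z‖ * j z) :=
        ENNReal.tsum_le_tsum fun k => lintegral_flat_annulus_le hj0 hj hν hC (hspos k)
    _ = ENNReal.ofReal (flatConst n * C) * ∫⁻ z in ⋃ k, A k, ENNReal.ofReal (‖z‖ * j z) := by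
        rw [ENNReal.tsum_mul_left, lintegral_iUnion hAm hAd]
    _ ≤ _ := by
        gcongr
        refine Set.iUnion_subset fun k z hz => ?_
        rw [mem_ball_zero_iff]
        have h1 : s k < δ := by
          simp only [hs]
          exact mul_lt_of_lt_one_right hδ (pow_lt_one₀ (by norm_num) (by norm_num) (by omega))
        exact hz.2.trans_lt h1

end Radial


/-! ### Truncated kernels and their potentials -/

section Kernel

variable {d : ℕ}

/-- The kernel `φ` cut off inside the ball of radius `r`. -/
noncomputable def truncKernel (φ : Space d → ℝ) (r : ℝ) : Space d → ℝ :=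
  (Metric.ball (0 : Space d) r)ᶜ.indicator φ

/-- `∫ χ̃_S(y) K(x-y) dy`. -/
noncomputable def kernelPotential (K : Space d → ℝ) (S : Set (Space d)) (x : Space d) : ℝ :=
  ∫ y, signedIndicator S y * K (x - y)

theorem truncKernel_of_lt {φ : Space d → ℝ} {r : ℝ} {z : Space d} (h : ‖z‖ < r) :
    truncKernel φ r z = 0 := by
  simp [truncKernel, h]

theorem truncKernel_of_le {φ : Space d → ℝ} {r : ℝ} {z : Space d} (h : r ≤ ‖z‖) :
    truncKernel φ r z = φ z := by
  simp [truncKernel, h]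

theorem signedIndicator_mul_truncKernel (φ : Space d → ℝ) (x : Space d) (S : Set (Space d))
    (r : ℝ) : (fun y => signedIndicator S y * truncKernel φ r (x - y)) =
      (Metric.ball x r)ᶜ.indicator fun y => signedIndicator S y * φ (x - y) := by
  ext y
  by_cases h : y ∈ Metric.ball x r
  · rw [Set.indicator_of_notMem (by simpa using h), truncKernel_of_lt, mul_zero]
    rw [mem_ball_iff_norm'] at h
    exact h
  · rw [Set.indicator_of_mem h, truncKernel_of_le]
    rw [mem_ball_iff_norm'] at h
    exact not_lt.1 h

theorem truncatedCurvature_eq (φ : Space d → ℝ) (x : Space d) (S : Set (Space d)) (r : ℝ) :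
    truncatedCurvature φ x S r = kernelPotential (truncKernel φ r) S x := by
  rw [truncatedCurvature, kernelPotential, signedIndicator_mul_truncKernel,
    integral_indicator Metric.isOpen_ball.measurableSet.compl]

theorem measurable_signedIndicator {S : Set (Space d)} (hS : MeasurableSet S) :
    Measurable (signedIndicator S) :=
  (measurable_const.indicator hS.compl).sub (measurable_const.indicator hS)

namespace IsAdmissibleKernel

variable {φ j : Space d → ℝ}

theorem truncKernel_nonneg (hφ : IsAdmissibleKernel φ j) (r : ℝ) (z : Space d) :
    0 ≤ truncKernel φ r z :=
  Set.indicator_nonneg (fun z _ => hφ.nonneg z) z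

theorem truncKernel_le (hφ : IsAdmissibleKernel φ j) (r : ℝ) (z : Space d) :
    truncKernel φ r z ≤ φ z :=
  Set.indicator_le_self' (fun z _ => hφ.nonneg z) z

theorem truncKernel_neg (hφ : IsAdmissibleKernel φ j) (r : ℝ) (z : Space d) :
    truncKernel φ r (-z) = truncKernel φ r z := by
  rcases lt_or_ge ‖z‖ r with h | h
  · rw [truncKernel_of_lt h, truncKernel_of_lt (by rwa [norm_neg])]
  · rw [truncKernel_of_le h, truncKernel_of_le (by rwa [norm_neg]), hφ.even]

theorem measurable_truncKernel (hφ : IsAdmissibleKernel φ j) (r : ℝ) :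
    Measurable (truncKernel φ r) :=
  hφ.measurable.indicator Metric.isOpen_ball.measurableSet.compl

/-- Where `|z| ≥ r`, the weight `min 1 |z|` is at least `min 1 r`, so there `φ` is at most a
constant times the integrable function. -/
theorem integrable_truncKernel (hφ : IsAdmissibleKernel φ j) {r : ℝ} (hr : 0 < r) :
    Integrable (truncKernel φ r) := by
  have hpos : 0 < min 1 r := lt_min one_pos hr
  refine (hφ.profile_integrable.const_mul (min 1 r)⁻¹).mono'
    (hφ.measurable_truncKernel r).aestronglyMeasurable (Eventually.of_forall fun z => ?_)
  rw [Real.norm_of_nonneg (hφ.truncKernel_nonneg r z)]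
  have hj := hφ.profile_nonneg z
  rcases lt_or_ge ‖z‖ r with h | h
  · rw [truncKernel_of_lt h]
    positivity
  · rw [truncKernel_of_le h, ← mul_assoc]
    refine (hφ.le_profile z).trans (le_mul_of_one_le_left hj ?_)
    calc (1 : ℝ) = (min 1 r)⁻¹ * min 1 r := (inv_mul_cancel₀ hpos.ne').symm
      _ ≤ (min 1 r)⁻¹ * min 1 ‖z‖ := by gcongr

end IsAdmissibleKernel

theorem integrable_signedIndicator_mul {K : Space d → ℝ} (hK : Integrable K) {S : Set (Space d)}
    (hS : MeasurableSet S) (x : Space d) :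
    Integrable fun y => signedIndicator S y * K (x - y) := by
  refine (hK.comp_sub_left x).bdd_mul (c := 1)
    (measurable_signedIndicator hS).aestronglyMeasurable (Eventually.of_forall fun y => ?_)
  rw [Real.norm_eq_abs, abs_signedIndicator]

theorem kernelPotential_eq (K : Space d → ℝ) (S : Set (Space d)) (x : Space d) :
    kernelPotential K S x = ∫ z, signedIndicator S (x - z) * K z := by
  rw [kernelPotential, ← integral_sub_left_eq_self _ volume x]
  simp

theorem kernelPotential_eq' {K : Space d → ℝ} (hK : ∀ z, K (-z) = K z) (S : Set (Space d))
    (x : Space d) : kernelPotential K S x = ∫ z, signedIndicator S (x + z) * K z := by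
  rw [kernelPotential_eq, ← integral_neg_eq_self]
  simp [hK]

theorem continuousAt_signedIndicator {S : Set (Space d)} {y : Space d} (hy : y ∉ frontier S) :
    ContinuousAt (signedIndicator S) y := by
  by_cases h : y ∈ interior S
  · refine continuousAt_const.congr (f := fun _ => -1) ?_
    filter_upwards [mem_interior_iff_mem_nhds.1 h] with z hz
    rw [signedIndicator_of_mem hz]
  · have h2 : y ∉ closure S := fun hc => hy ⟨hc, h⟩
    refine continuousAt_const.congr (f := fun _ => 1) ?_
    filter_upwards [isClosed_closure.isOpen_compl.mem_nhds h2] with z hz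
    rw [signedIndicator_of_notMem fun hz' => hz (subset_closure hz')]

/-- After substitution `x` occurs only in the signed indicator, which is continuous off the null set
`∂S`; dominated convergence applies. -/
theorem continuous_kernelPotential {K : Space d → ℝ} (hK : Integrable K) {S : Set (Space d)}
    (hS : MeasurableSet S) (hfr : volume (frontier S) = 0) : Continuous (kernelPotential K S) := by
  rw [continuous_iff_continuousAt]
  intro x
  have heq : kernelPotential K S = fun x => ∫ z, signedIndicator S (x - z) * K z :=
    funext fun x => kernelPotential_eq K S x
  rw [heq]
  refine continuousAt_of_dominated (bound := fun z => ‖K z‖) (Eventually.of_forall fun y => ?_)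
    (Eventually.of_forall fun y => Eventually.of_forall fun z => ?_) hK.norm ?_
  · exact ((measurable_signedIndicator hS).comp
      (measurable_const.sub measurable_id)).aestronglyMeasurable.mul hK.aestronglyMeasurable
  · rw [norm_mul, Real.norm_eq_abs, abs_signedIndicator, one_mul]
  · have h0 : volume ((fun z => x - z) ⁻¹' frontier S) = 0 := by
      rw [(Measure.measurePreserving_sub_left volume x).measure_preimage
        isClosed_frontier.measurableSet.nullMeasurableSet, hfr]
    filter_upwards [measure_eq_zero_iff_ae_notMem.1 h0] with z hz
    refine ContinuousAt.mul ?_ continuousAt_const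
    exact ContinuousAt.comp (f := fun y => y - z) (continuousAt_signedIndicator hz)
      (by fun_prop)

end Kernel

/-! ### Existence of the principal value -/

section Curvature

variable {n : ℕ} {φ j : Space (n + 1) → ℝ}

/-- The modulus of convergence of the truncated curvatures. -/
noncomputable def flatModulus (j : Space (n + 1) → ℝ) (C r : ℝ) : ℝ≥0∞ :=
  ENNReal.ofReal (flatConst n * C) *
    ∫⁻ z in Metric.ball (0 : Space (n + 1)) r, ENNReal.ofReal (min 1 ‖z‖ * j z)

theorem IsAdmissibleKernel.lintegral_profile_ne_top (hφ : IsAdmissibleKernel φ j) :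
    ∫⁻ z, ENNReal.ofReal (min 1 ‖z‖ * j z) ≠ ⊤ :=
  hφ.profile_integrable.lintegral_lt_top.ne

theorem IsAdmissibleKernel.flatModulus_ne_top (hφ : IsAdmissibleKernel φ j) (C r : ℝ) :
    flatModulus j C r ≠ ⊤ :=
  ENNReal.mul_ne_top ENNReal.ofReal_ne_top
    (ne_top_of_le_ne_top hφ.lintegral_profile_ne_top (setLIntegral_le_lintegral _ _))

/-- Absolute continuity of the integral of `min 1 |z| j`, as the volume of the ball tends to zero.
-/
theorem IsAdmissibleKernel.tendsto_flatModulus (hφ : IsAdmissibleKernel φ j) (C : ℝ) :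
    Tendsto (fun r => (flatModulus j C r).toReal) (𝓝[>] 0) (𝓝 0) := by
  have hvol : Tendsto (fun r : ℝ => volume (Metric.ball (0 : Space (n + 1)) r)) (𝓝[>] 0)
      (𝓝 0) := by
    have h1 : Tendsto (fun r : ℝ => ENNReal.ofReal (r ^ (n + 1)) *
        volume (Metric.ball (0 : Space (n + 1)) 1)) (𝓝 0) (𝓝 (ENNReal.ofReal (0 ^ (n + 1)) *
          volume (Metric.ball (0 : Space (n + 1)) 1))) := by
      refine ENNReal.Tendsto.mul_const ?_ (Or.inr measure_ball_lt_top.ne)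
      exact ENNReal.tendsto_ofReal ((continuous_pow (n + 1)).tendsto 0)
    rw [zero_pow (Nat.succ_ne_zero n), ENNReal.ofReal_zero, zero_mul] at h1
    refine (h1.mono_left nhdsWithin_le_nhds).congr' ?_
    filter_upwards [self_mem_nhdsWithin] with r hr
    rw [Measure.addHaar_ball volume (0 : Space (n + 1)) (le_of_lt hr), finrank_euclideanSpace_fin]
  have h2 := tendsto_setLIntegral_zero hφ.lintegral_profile_ne_top hvol
  have h3 := ENNReal.Tendsto.const_mul (a := ENNReal.ofReal (flatConst n * C)) h2
    (Or.inr ENNReal.ofReal_ne_top)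
  rw [mul_zero] at h3
  have h4 := (ENNReal.tendsto_toReal ENNReal.zero_ne_top).comp h3
  rw [ENNReal.toReal_zero] at h4
  exact h4

theorem IsAdmissibleKernel.lintegral_flat_le_flatModulus (hφ : IsAdmissibleKernel φ j)
    {ν : Space (n + 1)} (hν : ‖ν‖ = 1) {C : ℝ} (hC : 0 ≤ C) {r : ℝ} (hr : 0 < r) (hr1 : r ≤ 1) :
    ∫⁻ z in {z : Space (n + 1) | ‖z‖ < r ∧ |inner ℝ ν z| ≤ C * ‖z‖ ^ 2}, ENNReal.ofReal (j z) ≤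
      flatModulus j C r := by
  refine (lintegral_flat_le hφ.profile_nonneg hφ.profile_antitone hν hC hr).trans (le_of_eq ?_)
  rw [flatModulus]
  congr 1
  refine setLIntegral_congr_fun Metric.isOpen_ball.measurableSet fun z hz => ?_
  rw [min_eq_right]
  rw [mem_ball_zero_iff] at hz
  linarith

/-- Cancellation: by symmetry of the kernel only the flat region contributes to differences of
truncated curvatures. -/
theorem IsAdmissibleKernel.abs_truncatedCurvature_sub_le (hφ : IsAdmissibleKernel φ j)
    {S : Set (Space (n + 1))} (hS : MeasurableSet S) {x : Space (n + 1)} {C r₀ : ℝ} (hC : 0 ≤ C)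
    (hflat : FlatAt S x C r₀) {r r' : ℝ} (hr : 0 < r) (hrr : r ≤ r') (hr0 : r' ≤ r₀)
    (hr1 : r' ≤ 1) :
    |truncatedCurvature φ x S r - truncatedCurvature φ x S r'| ≤ (flatModulus j C r').toReal := by
  obtain ⟨ν, hν, hsym⟩ := hflat
  have hr' : 0 < r' := hr.trans_le hrr
  set D : Space (n + 1) → ℝ := fun z => truncKernel φ r z - truncKernel φ r' z with hD
  have hDint : Integrable D :=
    (hφ.integrable_truncKernel hr).sub (hφ.integrable_truncKernel hr')
  have hDneg : ∀ z, D (-z) = D z := fun z => by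
    simp only [hD, hφ.truncKernel_neg]
  have hsub : truncatedCurvature φ x S r - truncatedCurvature φ x S r' = kernelPotential D S x := by
    rw [truncatedCurvature_eq, truncatedCurvature_eq, kernelPotential, kernelPotential,
      kernelPotential, ← integral_sub
      (integrable_signedIndicator_mul (hφ.integrable_truncKernel hr) hS x)
      (integrable_signedIndicator_mul (hφ.integrable_truncKernel hr') hS x)]
    simp only [hD, mul_sub]
  have hi1 : Integrable fun z => signedIndicator S (x - z) * D z := by
    refine hDint.bdd_mul (c := 1) ((measurable_signedIndicator hS).comp
      (measurable_const.sub measurable_id)).aestronglyMeasurable (Eventually.of_forall fun y => ?_)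
    simp [abs_signedIndicator]
  have hi2 : Integrable fun z => signedIndicator S (x + z) * D z := by
    refine hDint.bdd_mul (c := 1) ((measurable_signedIndicator hS).comp
      (measurable_const.add measurable_id)).aestronglyMeasurable (Eventually.of_forall fun y => ?_)
    simp [abs_signedIndicator]
  -- Evenness of `D` gives two formulas for the potential, one with `x + z` and one with `x - z`;
  -- adding them exhibits the cancellation.
  have hdouble : 2 * kernelPotential D S x =
      ∫ z, (signedIndicator S (x + z) + signedIndicator S (x - z)) * D z := by
    rw [two_mul]
    nth_rewrite 1 [kernelPotential_eq' hDneg]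
    rw [kernelPotential_eq, ← integral_add hi2 hi1]
    simp only [add_mul]
  set T := {z : Space (n + 1) | ‖z‖ < r' ∧ |inner ℝ ν z| ≤ C * ‖z‖ ^ 2} with hT
  have hTm : MeasurableSet T := by
    have h1 : Measurable fun z : Space (n + 1) => |inner ℝ ν z| := by fun_prop
    have h2 : Measurable fun z : Space (n + 1) => C * ‖z‖ ^ 2 := by fun_prop
    exact (measurableSet_lt measurable_norm measurable_const).inter (measurableSet_le h1 h2)
  -- `D` vanishes outside the ball of radius `r'`, and inside it the symmetric sum vanishes off the
  -- flat region.
  have hpt : ∀ z, ‖(signedIndicator S (x + z) + signedIndicator S (x - z)) * D z‖ₑ ≤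
      T.indicator (fun z => 2 * ENNReal.ofReal (j z)) z := by
    intro z
    have hzero : ∀ t : ℝ, t = 0 → ‖t‖ₑ ≤ T.indicator (fun z => 2 * ENNReal.ofReal (j z)) z := by
      rintro t rfl
      simp
    rcases lt_or_ge ‖z‖ r' with hz | hz
    · by_cases hzT : z ∈ T
      · rw [Set.indicator_of_mem hzT]
        have hb : |(signedIndicator S (x + z) + signedIndicator S (x - z)) * D z| ≤ 2 * j z := by
          rw [abs_mul]
          have h1 : |signedIndicator S (x + z) + signedIndicator S (x - z)| ≤ 2 := by
            refine (abs_add_le _ _).trans ?_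
            rw [abs_signedIndicator, abs_signedIndicator]
            norm_num
          have h2 : |D z| ≤ j z := by
            simp only [hD]
            rw [truncKernel_of_lt hz, sub_zero, abs_of_nonneg (hφ.truncKernel_nonneg r z)]
            exact (hφ.truncKernel_le r z).trans (hφ.le_profile z)
          gcongr
        rw [← ofReal_norm, Real.norm_eq_abs]
        refine (ENNReal.ofReal_le_ofReal hb).trans ?_
        rw [ENNReal.ofReal_mul (by norm_num)]
        simp
      · refine hzero _ ?_
        rw [hsym z (hz.trans_le hr0), zero_mul]
        by_contra! hle
        exact hzT ⟨hz, hle⟩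
    · refine hzero _ ?_
      simp only [hD]
      rw [truncKernel_of_le hz, truncKernel_of_le (hrr.trans hz), sub_self, mul_zero]
  have hbound : ‖2 * kernelPotential D S x‖ₑ ≤ 2 * flatModulus j C r' := by
    rw [hdouble]
    refine (enorm_integral_le_lintegral_enorm _).trans ((lintegral_mono hpt).trans ?_)
    rw [lintegral_indicator hTm, lintegral_const_mul' _ _ (by norm_num)]
    gcongr
    exact hφ.lintegral_flat_le_flatModulus hν hC hr' hr1
  rw [hsub]
  have h3 := ENNReal.toReal_mono (ENNReal.mul_ne_top (by norm_num) (hφ.flatModulus_ne_top C r'))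
    hbound
  rw [ENNReal.toReal_mul, toReal_enorm, Real.norm_eq_abs, abs_mul] at h3
  simp at h3
  exact h3

/-- The principal value defining the curvature, before normalization. -/
noncomputable def pvCurvature (φ : Space (n + 1) → ℝ) (x : Space (n + 1))
    (S : Set (Space (n + 1))) : ℝ :=
  limUnder (𝓝[>] (0 : ℝ)) (truncatedCurvature φ x S)

/-- The cancellation estimate makes the truncated curvatures Cauchy as `r ↓ 0`, so `limUnder` is a
genuine limit. -/
theorem IsAdmissibleKernel.tendsto_truncatedCurvature (hφ : IsAdmissibleKernel φ j)
    {S : Set (Space (n + 1))} (hS : MeasurableSet S) {x : Space (n + 1)} {C r₀ : ℝ} (hC : 0 ≤ C)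
    (hr₀ : 0 < r₀) (hflat : FlatAt S x C r₀) :
    Tendsto (truncatedCurvature φ x S) (𝓝[>] 0) (𝓝 (pvCurvature φ x S)) := by
  refine tendsto_nhds_limUnder ?_
  rw [← cauchy_map_iff_exists_tendsto, Metric.cauchy_iff]
  refine ⟨inferInstance, fun ε hε => ?_⟩
  have hsmall : ∀ᶠ r in 𝓝[>] (0 : ℝ), ((0 < r ∧ r ≤ r₀) ∧ r ≤ 1) ∧
      (flatModulus j C r).toReal < ε :=
    (((show ∀ᶠ r in 𝓝[>] (0 : ℝ), 0 < r from self_mem_nhdsWithin).and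
      (nhdsWithin_le_nhds (Iic_mem_nhds hr₀))).and (nhdsWithin_le_nhds (Iic_mem_nhds one_pos))).and
      ((hφ.tendsto_flatModulus C).eventually (gt_mem_nhds hε))
  refine ⟨_, image_mem_map hsmall, ?_⟩
  have key : ∀ r r', r ≤ r' → (((0 < r ∧ r ≤ r₀) ∧ r ≤ 1) ∧ (flatModulus j C r).toReal < ε) →
      (((0 < r' ∧ r' ≤ r₀) ∧ r' ≤ 1) ∧ (flatModulus j C r').toReal < ε) →
      dist (truncatedCurvature φ x S r) (truncatedCurvature φ x S r') < ε := by
    intro r r' hrr h1 h2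
    rw [Real.dist_eq]
    exact (hφ.abs_truncatedCurvature_sub_le hS hC hflat h1.1.1.1 hrr h2.1.1.2 h2.1.2).trans_lt h2.2
  rintro _ ⟨r, hr, rfl⟩ _ ⟨r', hr', rfl⟩
  rcases le_total r r' with h | h
  · exact key r r' h hr hr'
  · rw [dist_comm]
    exact key r' r h hr' hr

theorem IsAdmissibleKernel.abs_truncatedCurvature_sub_pvCurvature_le (hφ : IsAdmissibleKernel φ j)
    {S : Set (Space (n + 1))} (hS : MeasurableSet S) {x : Space (n + 1)} {C r₀ : ℝ} (hC : 0 ≤ C)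
    (hr₀ : 0 < r₀) (hflat : FlatAt S x C r₀) {r : ℝ} (hr : 0 < r) (hr0 : r ≤ r₀) (hr1 : r ≤ 1) :
    |truncatedCurvature φ x S r - pvCurvature φ x S| ≤ (flatModulus j C r).toReal := by
  have ht := ((hφ.tendsto_truncatedCurvature hS hC hr₀ hflat).const_sub
    (truncatedCurvature φ x S r)).abs
  refine le_of_tendsto ht ?_
  filter_upwards [Ioo_mem_nhdsGT hr] with s hs
  rw [abs_sub_comm]
  exact hφ.abs_truncatedCurvature_sub_le hS hC hflat hs.1 hs.2.le hr0 hr1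

end Curvature


/-! ### Finite differences and truncation of the perimeter -/

section Perimeter

variable {d : ℕ} {K : Space d → ℝ} {E F : Set (Space d)}

/-- The integrand of the nonlocal perimeter on the product space. -/
noncomputable def perimeterDensity (K : Space d → ℝ) (E : Set (Space d)) (p : Space d × Space d) :
    ℝ :=
  E.indicator 1 p.1 * Eᶜ.indicator 1 p.2 * K (p.1 - p.2)

theorem measurable_perimeterDensity (hK : Measurable K) (hE : MeasurableSet E) :
    Measurable (perimeterDensity K E) := by
  have h1 : Measurable (E.indicator (1 : Space d → ℝ)) := measurable_one.indicator hE
  have h2 : Measurable (Eᶜ.indicator (1 : Space d → ℝ)) := measurable_one.indicator hE.compl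
  exact ((h1.comp measurable_fst).mul (h2.comp measurable_snd)).mul
    (hK.comp (measurable_fst.sub measurable_snd))

theorem perimeterDensity_nonneg (hK : ∀ z, 0 ≤ K z) (p : Space d × Space d) :
    0 ≤ perimeterDensity K E p :=
  mul_nonneg (mul_nonneg (Set.indicator_nonneg (fun _ _ => zero_le_one) _)
    (Set.indicator_nonneg (fun _ _ => zero_le_one) _)) (hK _)

theorem nonlocalPerimeter_eq_lintegral (hK : Measurable K) (hE : MeasurableSet E) :
    nonlocalPerimeter K E =
      ∫⁻ p, ENNReal.ofReal (perimeterDensity K E p)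
        ∂((volume : Measure (Space d)).prod volume) := by
  rw [lintegral_prod _ (measurable_perimeterDensity hK hE).ennreal_ofReal.aemeasurable,
    nonlocalPerimeter, ← lintegral_indicator hE]
  refine lintegral_congr fun x => ?_
  by_cases hx : x ∈ E
  · rw [Set.indicator_of_mem hx, ← lintegral_indicator hE.compl]
    refine lintegral_congr fun y => ?_
    by_cases hy : y ∈ Eᶜ
    · simp [perimeterDensity, hx, hy]
    · simp [perimeterDensity, hy]
  · simp [perimeterDensity, hx]

theorem integrable_perimeterDensity (hK : Measurable K) (hK0 : ∀ z, 0 ≤ K z)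
    (hE : MeasurableSet E) (hfin : nonlocalPerimeter K E ≠ ⊤) :
    Integrable (perimeterDensity K E) ((volume : Measure (Space d)).prod volume) := by
  rw [nonlocalPerimeter_eq_lintegral hK hE] at hfin
  exact (lintegral_ofReal_ne_top_iff_integrable
    (measurable_perimeterDensity hK hE).aestronglyMeasurable
    (Eventually.of_forall (perimeterDensity_nonneg hK0))).1 hfin

theorem toReal_nonlocalPerimeter (hK : Measurable K) (hK0 : ∀ z, 0 ≤ K z)
    (hE : MeasurableSet E) : (nonlocalPerimeter K E).toReal =
      ∫ p, perimeterDensity K E p ∂((volume : Measure (Space d)).prod volume) := by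
  rw [nonlocalPerimeter_eq_lintegral hK hE, integral_eq_lintegral_of_nonneg_ae
    (Eventually.of_forall (perimeterDensity_nonneg hK0))
    (measurable_perimeterDensity hK hE).aestronglyMeasurable]

theorem integrable_indicator_sub_indicator (hE : MeasurableSet E) (hF : MeasurableSet F)
    (hfin : volume (symmDiff F E) ≠ ⊤) :
    Integrable fun x => F.indicator (1 : Space d → ℝ) x - E.indicator 1 x := by
  have h1 : Integrable ((F \ E).indicator (1 : Space d → ℝ)) := by
    refine (integrable_indicator_iff (hF.diff hE)).2 (integrableOn_const ?_)
    exact ne_top_of_le_ne_top hfin (measure_mono Set.subset_union_left)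
  have h2 : Integrable ((E \ F).indicator (1 : Space d → ℝ)) := by
    refine (integrable_indicator_iff (hE.diff hF)).2 (integrableOn_const ?_)
    exact ne_top_of_le_ne_top hfin (measure_mono Set.subset_union_right)
  refine (h1.sub h2).congr (Eventually.of_forall fun x => ?_)
  by_cases hx : x ∈ E <;> by_cases hy : x ∈ F <;> simp [hx, hy]

/-- Exact finite difference formula for the perimeter of an integrable kernel. -/
theorem toReal_nonlocalPerimeter_sub (hK : Measurable K) (hK0 : ∀ z, 0 ≤ K z)
    (hKs : ∀ z, K (-z) = K z) (hKi : Integrable K) (hE : MeasurableSet E) (hF : MeasurableSet F)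
    (hPE : nonlocalPerimeter K E ≠ ⊤) (hPF : nonlocalPerimeter K F ≠ ⊤)
    (hfin : volume (symmDiff F E) ≠ ⊤) :
    (nonlocalPerimeter K F).toReal - (nonlocalPerimeter K E).toReal =
      ∫ x, (F.indicator 1 x - E.indicator 1 x) *
        ((kernelPotential K E x + kernelPotential K F x) / 2) := by
  set μ := (volume : Measure (Space d)).prod (volume : Measure (Space d)) with hμ
  set h : Space d → ℝ := fun x => F.indicator 1 x - E.indicator 1 x with hh
  have hhi : Integrable h := integrable_indicator_sub_indicator hE hF hfin
  set H : Space d × Space d → ℝ := fun p =>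
    h p.1 * (((signedIndicator E p.2 + signedIndicator F p.2) / 2) * K (p.1 - p.2)) with hH
  have hneg : ∀ x y : Space d, K (y - x) = K (x - y) := fun x y => by rw [← hKs, neg_sub]
  -- This is a convolution integrand of two integrable functions: `h` is integrable because `F Δ E`
  -- has finite volume.
  have hQ : Integrable (fun p : Space d × Space d => h p.1 * K (p.1 - p.2)) μ := by
    have h1 := (hhi.convolution_integrand (ContinuousLinearMap.mul ℝ ℝ) hKi).swap
    refine h1.congr (Eventually.of_forall fun p => ?_)
    simp [hneg p.1 p.2]
  have hHi : Integrable H μ := by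
    have h2 := hQ.bdd_mul (c := 1)
      (f := fun p : Space d × Space d => (signedIndicator E p.2 + signedIndicator F p.2) / 2)
      ((((measurable_signedIndicator hE).comp measurable_snd).add
        ((measurable_signedIndicator hF).comp measurable_snd)).div_const 2).aestronglyMeasurable
      (Eventually.of_forall fun p => ?_)
    · refine h2.congr (Eventually.of_forall fun p => ?_)
      simp only [hH]
      ring
    · rw [Real.norm_eq_abs, abs_div, abs_two, div_le_one two_pos]
      refine (abs_add_le _ _).trans ?_
      rw [abs_signedIndicator, abs_signedIndicator]
      norm_num
  -- The integrands agree only after symmetrization in the two points, where evenness of `K` is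
  -- used; the identity is then a check of all memberships.
  have hpt : ∀ p : Space d × Space d, (perimeterDensity K F p + perimeterDensity K F p.swap) -
      (perimeterDensity K E p + perimeterDensity K E p.swap) = H p + H p.swap := by
    rintro ⟨x, y⟩
    simp only [perimeterDensity, hH, hh, Prod.swap, hneg x y]
    by_cases h1 : x ∈ E <;> by_cases h2 : y ∈ E <;> by_cases h3 : x ∈ F <;> by_cases h4 : y ∈ F <;>
      simp [h1, h2, h3, h4, signedIndicator]
  have hFi := integrable_perimeterDensity hK hK0 hF hPF
  have hEi := integrable_perimeterDensity hK hK0 hE hPE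
  have hswap : ∀ G : Space d × Space d → ℝ, ∫ p, G p.swap ∂μ = ∫ p, G p ∂μ := fun G =>
    integral_prod_swap G
  have hsum : ∀ G : Space d × Space d → ℝ, Integrable G μ →
      ∫ p, (G p + G p.swap) ∂μ = 2 * ∫ p, G p ∂μ := fun G hG => by
    have h1 : ∫ p, (G p + G p.swap) ∂μ = ∫ p, G p ∂μ + ∫ p, G p.swap ∂μ :=
      integral_add hG hG.swap
    rw [h1, hswap, two_mul]
  have htot : 2 * ∫ p, perimeterDensity K F p ∂μ - 2 * ∫ p, perimeterDensity K E p ∂μ =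
      2 * ∫ p, H p ∂μ := by
    rw [← hsum _ hFi, ← hsum _ hEi, ← hsum _ hHi]
    exact (integral_sub (hFi.add hFi.swap) (hEi.add hEi.swap)).symm.trans
      (integral_congr_ae (Eventually.of_forall hpt))
  rw [toReal_nonlocalPerimeter hK hK0 hF, toReal_nonlocalPerimeter hK hK0 hE]
  have hfub : ∫ p, H p ∂μ = ∫ x, h x * ((kernelPotential K E x + kernelPotential K F x) / 2) := by
    rw [hμ, integral_prod _ hHi]
    refine integral_congr_ae (Eventually.of_forall fun x => ?_)
    simp only [hH]
    rw [integral_const_mul]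
    congr 1
    rw [kernelPotential, kernelPotential, ← integral_add (integrable_signedIndicator_mul hKi hE x)
      (integrable_signedIndicator_mul hKi hF x), ← integral_div]
    congr 1
    ext y
    ring
  rw [← hfub]
  linarith

theorem IsAdmissibleKernel.tendsto_nonlocalPerimeter {φ j : Space d → ℝ}
    (hφ : IsAdmissibleKernel φ j) (hE : MeasurableSet E) (hfin : nonlocalPerimeter φ E ≠ ⊤) :
    Tendsto (fun r => (nonlocalPerimeter (truncKernel φ r) E).toReal) (𝓝[>] 0)
      (𝓝 (nonlocalPerimeter φ E).toReal) := by
  refine (ENNReal.tendsto_toReal hfin).comp ?_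
  have hfin' := hfin
  rw [nonlocalPerimeter_eq_lintegral hφ.measurable hE] at hfin' ⊢
  simp_rw [nonlocalPerimeter_eq_lintegral (hφ.measurable_truncKernel _) hE]
  refine tendsto_lintegral_filter_of_dominated_convergence
    (fun p => ENNReal.ofReal (perimeterDensity φ E p)) ?_ ?_ hfin' ?_
  · exact Eventually.of_forall fun r =>
      (measurable_perimeterDensity (hφ.measurable_truncKernel r) hE).ennreal_ofReal
  · refine Eventually.of_forall fun r => Eventually.of_forall fun p => ENNReal.ofReal_le_ofReal ?_
    exact mul_le_mul_of_nonneg_left (hφ.truncKernel_le r _)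
      (mul_nonneg (Set.indicator_nonneg (fun _ _ => zero_le_one) _)
        (Set.indicator_nonneg (fun _ _ => zero_le_one) _))
  · refine Eventually.of_forall fun p => tendsto_const_nhds.congr' ?_
    -- On the diagonal the truncated kernel need not recover `φ 0`, but the density vanishes since a
    -- point is not in both `E` and its complement.
    rcases eq_or_ne p.1 p.2 with hp | hp
    · refine Eventually.of_forall fun r => ?_
      have : E.indicator (1 : Space d → ℝ) p.2 * Eᶜ.indicator 1 p.2 = 0 := by
        by_cases h : p.2 ∈ E <;> simp [h]
      simp [perimeterDensity, hp, this]
    · have hpos : 0 < ‖p.1 - p.2‖ := norm_pos_iff.2 (sub_ne_zero.2 hp)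
      filter_upwards [Ioo_mem_nhdsGT hpos] with r hr
      simp only [perimeterDensity]
      rw [truncKernel_of_le hr.2.le]

theorem IsAdmissibleKernel.nonlocalPerimeter_truncKernel_le {φ j : Space d → ℝ}
    (hφ : IsAdmissibleKernel φ j) (r : ℝ) (E : Set (Space d)) :
    nonlocalPerimeter (truncKernel φ r) E ≤ nonlocalPerimeter φ E :=
  lintegral_mono fun _ => lintegral_mono fun _ => ENNReal.ofReal_le_ofReal (hφ.truncKernel_le r _)

end Perimeter

/-! ### Finiteness of the perimeter -/

section Finite

variable {n : ℕ} {E : Set (Space (n + 1))}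

/-- Substituting `z = x - y` and applying Tonelli separates the kernel from the geometry of `E`. -/
theorem nonlocalPerimeter_eq_lintegral_translate {d : ℕ} {K : Space d → ℝ} {E : Set (Space d)}
    (hK : Measurable K) (hE : MeasurableSet E) :
    nonlocalPerimeter K E = ∫⁻ z, ENNReal.ofReal (K z) * volume {x | x ∈ E ∧ x - z ∉ E} := by
  have h1 : nonlocalPerimeter K E = ∫⁻ x, ∫⁻ z, {q : Space d × Space d | q.1 ∈ E ∧ q.1 - q.2 ∉ E
      }.indicator (fun q => ENNReal.ofReal (K q.2)) (x, z) := by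
    rw [nonlocalPerimeter, ← lintegral_indicator hE]
    refine lintegral_congr fun x => ?_
    by_cases hx : x ∈ E
    · rw [Set.indicator_of_mem hx, ← lintegral_indicator hE.compl,
        ← lintegral_sub_left_eq_self _ x]
      refine lintegral_congr fun z => ?_
      by_cases hz : x - z ∈ E
      · rw [Set.indicator_of_notMem (by simpa using hz),
          Set.indicator_of_notMem (fun h => h.2 hz)]
      · have hmem : (x, z) ∈ {q : Space d × Space d | q.1 ∈ E ∧ q.1 - q.2 ∉ E} := ⟨hx, hz⟩
        rw [Set.indicator_of_mem (by simpa using hz), Set.indicator_of_mem hmem, sub_sub_cancel]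
    · rw [Set.indicator_of_notMem hx]
      symm
      rw [lintegral_eq_zero_iff']
      · exact Eventually.of_forall fun z => Set.indicator_of_notMem (fun h => hx h.1) _
      · refine Measurable.aemeasurable ?_
        have : (fun z => {q : Space d × Space d | q.1 ∈ E ∧ q.1 - q.2 ∉ E}.indicator
          (fun q => ENNReal.ofReal (K q.2)) (x, z)) = fun _ => 0 := by
          ext z
          exact Set.indicator_of_notMem (fun h => hx h.1) _
        rw [this]
        exact measurable_const
  have hm : MeasurableSet {q : Space d × Space d | q.1 ∈ E ∧ q.1 - q.2 ∉ E} :=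
    (measurable_fst hE).inter ((measurable_fst.sub measurable_snd) hE.compl)
  rw [h1, lintegral_lintegral_swap (f := fun x z => {q : Space d × Space d |
    q.1 ∈ E ∧ q.1 - q.2 ∉ E}.indicator (fun q => ENNReal.ofReal (K q.2)) (x, z))
    (((hK.comp measurable_snd).ennreal_ofReal.indicator hm).aemeasurable)]
  refine lintegral_congr fun z => ?_
  have hmz : MeasurableSet {x | x ∈ E ∧ x - z ∉ E} :=
    hE.inter ((measurable_id.sub measurable_const) hE.compl)
  rw [← lintegral_indicator_const hmz]
  exact lintegral_congr fun x => rfl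

/-- In dimension at least two the punctured space is connected, and the radial map adding `R` to the
norm sends it onto the exterior of the ball. -/
theorem isPreconnected_norm_gt (hn : 1 ≤ n) (R : ℝ) (hR : 0 ≤ R) :
    IsPreconnected {x : Space (n + 1) | R < ‖x‖} := by
  have hrank : 1 < Module.rank ℝ (Space (n + 1)) := by
    rw [← Module.finrank_eq_rank, finrank_euclideanSpace_fin]
    exact_mod_cast Nat.lt_succ_of_le hn
  have hpre := (isConnected_compl_singleton_of_one_lt_rank hrank 0).isPreconnected
  have himg : {x : Space (n + 1) | R < ‖x‖} = (fun x => x + (R / ‖x‖) • x) '' {0}ᶜ := by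
    ext x
    constructor
    · intro hx
      have hx' : R < ‖x‖ := hx
      have hpos : 0 < ‖x‖ := hR.trans_lt hx'
      have hc : 0 < 1 - R / ‖x‖ := by rw [sub_pos, div_lt_one hpos]; exact hx'
      refine ⟨(1 - R / ‖x‖) • x, ?_, ?_⟩
      · simp only [Set.mem_compl_iff, Set.mem_singleton_iff, smul_eq_zero, not_or]
        exact ⟨hc.ne', norm_pos_iff.1 hpos⟩
      · simp only
        rw [norm_smul, Real.norm_of_nonneg hc.le, smul_smul, ← add_smul]
        have h1 : R / ((1 - R / ‖x‖) * ‖x‖) * (1 - R / ‖x‖) = R / ‖x‖ := by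
          rw [mul_comm (1 - R / ‖x‖) ‖x‖, ← div_div, div_mul_cancel₀ _ hc.ne']
        rw [h1, sub_add_cancel, one_smul]
    · rintro ⟨y, hy, rfl⟩
      have hpos : 0 < ‖y‖ := norm_pos_iff.2 hy
      change R < ‖y + (R / ‖y‖) • y‖
      have : y + (R / ‖y‖) • y = (1 + R / ‖y‖) • y := by rw [add_smul, one_smul]
      rw [this, norm_smul, Real.norm_of_nonneg (by positivity), add_mul, div_mul_cancel₀ _ hpos.ne']
      linarith
  rw [himg]
  refine hpre.image _ ?_
  have hc : ContinuousOn (fun x : Space (n + 1) => R / ‖x‖) {0}ᶜ :=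
    continuousOn_const.div continuous_norm.continuousOn fun x hx => norm_ne_zero_iff.2 hx
  exact continuousOn_id.add (hc.smul continuousOn_id)

theorem inter_frontier_nonempty_of_isPreconnected {X : Type*} [TopologicalSpace X] {S A : Set X}
    (hS : IsPreconnected S) (h1 : (S ∩ A).Nonempty) (h2 : (S ∩ Aᶜ).Nonempty) :
    (S ∩ frontier A).Nonempty := by
  by_contra hcon
  have hcover : S ⊆ interior A ∪ (closure A)ᶜ := fun x hx => by
    by_contra hx'
    rw [Set.mem_union, Set.mem_compl_iff, not_or, not_not] at hx'
    exact hcon ⟨x, hx, hx'.2, hx'.1⟩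
  obtain ⟨x, hxS, hxA⟩ := h1
  obtain ⟨y, hyS, hyA⟩ := h2
  have hx1 : x ∈ interior A := (hcover hxS).resolve_right fun h => h (subset_closure hxA)
  have hy1 : y ∈ (closure A)ᶜ := (hcover hyS).resolve_left fun h => hyA (interior_subset h)
  obtain ⟨z, -, hz1, hz2⟩ := hS _ _ isOpen_interior isClosed_closure.isOpen_compl hcover
    ⟨x, hxS, hx1⟩ ⟨y, hyS, hy1⟩
  exact hz2 (subset_closure (interior_subset hz1))

/-- The exterior of a large ball is connected and misses `∂E`, so it lies entirely in `E` or in its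
complement. A half-line shows that this fails in dimension one. -/
theorem IsC2Domain.volume_lt_top_or (hn : 1 ≤ n) (hE : IsC2Domain E) :
    volume E < ⊤ ∨ volume Eᶜ < ⊤ := by
  obtain ⟨R, hR⟩ := hE.isCompact_frontier.isBounded.subset_closedBall 0
  have hpre := isPreconnected_norm_gt hn (max R 0) (le_max_right _ _)
  set S := {x : Space (n + 1) | max R 0 < ‖x‖} with hS
  have hSfr : ¬ (S ∩ frontier E).Nonempty := by
    rintro ⟨x, hx, hxE⟩
    have h1 := hR hxE
    rw [mem_closedBall_zero_iff] at h1
    have h2 : max R 0 < ‖x‖ := hx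
    linarith [le_max_left R 0]
  have hcompl : ∀ A : Set (Space (n + 1)), ¬ (S ∩ A).Nonempty → volume A < ⊤ := by
    intro A hA
    refine lt_of_le_of_lt (measure_mono (t := Metric.closedBall 0 (max R 0)) fun x hx => ?_)
      measure_closedBall_lt_top
    rw [mem_closedBall_zero_iff]
    by_contra! hlt
    exact hA ⟨x, hlt, hx⟩
  by_contra! hcon
  have h1 : (S ∩ E).Nonempty := by
    by_contra h
    exact absurd (hcompl E h) (not_lt.2 hcon.1)
  have h2 : (S ∩ Eᶜ).Nonempty := by
    by_contra h
    exact absurd (hcompl Eᶜ h) (not_lt.2 hcon.2)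
  exact hSfr (inter_frontier_nonempty_of_isPreconnected hpre h1 h2)

theorem mem_thickening_frontier {F : Type*} [NormedAddCommGroup F] [NormedSpace ℝ F] {E : Set F}
    {x y : F} {r : ℝ} (hx : x ∈ E) (hy : y ∉ E) (hr : ‖x - y‖ < r) :
    x ∈ Metric.thickening r (frontier E) := by
  obtain ⟨w, hw, hwE⟩ := inter_frontier_nonempty_of_isPreconnected
    (convex_segment x y).isPreconnected (A := E) ⟨x, left_mem_segment ℝ x y, hx⟩
    ⟨y, right_mem_segment ℝ x y, hy⟩
  refine Metric.mem_thickening_iff.2 ⟨w, hwE, ?_⟩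
  rw [dist_comm, dist_eq_norm]
  refine (norm_sub_le_of_mem_segment hw).trans_lt ?_
  rwa [norm_sub_rev]

/-- The set of `x ∈ E` with `x - z ∉ E` lies in a tube of radius comparable to `|z|`, and its volume
is bounded independently of `z`. So the volume is at most a constant times `min 1 |z|`, which is
exactly the weight against which `j` is integrable. -/
theorem IsC2Domain.nonlocalPerimeter_ne_top (hn : 1 ≤ n) (hE : IsC2Domain E)
    {φ j : Space (n + 1) → ℝ} (hφ : IsAdmissibleKernel φ j) : nonlocalPerimeter φ E ≠ ⊤ := by
  obtain ⟨C, ρ, hC, hρ, htube⟩ := hE.exists_volume_thickening_le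
  have hEm := hE.isClosed.measurableSet
  set r := min (ρ / 2) 1 with hr
  have hrpos : 0 < r := lt_min (by positivity) one_pos
  obtain ⟨W, hW0, hW⟩ : ∃ W : ℝ, 0 ≤ W ∧ ∀ z,
      volume {x | x ∈ E ∧ x - z ∉ E} ≤ ENNReal.ofReal W := by
    rcases hE.volume_lt_top_or hn with h | h
    · refine ⟨(volume E).toReal, ENNReal.toReal_nonneg, fun z => ?_⟩
      rw [ENNReal.ofReal_toReal h.ne]
      exact measure_mono fun x hx => hx.1
    · refine ⟨(volume Eᶜ).toReal, ENNReal.toReal_nonneg, fun z => ?_⟩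
      rw [ENNReal.ofReal_toReal h.ne, ← measure_preimage_add_right volume (-z) Eᶜ]
      exact measure_mono fun x hx => by simpa [← sub_eq_add_neg] using hx.2
  have hbound : ∀ z, volume {x | x ∈ E ∧ x - z ∉ E} ≤
      ENNReal.ofReal ((2 * C + W / r) * min 1 ‖z‖) := by
    intro z
    rcases eq_or_ne z 0 with rfl | hz0
    · simp
    have hz : 0 < ‖z‖ := norm_pos_iff.2 hz0
    rcases lt_or_ge ‖z‖ r with h | h
    · have h1 : ‖z‖ < ρ / 2 := h.trans_le (min_le_left _ _)
      have h2 : ‖z‖ < 1 := h.trans_le (min_le_right _ _)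
      rw [min_eq_right h2.le]
      -- The open tube has radius `2|z|`, since its radius must strictly exceed `|z|`.
      refine (measure_mono fun x hx => ?_).trans ((htube (2 * ‖z‖) (by positivity)
        (by linarith)).trans (ENNReal.ofReal_le_ofReal ?_))
      · refine mem_thickening_frontier hx.1 hx.2 ?_
        rw [sub_sub_cancel]
        linarith
      · have : 0 ≤ W / r * ‖z‖ := by positivity
        nlinarith
    · refine (hW z).trans (ENNReal.ofReal_le_ofReal ?_)
      have h1 : r ≤ min 1 ‖z‖ := le_min (min_le_right _ _) h
      calc W = W / r * r := by field_simp
        _ ≤ W / r * min 1 ‖z‖ := by gcongr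
        _ ≤ _ := by
          have : 0 ≤ 2 * C * min 1 ‖z‖ := by positivity
          linarith
  rw [nonlocalPerimeter_eq_lintegral_translate hφ.measurable hEm]
  have hle : ∫⁻ z, ENNReal.ofReal (φ z) * volume {x | x ∈ E ∧ x - z ∉ E} ≤
      ∫⁻ z, ENNReal.ofReal (2 * C + W / r) * ENNReal.ofReal (min 1 ‖z‖ * j z) := by
    refine lintegral_mono fun z => ?_
    calc ENNReal.ofReal (φ z) * volume {x | x ∈ E ∧ x - z ∉ E}
        ≤ ENNReal.ofReal (j z) * ENNReal.ofReal ((2 * C + W / r) * min 1 ‖z‖) := by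
          gcongr
          · exact hφ.le_profile z
          · exact hbound z
      _ = _ := by
          rw [ENNReal.ofReal_mul (by positivity), ENNReal.ofReal_mul (by positivity)]
          ring
  refine ne_top_of_le_ne_top ?_ hle
  rw [lintegral_const_mul' _ _ ENNReal.ofReal_ne_top]
  exact ENNReal.mul_ne_top ENNReal.ofReal_ne_top hφ.lintegral_profile_ne_top

end Finite


/-! ### Integrals over moving subgraphs and over graphs -/

section Reynolds

variable {n : ℕ} {e : (Space n × ℝ) ≃L[ℝ] Space (n + 1)} {f : ℝ × Space n → ℝ}
  {g : Space (n + 1) → ℝ}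

/-- Differentiation of an integral over a moving subgraph. -/
theorem hasDerivAt_setIntegral_subgraph {A : ℝ → Set (Space (n + 1))} (he : IsSplitting e)
    (hA : ∀ ε, MeasurableSet (A ε)) {y₀ : Space n} {t₀ η K : ℝ} (hη : 0 < η)
    (hf : ∀ ε y, |ε| < η → y ∈ Metric.ball y₀ η →
      DifferentiableAt ℝ f (ε, y) ∧ ‖fderiv ℝ f (ε, y)‖ ≤ K)
    (hmem : ∀ ε y t, |ε| < η → y ∈ Metric.ball y₀ η → t ∈ Metric.ball t₀ η →
      (e (y, t) ∈ A ε ↔ t ≤ f (ε, y)))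
    (hg : Continuous g) (hgc : HasCompactSupport g)
    (hsupp : ∀ y t, g (e (y, t)) ≠ 0 → y ∈ Metric.ball y₀ η ∧ t ∈ Metric.ball t₀ η) :
    HasDerivAt (fun ε => ∫ x in A ε, g x)
      (∫ y in Metric.ball y₀ η, g (e (y, f (0, y))) * fderiv ℝ f (0, y) (1, 0)) 0 := by
  set B := Metric.ball y₀ η with hB
  set F : ℝ → Space n → ℝ := fun ε y => ∫ t, (A ε).indicator g (e (y, t)) with hF
  have hgi : Integrable g := hg.integrable_of_hasCompactSupport hgc
  obtain ⟨M, hM⟩ := hgc.exists_bound_of_continuous hg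
  have hM0 : 0 ≤ M := (norm_nonneg _).trans (hM 0)
  have hGi : ∀ ε, Integrable (fun q : Space n × ℝ => (A ε).indicator g (e q))
      ((volume : Measure (Space n)).prod (volume : Measure ℝ)) := fun ε =>
    he.measurePreserving.integrable_comp_of_integrable (hgi.indicator (hA ε))
  have hint : ∀ ε, ∫ x in A ε, g x = ∫ y in B, F ε y := by
    intro ε
    rw [← integral_indicator (hA ε), ← he.measurePreserving.integral_comp
      e.toHomeomorph.measurableEmbedding, Measure.volume_eq_prod, integral_prod _ (hGi ε)]
    refine (setIntegral_eq_integral_of_forall_compl_eq_zero fun y hy => ?_).symm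
    have : ∀ t, (A ε).indicator g (e (y, t)) = 0 := fun t => by
      by_contra hne
      have h1 : g (e (y, t)) ≠ 0 := fun h0 => hne (Set.indicator_apply_eq_zero.2 fun _ => h0)
      exact hy (hsupp y t h1).1
    simp [this]
  have hFint : ∀ ε, Integrable (F ε) := fun ε => (hGi ε).integral_prod_left
  have hGy : ∀ y, Continuous fun t => g (e (y, t)) := fun y => by fun_prop
  have hGyi : ∀ y, Integrable fun t => g (e (y, t)) := fun y => by
    refine (hGy y).integrable_of_hasCompactSupport
      (HasCompactSupport.intro (isCompact_closedBall t₀ η) fun t ht => ?_)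
    by_contra h
    exact ht (Metric.ball_subset_closedBall (hsupp y t h).2)
  -- Membership in `A ε` is known only inside the chart, but `g` vanishes elsewhere on the vertical
  -- line. The slice may thus be replaced by a full half-line, and `ε` enters only through its
  -- endpoint.
  have hFeq : ∀ ε y, |ε| < η → y ∈ B → F ε y = ∫ t in Set.Iic (f (ε, y)), g (e (y, t)) := by
    intro ε y hε hy
    rw [← integral_indicator measurableSet_Iic]
    refine integral_congr_ae (Eventually.of_forall fun t => ?_)
    simp only
    by_cases h0 : g (e (y, t)) = 0
    · exact (Set.indicator_apply_eq_zero.2 fun _ => h0).trans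
        (Set.indicator_apply_eq_zero (f := fun t => g (e (y, t))).2 fun _ => h0).symm
    · have ht := (hsupp y t h0).2
      have hiff := hmem ε y t hε hy ht
      by_cases h : t ≤ f (ε, y)
      · rw [Set.indicator_of_mem (hiff.2 h), Set.indicator_of_mem (Set.mem_Iic.2 h)]
      · rw [Set.indicator_of_notMem fun h' => h (hiff.1 h'),
          Set.indicator_of_notMem fun h' => h (Set.mem_Iic.1 h')]
  have hsub : ∀ ε ε' y, |ε| < η → |ε'| < η → y ∈ B →
      F ε y - F ε' y = ∫ t in (f (ε', y))..(f (ε, y)), g (e (y, t)) := by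
    intro ε ε' y hε hε' hy
    rw [hFeq ε y hε hy, hFeq ε' y hε' hy]
    exact intervalIntegral.integral_Iic_sub_Iic (hGyi y).integrableOn (hGyi y).integrableOn
  have hfd : ∀ ε y, |ε| < η → y ∈ B →
      HasDerivAt (fun ε => f (ε, y)) (fderiv ℝ f (ε, y) (1, 0)) ε := by
    intro ε y hε hy
    exact (hf ε y hε hy).1.hasFDerivAt.comp_hasDerivAt ε
      ((hasDerivAt_id ε).prodMk (hasDerivAt_const ε y))
  have hfd_le : ∀ ε y, |ε| < η → y ∈ B → ‖fderiv ℝ f (ε, y) (1, 0)‖ ≤ K := by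
    intro ε y hε hy
    refine ((fderiv ℝ f (ε, y)).le_opNorm _).trans ?_
    rw [Prod.norm_mk, norm_one, norm_zero, max_eq_left zero_le_one, mul_one]
    exact (hf ε y hε hy).2
  have hK0 : 0 ≤ K := (norm_nonneg _).trans
    (hf 0 y₀ (by simpa using hη) (Metric.mem_ball_self hη)).2
  have hball : ∀ ε, ε ∈ Metric.ball (0 : ℝ) η → |ε| < η := fun ε h => by simpa using h
  simp_rw [hint]
  -- The Lipschitz constant in time is `M * K`: `|g| ≤ M`, and the height of the graph moves with
  -- speed at most `K`.
  refine (hasDerivAt_integral_of_dominated_loc_of_lip (μ := volume.restrict B) (F := F)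
    (bound := fun _ => M * K) (s := Metric.ball 0 η) (Metric.ball_mem_nhds 0 hη)
    (Eventually.of_forall fun ε => (hFint ε).aestronglyMeasurable.restrict) (hFint 0).integrableOn
    ?_ ?_ ?_ ?_).2
  · refine AEStronglyMeasurable.mul ?_ ?_
    · refine (ContinuousOn.aestronglyMeasurable ?_ Metric.isOpen_ball.measurableSet)
      intro y hy
      have h1 : ContinuousAt f (0, y) := (hf 0 y (by simpa using hη) hy).1.continuousAt
      have h2 : ContinuousAt (fun y => f (0, y)) y :=
        h1.comp (f := fun y => ((0 : ℝ), y)) (Continuous.prodMk_right (0 : ℝ)).continuousAt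
      refine ContinuousAt.continuousWithinAt ?_
      exact hg.continuousAt.comp (e.continuous.continuousAt.comp (continuousAt_id.prodMk h2))
    · refine Measurable.aestronglyMeasurable ?_
      exact (measurable_fderiv_apply_const ℝ f (1, 0)).comp measurable_prodMk_left
  · refine (ae_restrict_mem Metric.isOpen_ball.measurableSet).mono fun y hy => ?_
    refine LipschitzOnWith.of_dist_le_mul fun ε hε ε' hε' => ?_
    rw [Real.dist_eq, hsub ε ε' y (hball ε hε) (hball ε' hε') hy, Real.coe_nnabs,
      abs_of_nonneg (a := M * K) (by positivity), ← Real.norm_eq_abs, mul_assoc]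
    refine (intervalIntegral.norm_integral_le_of_norm_le_const fun t _ => hM _).trans ?_
    gcongr
    have hconv := (convex_ball (0 : ℝ) η).norm_image_sub_le_of_norm_hasDerivWithin_le
      (f := fun ε => f (ε, y)) (C := K)
      (fun s hs => (hfd s y (hball s hs) hy).hasDerivWithinAt)
      (fun s hs => hfd_le s y (hball s hs) hy) hε' hε
    simpa [Real.dist_eq] using hconv
  · exact integrableOn_const measure_ball_lt_top.ne
  · refine (ae_restrict_mem Metric.isOpen_ball.measurableSet).mono fun y hy => ?_
    have h0 : |(0 : ℝ)| < η := by simpa using hη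
    have h1 : HasDerivAt (fun u => ∫ t in (f (0, y))..u, g (e (y, t))) (g (e (y, f (0, y))))
        (f (0, y)) :=
      intervalIntegral.integral_hasDerivAt_right ((hGy y).intervalIntegrable _ _)
        ((hGy y).stronglyMeasurableAtFilter _ _) (hGy y).continuousAt
    have h2 := (HasDerivAt.comp (0 : ℝ) h1 (hfd 0 y h0 hy)).const_add (F 0 y)
    refine h2.congr_of_eventuallyEq ?_
    filter_upwards [Metric.ball_mem_nhds (0 : ℝ) hη] with ε hε
    have := hsub ε 0 y (hball ε hε) h0 hy
    simp only [Function.comp_apply]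
    linarith

/-- Surface integrals over a piece of a graph. -/
theorem setIntegral_hausdorff_graph {B : Set (Space n)} {u : Space n → ℝ}
    {u' : Space n → Space n →L[ℝ] ℝ} (he : IsSplitting e) (hB : IsOpen B) (hBfin : volume B ≠ ⊤)
    (hu : ∀ x ∈ B, HasStrictFDerivAt u (u' x) x) (hu' : ContinuousOn u' B) {K : ℝ≥0}
    (hK : LipschitzOnWith K u B) {S : Set (Space (n + 1))} (hS : MeasurableSet S)
    (hg : ContinuousOn g S) (hsub : ∀ x ∈ S, g x ≠ 0 → x ∈ (fun y => e (y, u y)) '' B) :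
    ∫ x in S, g x ∂μHE[n] =
      ∫ y in B, √(1 + ‖u' y‖ ^ 2) * S.indicator g (e (y, u y)) := by
  have hSm : Measurable (S.indicator g) := by
    classical
    rw [← Set.piecewise_eq_indicator]
    exact hg.measurable_piecewise continuousOn_const hS
  have hFc : ContinuousOn (fun y => e (y, u y)) B :=
    e.continuous.comp_continuousOn (continuousOn_id.prodMk hK.continuousOn)
  have hFm : AEMeasurable (fun y => e (y, u y)) (volume.restrict B) :=
    hFc.aemeasurable hB.measurableSet
  have hJ : AEMeasurable (fun y => ENNReal.ofReal (√(1 + ‖u' y‖ ^ 2))) (volume.restrict B) := by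
    refine AEMeasurable.ennreal_ofReal (ContinuousOn.aemeasurable ?_ hB.measurableSet)
    exact (continuousOn_const.add (hu'.norm.pow 2)).sqrt
  rw [← integral_indicator hS]
  have h1 : ∫ x, S.indicator g x ∂μHE[n] =
      ∫ x in (fun y => e (y, u y)) '' B, S.indicator g x ∂μHE[n] := by
    refine (setIntegral_eq_integral_of_forall_compl_eq_zero fun x hx => ?_).symm
    by_contra hne
    have hxS : x ∈ S := Set.mem_of_indicator_ne_zero hne
    rw [Set.indicator_of_mem hxS] at hne
    exact hx (hsub x hxS hne)
  rw [h1, restrict_graph_eq_map he hB hBfin hu hK, integral_map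
    (hFm.mono_ac (withDensity_absolutelyContinuous _ _)) hSm.aestronglyMeasurable,
    integral_withDensity_eq_integral_toReal_smul₀ hJ
      (Eventually.of_forall fun _ => ENNReal.ofReal_lt_top)]
  refine integral_congr_ae (Eventually.of_forall fun y => ?_)
  simp [ENNReal.toReal_ofReal (Real.sqrt_nonneg _)]

end Reynolds

/-! ### The local transport theorem -/

section Moving

variable {n : ℕ} {E : Set (Space (n + 1))} {ε₀ : ℝ}
  {Φ : ℝ → (Space (n + 1) ≃ₘ^2⟮𝓘(ℝ, Space (n + 1)), 𝓘(ℝ, Space (n + 1))⟯ Space (n + 1))}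

theorem IsC2Family.continuous_velocity {d : ℕ}
    {Φ : ℝ → (Space d ≃ₘ^2⟮𝓘(ℝ, Space d), 𝓘(ℝ, Space d)⟯ Space d)} (hΦ : IsC2Family ε₀ Φ) :
    Continuous fun x => deriv (fun ε => Φ ε x) 0 := by
  rw [continuous_iff_continuousAt]
  intro x
  have h1 : ContinuousAt (fun q : ℝ × Space d => fderiv ℝ (fun p : ℝ × Space d => Φ p.1 p.2) q)
      (0, x) := ((hΦ.contDiffAt hΦ.zero_mem x).fderiv_right (m := 1) (by norm_num)).continuousAt
  have h2 : ContinuousAt (fun x => fderiv ℝ (fun p : ℝ × Space d => Φ p.1 p.2) (0, x) (1, 0)) x :=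
    (h1.comp (f := fun x => ((0 : ℝ), x)) (Continuous.prodMk_right (0 : ℝ)).continuousAt).clm_apply
      continuousAt_const
  refine h2.congr (Eventually.of_forall fun y => ?_)
  have h3 := ((hΦ.contDiffAt hΦ.zero_mem y).differentiableAt (by norm_num)).hasFDerivAt
  exact (h3.comp_hasDerivAt (0 : ℝ) ((hasDerivAt_id (0 : ℝ)).prodMk
    (hasDerivAt_const (0 : ℝ) y))).deriv.symm

/-- The transport theorem for densities supported near a boundary point. -/
theorem IsC2Domain.exists_hasDerivAt_setIntegral (hE : IsC2Domain E) (hΦ : IsC2Family ε₀ Φ)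
    {p : Space (n + 1)} (hp : p ∈ frontier E) :
    ∃ W, IsOpen W ∧ p ∈ W ∧ ∀ g : Space (n + 1) → ℝ, Continuous g → HasCompactSupport g →
      tsupport g ⊆ W → HasDerivAt (fun ε => ∫ x in Φ ε '' E, g x)
        (∫ x in frontier E, g x * inner ℝ (deriv (fun ε => Φ ε x) 0) (outerNormal E x) ∂μHE[n]) 0
      := by
  obtain ⟨e, f, h⟩ := hE.exists_isGraphChart hΦ hp
  have he := h.isSplitting
  set y₀ := (e.symm p).1 with hy₀
  set t₀ := (e.symm p).2 with ht₀
  have hlim : Tendsto (fun x => ((0 : ℝ), x)) (𝓝 p) (𝓝 (0, p)) :=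
    (Continuous.prodMk_right (0 : ℝ)).tendsto p
  have helim : Tendsto (fun w => e w) (𝓝 (e.symm p)) (𝓝 p) := by
    have := e.continuous.tendsto (e.symm p)
    rwa [e.apply_symm_apply] at this
  have hev1 := helim.eventually ((hlim.eventually h.eventually_mem_frontier_iff).and
    ((hlim.eventually h.eventually_outerNormal_eq).and (h.eventually_fderiv_eq_inner hΦ)))
  have hfd : ContinuousAt (fun q => ‖fderiv ℝ f q‖) (0, y₀) :=
    ((h.contDiffAt.fderiv_right (m := 1) (by norm_num)).continuousAt).norm
  set K : ℝ := ‖fderiv ℝ f (0, y₀)‖ + 1 with hKdef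
  have hev2 : ∀ᶠ q in 𝓝 ((0 : ℝ), y₀), ContDiffAt ℝ 2 f q ∧ ‖fderiv ℝ f q‖ < K :=
    (eventually_contDiffAt h.contDiffAt).and
      (hfd.eventually_lt continuousAt_const (by simp [hKdef]))
  obtain ⟨η₁, hη₁, hb1⟩ := Metric.eventually_nhds_iff_ball.1 hev1
  obtain ⟨η₂, hη₂, hb2⟩ := Metric.eventually_nhds_iff_ball.1 hev2
  obtain ⟨η₃, hη₃, hb3⟩ := Metric.eventually_nhds_iff_ball.1 h.mem_iff
  set η := min η₁ (min η₂ η₃) with hηdef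
  have hη : 0 < η := lt_min hη₁ (lt_min hη₂ hη₃)
  have hle1 : η ≤ η₁ := min_le_left _ _
  have hle2 : η ≤ η₂ := (min_le_right _ _).trans (min_le_left _ _)
  have hle3 : η ≤ η₃ := (min_le_right _ _).trans (min_le_right _ _)
  have hf : ∀ ε y, |ε| < η → y ∈ Metric.ball y₀ η →
      ContDiffAt ℝ 2 f (ε, y) ∧ ‖fderiv ℝ f (ε, y)‖ < K := by
    intro ε y hε hy
    refine hb2 (ε, y) ?_
    rw [← ball_prod_same]
    exact ⟨by simpa using hε.trans_le hle2, Metric.ball_subset_ball hle2 hy⟩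
  have hmem : ∀ ε y t, |ε| < η → y ∈ Metric.ball y₀ η → t ∈ Metric.ball t₀ η →
      (e (y, t) ∈ Φ ε '' E ↔ t ≤ f (ε, y)) := by
    intro ε y t hε hy ht
    refine hb3 (ε, (y, t)) ?_
    rw [← ball_prod_same]
    refine ⟨by simpa using hε.trans_le hle3, ?_⟩
    have : e.symm p = (y₀, t₀) := rfl
    rw [this, ← ball_prod_same]
    exact ⟨Metric.ball_subset_ball hle3 hy, Metric.ball_subset_ball hle3 ht⟩
  have hchart : ∀ y t, y ∈ Metric.ball y₀ η → t ∈ Metric.ball t₀ η →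
      (e (y, t) ∈ frontier E ↔ t = f (0, y)) ∧ (e (y, t) ∈ frontier E →
        outerNormal E (e (y, t)) = ‖upNormal e f (0, y)‖⁻¹ • upNormal e f (0, y) ∧
        fderiv ℝ f (0, y) (1, 0) =
          inner ℝ (deriv (fun ε => Φ ε (e (y, t))) 0) (upNormal e f (0, y))) := by
    intro y t hy ht
    have hm : (y, t) ∈ Metric.ball (e.symm p) η₁ := by
      have : e.symm p = (y₀, t₀) := rfl
      rw [this, ← ball_prod_same]
      exact ⟨Metric.ball_subset_ball hle1 hy, Metric.ball_subset_ball hle1 ht⟩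
    obtain ⟨h1, h2, h3⟩ := hb1 (y, t) hm
    simp only [hΦ.coe_zero, Set.image_id, graphDefect, e.symm_apply_apply, sub_eq_zero] at h1 h2 h3
    exact ⟨h1, fun hfr => ⟨h2 hfr, h3 hfr⟩⟩
  refine ⟨e.symm ⁻¹' (Metric.ball y₀ η ×ˢ Metric.ball t₀ η),
    (Metric.isOpen_ball.prod Metric.isOpen_ball).preimage e.symm.continuous,
    ⟨Metric.mem_ball_self hη, Metric.mem_ball_self hη⟩, fun g hg hgc hgW => ?_⟩
  have hsupp : ∀ y t, g (e (y, t)) ≠ 0 → y ∈ Metric.ball y₀ η ∧ t ∈ Metric.ball t₀ η := by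
    intro y t hne
    have := hgW (subset_tsupport g hne)
    simpa using this
  have hA : ∀ ε, MeasurableSet (Φ ε '' E) := fun ε => (hE.image (Φ ε)).isClosed.measurableSet
  have hder := hasDerivAt_setIntegral_subgraph (A := fun ε => Φ ε '' E) he hA hη (K := K)
    (fun ε y hε hy => ⟨(hf ε y hε hy).1.differentiableAt (by norm_num), (hf ε y hε hy).2.le⟩)
    hmem hg hgc hsupp
  convert hder using 1
  have h0 : |(0 : ℝ)| < η := by simpa using hη
  have hstrict : ∀ y ∈ Metric.ball y₀ η, HasStrictFDerivAt (fun y => f (0, y))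
      (fderiv ℝ f (0, y) ∘L .inr ℝ ℝ (Space n)) y := fun y hy =>
    ((hf 0 y h0 hy).1.hasStrictFDerivAt (by norm_num)).comp y
      ((hasStrictFDerivAt_const (0 : ℝ) y).prodMk (hasStrictFDerivAt_id y))
  have hcont : ContinuousOn (fun y => fderiv ℝ f (0, y) ∘L .inr ℝ ℝ (Space n))
      (Metric.ball y₀ η) := by
    intro y hy
    have h1 : ContinuousAt (fderiv ℝ f) (0, y) :=
      ((hf 0 y h0 hy).1.fderiv_right (m := 1) (by norm_num)).continuousAt
    have h2 : ContinuousAt (fun y => fderiv ℝ f (0, y)) y :=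
      h1.comp (f := fun y => ((0 : ℝ), y)) (Continuous.prodMk_right (0 : ℝ)).continuousAt
    exact (h2.clm_comp continuousAt_const).continuousWithinAt
  have hlip : LipschitzOnWith K.toNNReal (fun y => f (0, y)) (Metric.ball y₀ η) := by
    refine (convex_ball y₀ η).lipschitzOnWith_of_nnnorm_hasFDerivWithin_le
      (fun y hy => (hstrict y hy).hasFDerivAt.hasFDerivWithinAt) fun y hy => ?_
    rw [← norm_toNNReal]
    refine Real.toNNReal_le_toNNReal ?_
    refine (ContinuousLinearMap.opNorm_comp_le _ _).trans ?_
    refine (mul_le_of_le_one_right (norm_nonneg _)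
      (ContinuousLinearMap.norm_inr_le_one _ _ _)).trans
      (hf 0 y h0 hy).2.le
  have hbfr : ContinuousOn (fun x => g x * inner ℝ (deriv (fun ε => Φ ε x) 0) (outerNormal E x))
      (frontier E) :=
    hg.continuousOn.mul (hΦ.continuous_velocity.continuousOn.inner hE.continuousOn_outerNormal)
  rw [setIntegral_hausdorff_graph he Metric.isOpen_ball measure_ball_lt_top.ne hstrict hcont hlip
    isClosed_frontier.measurableSet hbfr ?_]
  -- The area element `√(1 + |∇f|²)` equals `|N|` and `ν = N/|N|`, so the factors cancel and the
  -- integrand becomes `g ψ·N = g ∂_ε f`.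
  · refine setIntegral_congr_fun Metric.isOpen_ball.measurableSet fun y hy => ?_
    simp only
    by_cases hne : g (e (y, f (0, y))) = 0
    · rw [hne, zero_mul, Set.indicator_apply_eq_zero.2 fun _ => by rw [hne, zero_mul], mul_zero]
    · have ht := (hsupp _ _ hne).2
      obtain ⟨h1, h2⟩ := hchart y _ hy ht
      have hfr := h1.2 rfl
      obtain ⟨h3, h4⟩ := h2 hfr
      have hn := one_le_norm_upNormal (f := f) he (0, y)
      rw [Set.indicator_of_mem hfr, h3, h4, ← norm_upNormal_sq he, Real.sqrt_sq (norm_nonneg _),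
        real_inner_smul_right]
      field_simp
  · intro x hx hne
    have hgx : g x ≠ 0 := left_ne_zero_of_mul hne
    obtain ⟨⟨y, t⟩, rfl⟩ := e.surjective x
    obtain ⟨hy, ht⟩ := hsupp y t hgx
    refine ⟨y, hy, ?_⟩
    simp only
    rw [← (hchart y t hy ht).1.1 hx]

end Moving


/-! ### How far the boundary moves -/

section Flow

variable {d : ℕ} {ε₀ : ℝ} {Φ : ℝ → (Space d ≃ₘ^2⟮𝓘(ℝ, Space d), 𝓘(ℝ, Space d)⟯ Space d)}

theorem IsC2Family.hasDerivAt_fderiv (hΦ : IsC2Family ε₀ Φ) {ε : ℝ} (hε : ε ∈ Set.Ioo (-ε₀) ε₀)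
    (x : Space d) : HasDerivAt (fun s => Φ s x)
      (fderiv ℝ (fun p : ℝ × Space d => Φ p.1 p.2) (ε, x) (1, 0)) ε :=
  ((hΦ.contDiffAt hε x).differentiableAt (by norm_num)).hasFDerivAt.comp_hasDerivAt
    (f := fun s : ℝ => (s, x)) ε ((hasDerivAt_id ε).prodMk (hasDerivAt_const ε x))

/-- On compact sets, the family is uniformly Lipschitz in time and space. -/
theorem IsC2Family.exists_flow_bound (hΦ : IsC2Family ε₀ Φ) {S : Set (Space d)} (hS : IsCompact S) :
    ∃ L η : ℝ, 0 < L ∧ 0 < η ∧ η < ε₀ ∧ ∀ ε, |ε| ≤ η →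
      (∀ x ∈ S, ‖Φ ε x - x‖ ≤ L * |ε|) ∧ (∀ x ∈ S, ∀ y ∈ S, ‖Φ ε x - Φ ε y‖ ≤ L * ‖x - y‖) ∧
      ∀ x ∈ S, ‖deriv (fun s => Φ s x) ε‖ ≤ L := by
  obtain ⟨R, hR⟩ := hS.isBounded.subset_closedBall 0
  set η := ε₀ / 2 with hη
  have hpos := hΦ.pos
  -- The mean value inequality needs a convex set, so `S` is enclosed in a box.
  set Q : Set (ℝ × Space d) := Metric.closedBall 0 η ×ˢ Metric.closedBall 0 R with hQ
  have hIoo : ∀ ε : ℝ, |ε| ≤ η → ε ∈ Set.Ioo (-ε₀) ε₀ := fun ε hε => by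
    rw [Set.mem_Ioo, ← abs_lt]
    linarith
  have hQmem : ∀ q ∈ Q, q.1 ∈ Set.Ioo (-ε₀) ε₀ := fun q hq => by
    have := hq.1
    rw [mem_closedBall_zero_iff, Real.norm_eq_abs] at this
    exact hIoo _ this
  have hQc : IsCompact Q := (isCompact_closedBall _ _).prod (isCompact_closedBall _ _)
  have hQconv : Convex ℝ Q := (convex_closedBall _ _).prod (convex_closedBall _ _)
  set G : ℝ × Space d → Space d := fun p => Φ p.1 p.2 with hG
  have hGd : ∀ q ∈ Q, ContDiffAt ℝ 2 G q := fun q hq => hΦ.contDiffAt (hQmem q hq) q.2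
  obtain ⟨L', hL'⟩ := hQc.exists_bound_of_continuousOn (f := fderiv ℝ G) fun q hq =>
    ((hGd q hq).fderiv_right (m := 1) (by norm_num)).continuousAt.continuousWithinAt
  set L := max L' 1 with hL
  have hbound : ∀ q ∈ Q, ‖fderiv ℝ G q‖ ≤ L := fun q hq => (hL' q hq).trans (le_max_left _ _)
  have hlip : ∀ q ∈ Q, ∀ q' ∈ Q, ‖G q - G q'‖ ≤ L * ‖q - q'‖ := fun q hq q' hq' =>
    hQconv.norm_image_sub_le_of_norm_fderiv_le
      (fun z hz => (hGd z hz).differentiableAt (by norm_num))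
      hbound hq' hq
  have hmem : ∀ ε x, |ε| ≤ η → x ∈ S → (ε, x) ∈ Q := fun ε x hε hx =>
    ⟨by simpa using hε, hR hx⟩
  refine ⟨L, η, lt_of_lt_of_le one_pos (le_max_right _ _), by positivity, by linarith,
    fun ε hε => ⟨fun x hx => ?_, fun x hx y hy => ?_, fun x hx => ?_⟩⟩
  · have h := hlip _ (hmem ε x hε hx) _ (hmem 0 x (by rw [abs_zero]; positivity) hx)
    simpa [hG, hΦ.zero] using h
  · have h := hlip _ (hmem ε x hε hx) _ (hmem ε y hε hy)
    simpa [hG] using h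
  · rw [(hΦ.hasDerivAt_fderiv (hIoo ε hε) x).deriv]
    refine (ContinuousLinearMap.le_opNorm _ _).trans ?_
    rw [Prod.norm_mk, norm_one, norm_zero, max_eq_left zero_le_one, mul_one]
    exact hbound _ (hmem ε x hε hx)

/-- A point that changes sides is crossed by the moving boundary. -/
theorem IsC2Family.symmDiff_subset (hΦ : IsC2Family ε₀ Φ) {E : Set (Space d)} {ε : ℝ}
    (hε : ε ∈ Set.Ioo (-ε₀) ε₀) {x : Space d} (hx : x ∈ symmDiff (Φ ε '' E) E) :
    ∃ s, |s| ≤ |ε| ∧ ∃ y ∈ frontier E, Φ s y = x := by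
  have hle : ∀ s ∈ Set.uIcc 0 ε, |s| ≤ |ε| := fun s hs => by
    simpa using Set.abs_sub_left_of_mem_uIcc hs
  -- The curve `s ↦ Φ_s⁻¹(x)` joins `x` to `Φ_ε⁻¹(x)`. Exactly one of these endpoints is in `E`, so
  -- the curve meets `∂E`.
  have hcont : ContinuousOn (fun s => (Φ s).symm x) (Set.uIcc 0 ε) := fun s hs => by
    have hs' : s ∈ Set.Ioo (-ε₀) ε₀ := by
      rw [Set.mem_Ioo, ← abs_lt] at hε ⊢
      exact (hle s hs).trans_lt hε
    have h1 : ContinuousAt (fun s => (Φ s).symm x) s :=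
      (hΦ.contDiffAt_symm hs' x).continuousAt.comp (f := fun s : ℝ => (s, x)) (by fun_prop)
    exact h1.continuousWithinAt
  have hpre := isPreconnected_uIcc.image _ hcont
  have h0 : x ∈ (fun s => (Φ s).symm x) '' Set.uIcc 0 ε := ⟨0, Set.left_mem_uIcc, hΦ.symm_zero x⟩
  have h1 : (Φ ε).symm x ∈ (fun s => (Φ s).symm x) '' Set.uIcc 0 ε := ⟨ε, Set.right_mem_uIcc, rfl⟩
  have hiff : x ∈ Φ ε '' E ↔ (Φ ε).symm x ∈ E :=
    ⟨fun ⟨y, hy, hyx⟩ => by rwa [← hyx, (Φ ε).symm_apply_apply],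
      fun h => ⟨_, h, (Φ ε).apply_symm_apply x⟩⟩
  have hne : ((fun s => (Φ s).symm x) '' Set.uIcc 0 ε ∩ frontier E).Nonempty := by
    rcases hx with ⟨hx1, hx2⟩ | ⟨hx1, hx2⟩
    · exact inter_frontier_nonempty_of_isPreconnected hpre ⟨_, h1, hiff.1 hx1⟩ ⟨_, h0, hx2⟩
    · exact inter_frontier_nonempty_of_isPreconnected hpre ⟨_, h0, hx1⟩
        ⟨_, h1, fun h => hx2 (hiff.2 h)⟩
  obtain ⟨_, ⟨s, hs, rfl⟩, hfr⟩ := hne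
  exact ⟨s, hle s hs, _, hfr, (Φ s).apply_symm_apply x⟩

theorem IsC2Domain.exists_symmDiff_subset_thickening {E : Set (Space d)} (hE : IsC2Domain E)
    (hΦ : IsC2Family ε₀ Φ) : ∃ L η : ℝ, 0 < L ∧ 0 < η ∧ ∀ ε, |ε| ≤ η →
      symmDiff (Φ ε '' E) E ⊆ Metric.thickening (L * |ε|) (frontier E) := by
  obtain ⟨L, η, hL, hη, hηε, h⟩ := hΦ.exists_flow_bound hE.isCompact_frontier
  -- `L + 1` instead of `L` gives the strict inequality required by the open thickening.
  refine ⟨L + 1, η, by linarith, hη, fun ε hε x hx => ?_⟩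
  rcases eq_or_ne ε 0 with rfl | hne
  · rw [hΦ.coe_zero, Set.image_id, symmDiff_self] at hx
    exact hx.elim
  · obtain ⟨s, hs, y, hy, rfl⟩ := hΦ.symmDiff_subset (by
      rw [Set.mem_Ioo, ← abs_lt]; exact hε.trans_lt hηε) hx
    refine Metric.mem_thickening_iff.2 ⟨y, hy, ?_⟩
    rw [dist_eq_norm]
    have h1 := (h s (hs.trans hε)).1 y hy
    have h2 : L * |s| ≤ L * |ε| := by gcongr
    have h3 : 0 < |ε| := abs_pos.2 hne
    linarith

end Flow

/-! ### The global transport theorem -/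

section Transport

variable {n : ℕ} {E : Set (Space (n + 1))} {ε₀ : ℝ}
  {Φ : ℝ → (Space (n + 1) ≃ₘ^2⟮𝓘(ℝ, Space (n + 1)), 𝓘(ℝ, Space (n + 1))⟯ Space (n + 1))}

theorem IsC2Domain.exists_volume_symmDiff_le (hE : IsC2Domain E) (hΦ : IsC2Family ε₀ Φ) :
    ∃ C : ℝ, 0 ≤ C ∧ ∀ᶠ ε in 𝓝 (0 : ℝ),
      volume (symmDiff (Φ ε '' E) E) ≤ ENNReal.ofReal (C * |ε|) := by
  obtain ⟨L, η, hL, hη, h⟩ := hE.exists_symmDiff_subset_thickening hΦ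
  obtain ⟨C, ρ, hC, hρ, htube⟩ := hE.exists_volume_thickening_le
  refine ⟨C * L, by positivity, ?_⟩
  have hpos : 0 < min η (ρ / L) := lt_min hη (by positivity)
  filter_upwards [Metric.ball_mem_nhds (0 : ℝ) hpos] with ε hε
  rw [mem_ball_zero_iff, Real.norm_eq_abs, lt_min_iff] at hε
  rcases eq_or_ne ε 0 with rfl | hne
  · simp [hΦ.coe_zero]
  · have h3 : 0 < |ε| := abs_pos.2 hne
    refine (measure_mono (h ε hε.1.le)).trans ?_
    rw [mul_assoc]
    refine htube _ (by positivity) ?_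
    have := (lt_div_iff₀ hL).1 hε.2
    linarith

theorem IsC2Domain.continuousOn_normalSpeed (hE : IsC2Domain E) (hΦ : IsC2Family ε₀ Φ) :
    ContinuousOn (fun x => inner ℝ (deriv (fun ε => Φ ε x) 0) (outerNormal E x)) (frontier E) :=
  hΦ.continuous_velocity.continuousOn.inner hE.continuousOn_outerNormal

theorem IsC2Domain.isFiniteMeasure_hausdorff (hE : IsC2Domain E) :
    IsFiniteMeasure ((μHE[n] : Measure (Space (n + 1))).restrict (frontier E)) :=
  ⟨by simpa using hE.hausdorff_frontier_lt_top⟩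

theorem IsC2Domain.integrableOn_frontier (hE : IsC2Domain E) {g : Space (n + 1) → ℝ}
    (hg : ContinuousOn g (frontier E)) : IntegrableOn g (frontier E) μHE[n] := by
  have := hE.isFiniteMeasure_hausdorff
  obtain ⟨M, hM⟩ := hE.isCompact_frontier.exists_bound_of_continuousOn hg
  refine Integrable.of_bound (hg.aestronglyMeasurable isClosed_frontier.measurableSet) M ?_
  exact (ae_restrict_mem isClosed_frontier.measurableSet).mono hM

/-- The transport theorem. -/
theorem IsC2Domain.hasDerivAt_integral_indicator_sub (hE : IsC2Domain E) (hΦ : IsC2Family ε₀ Φ)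
    {g : Space (n + 1) → ℝ} (hg : Continuous g) :
    HasDerivAt (fun ε => ∫ x, ((Φ ε '' E).indicator 1 x - E.indicator 1 x) * g x)
      (∫ x in frontier E,
        g x * inner ℝ (deriv (fun ε => Φ ε x) 0) (outerNormal E x) ∂μHE[n]) 0 := by
  choose! W hWo hWp hW using fun p (hp : p ∈ frontier E) => hE.exists_hasDerivAt_setIntegral hΦ hp
  obtain ⟨t, ht, hcover⟩ := hE.isCompact_frontier.elim_nhds_subcover W
    fun p hp => (hWo p hp).mem_nhds (hWp p hp)
  set s : Fin t.card → Set (Space (n + 1)) := fun i => W (t.equivFin.symm i) with hs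
  have hso : ∀ i, IsOpen (s i) := fun i => hWo _ (ht _ (t.equivFin.symm i).2)
  have hcov : frontier E ⊆ ⋃ i, s i := fun x hx => by
    obtain ⟨p, hp, hxp⟩ := Set.mem_iUnion₂.1 (hcover hx)
    exact Set.mem_iUnion.2 ⟨t.equivFin ⟨p, hp⟩, by simpa [hs] using hxp⟩
  -- The partition of unity must sum to one on a neighbourhood of `∂E`, so that it does so on
  -- `Φ_ε(E) Δ E` for small `ε`. Off that set the indicator difference is zero, so `g` itself needs
  -- no compact support.
  obtain ⟨ρ, hρ, hρs⟩ := hE.isCompact_frontier.exists_cthickening_subset_open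
    (isOpen_iUnion hso) hcov
  obtain ⟨χ, hχs, hχ1, -, hχc⟩ := exists_continuous_sum_one_of_isOpen_isCompact hso
    (hE.isCompact_frontier.cthickening (r := ρ)) hρs
  have hA : ∀ ε, MeasurableSet (Φ ε '' E) := fun ε => (hE.image (Φ ε)).isClosed.measurableSet
  have hEm := hE.isClosed.measurableSet
  have hgi : ∀ i, Continuous fun x => χ i x * g x := fun i => (χ i).continuous.mul hg
  have hgc : ∀ i, HasCompactSupport fun x => χ i x * g x := fun i => (hχc i).mul_right
  have hgs : ∀ i, tsupport (fun x => χ i x * g x) ⊆ s i := fun i =>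
    (tsupport_mul_subset_left).trans (hχs i)
  have hint : ∀ i, Integrable fun x => χ i x * g x := fun i =>
    (hgi i).integrable_of_hasCompactSupport (hgc i)
  have hder : HasDerivAt (fun ε => ∑ i, ((∫ x in Φ ε '' E, χ i x * g x) - ∫ x in E, χ i x * g x))
      (∑ i, ∫ x in frontier E, χ i x * g x *
        inner ℝ (deriv (fun ε => Φ ε x) 0) (outerNormal E x) ∂μHE[n]) 0 :=
    HasDerivAt.fun_sum fun i _ =>
      (hW _ (ht _ (t.equivFin.symm i).2) _ (hgi i) (hgc i) (hgs i)).sub_const _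
  have hval : ∑ i, ∫ x in frontier E, χ i x * g x *
      inner ℝ (deriv (fun ε => Φ ε x) 0) (outerNormal E x) ∂μHE[n] =
      ∫ x in frontier E, g x * inner ℝ (deriv (fun ε => Φ ε x) 0) (outerNormal E x) ∂μHE[n] := by
    have hii : ∀ i ∈ Finset.univ, IntegrableOn (fun x => χ i x * g x *
        inner ℝ (deriv (fun ε => Φ ε x) 0) (outerNormal E x)) (frontier E) μHE[n] := fun i _ =>
      hE.integrableOn_frontier ((hgi i).continuousOn.mul (hE.continuousOn_normalSpeed hΦ))
    rw [← integral_finsetSum _ hii]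
    refine setIntegral_congr_fun isClosed_frontier.measurableSet fun x hx => ?_
    have h1 : ∑ i, χ i x = 1 := by
      have := hχ1 (Metric.self_subset_cthickening _ hx)
      simpa using this
    rw [← Finset.sum_mul, ← Finset.sum_mul, h1, one_mul]
  rw [hval] at hder
  refine hder.congr_of_eventuallyEq ?_
  obtain ⟨L, η, hL, hη, h⟩ := hE.exists_symmDiff_subset_thickening hΦ
  have hpos : 0 < min η (ρ / L) := lt_min hη (by positivity)
  filter_upwards [Metric.ball_mem_nhds (0 : ℝ) hpos] with ε hε
  rw [mem_ball_zero_iff, Real.norm_eq_abs, lt_min_iff] at hε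
  have hone : ∀ (A : Set (Space (n + 1))) (F : Space (n + 1) → ℝ) (x : Space (n + 1)),
      A.indicator F x = A.indicator 1 x * F x := fun A F x => by
    by_cases hx : x ∈ A <;> simp [hx]
  have hterm : ∀ i, (∫ x in Φ ε '' E, χ i x * g x) - ∫ x in E, χ i x * g x =
      ∫ x, ((Φ ε '' E).indicator 1 x - E.indicator 1 x) * (χ i x * g x) := fun i => by
    rw [← integral_indicator (hA ε), ← integral_indicator hEm,
      ← integral_sub ((hint i).indicator (hA ε)) ((hint i).indicator hEm)]
    refine integral_congr_ae (Eventually.of_forall fun x => ?_)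
    simp only
    rw [hone (Φ ε '' E), hone E, sub_mul]
  have hti : ∀ i, Integrable fun x =>
      ((Φ ε '' E).indicator 1 x - E.indicator 1 x) * (χ i x * g x) := fun i => by
    refine (((hint i).indicator (hA ε)).sub ((hint i).indicator hEm)).congr
      (Eventually.of_forall fun x => ?_)
    simp only [Pi.sub_apply]
    rw [hone (Φ ε '' E), hone E, sub_mul]
  simp_rw [hterm]
  rw [← integral_finsetSum _ fun i _ => hti i]
  refine integral_congr_ae (Eventually.of_forall fun x => ?_)
  simp only
  rw [← Finset.mul_sum, ← Finset.sum_mul]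
  by_cases hx : x ∈ symmDiff (Φ ε '' E) E
  · have h2 : L * |ε| ≤ ρ := by
      have := (lt_div_iff₀ hL).1 hε.2
      linarith
    have h1 : ∑ i, χ i x = 1 := by
      have := hχ1 (Metric.cthickening_mono h2 _ (Metric.thickening_subset_cthickening _ _
        (h ε hε.1.le hx)))
      simpa using this
    rw [h1, one_mul]
  · have h0 : (Φ ε '' E).indicator (1 : Space (n + 1) → ℝ) x - E.indicator 1 x = 0 := by
      rw [Set.mem_symmDiff] at hx
      by_cases h1 : x ∈ Φ ε '' E <;> by_cases h2 : x ∈ E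
      · rw [Set.indicator_of_mem h1, Set.indicator_of_mem h2, sub_self]
      · exact absurd (Or.inl ⟨h1, h2⟩) hx
      · exact absurd (Or.inr ⟨h2, h1⟩) hx
      · rw [Set.indicator_of_notMem h1, Set.indicator_of_notMem h2, sub_self]
    rw [h0, zero_mul, zero_mul]

end Transport


/-! ### First variation for integrable kernels -/

section Integrable

variable {d : ℕ} {K : Space d → ℝ}

/-- The potential of an integrable kernel depends uniformly continuously on the set. -/
theorem exists_abs_kernelPotential_sub_lt (hK : Integrable K) {c : ℝ} (hc : 0 < c) :
    ∃ δ : ℝ≥0∞, 0 < δ ∧ ∀ E F : Set (Space d), MeasurableSet E → MeasurableSet F →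
      volume (symmDiff F E) < δ → ∀ x, |kernelPotential K F x - kernelPotential K E x| < c := by
  have hfin : ∫⁻ z, 2 * ‖K z‖ₑ ≠ ⊤ := by
    rw [lintegral_const_mul' _ _ (by norm_num)]
    exact ENNReal.mul_ne_top (by norm_num) hK.2.ne
  -- Absolute continuity of the integral of `|K|`. The reflected translate of `F Δ E` has the same
  -- volume for every `x`, whence uniformity in `x`.
  obtain ⟨δ, hδ, h⟩ := exists_pos_setLIntegral_lt_of_measure_lt hfin
    (ENNReal.ofReal_pos.2 hc).ne'
  refine ⟨δ, hδ, fun E F hE hF hlt x => ?_⟩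
  set T := (fun z => x - z) ⁻¹' symmDiff F E with hT
  have hFE : MeasurableSet (symmDiff F E) := hF.symmDiff hE
  have hTm : MeasurableSet T := (measurable_const.sub measurable_id) hFE
  have hTv : volume T = volume (symmDiff F E) :=
    (Measure.measurePreserving_sub_left volume x).measure_preimage hFE.nullMeasurableSet
  have hint : ∀ S : Set (Space d), MeasurableSet S →
      Integrable fun z => signedIndicator S (x - z) * K z := fun S hS => by
    have := (integrable_signedIndicator_mul hK hS x).comp_sub_left x
    simpa using this
  rw [kernelPotential_eq, kernelPotential_eq, ← integral_sub (hint F hF) (hint E hE)]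
  have hle : ‖∫ z, (signedIndicator F (x - z) * K z - signedIndicator E (x - z) * K z)‖ₑ ≤
      ∫⁻ z in T, 2 * ‖K z‖ₑ := by
    refine (enorm_integral_le_lintegral_enorm _).trans ?_
    rw [← lintegral_indicator hTm]
    refine lintegral_mono fun z => ?_
    by_cases hz : z ∈ T
    · rw [Set.indicator_of_mem hz, ← sub_mul, enorm_mul]
      gcongr
      have h2 : |signedIndicator F (x - z) - signedIndicator E (x - z)| ≤ 2 := by
        refine (abs_sub _ _).trans ?_
        rw [abs_signedIndicator, abs_signedIndicator]
        norm_num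
      rw [Real.enorm_eq_ofReal_abs]
      exact (ENNReal.ofReal_le_ofReal h2).trans (by simp)
    · have hz' : ¬ (x - z ∈ symmDiff F E) := hz
      rw [Set.mem_symmDiff] at hz'
      have heq : signedIndicator F (x - z) = signedIndicator E (x - z) := by
        by_cases h1 : x - z ∈ F <;> by_cases h2 : x - z ∈ E
        · rw [signedIndicator_of_mem h1, signedIndicator_of_mem h2]
        · exact absurd (Or.inl ⟨h1, h2⟩) hz'
        · exact absurd (Or.inr ⟨h2, h1⟩) hz'
        · rw [signedIndicator_of_notMem h1, signedIndicator_of_notMem h2]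
      simp [heq]
  have hlt' := hle.trans_lt (h T (hTv.trans_lt hlt))
  rw [Real.enorm_eq_ofReal_abs] at hlt'
  exact (ENNReal.ofReal_lt_ofReal_iff hc).1 hlt'

theorem abs_kernelPotential_le (S : Set (Space d)) (x : Space d) :
    |kernelPotential K S x| ≤ ∫ z, ‖K z‖ := by
  rw [kernelPotential_eq, ← Real.norm_eq_abs]
  refine (norm_integral_le_integral_norm _).trans (le_of_eq ?_)
  refine integral_congr_ae (Eventually.of_forall fun z => ?_)
  simp only
  rw [norm_mul, Real.norm_eq_abs, abs_signedIndicator, one_mul]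

end Integrable

section FirstVariation

variable {n : ℕ} {E : Set (Space (n + 1))} {ε₀ : ℝ} {K : Space (n + 1) → ℝ}
  {Φ : ℝ → (Space (n + 1) ≃ₘ^2⟮𝓘(ℝ, Space (n + 1)), 𝓘(ℝ, Space (n + 1))⟯ Space (n + 1))}

/-- First variation of the perimeter of an integrable kernel. -/
theorem IsC2Domain.hasDerivAt_nonlocalPerimeter (hE : IsC2Domain E) (hΦ : IsC2Family ε₀ Φ)
    (hK : Measurable K) (hK0 : ∀ z, 0 ≤ K z) (hKs : ∀ z, K (-z) = K z) (hKi : Integrable K)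
    (hfin : ∀ ε, nonlocalPerimeter K (Φ ε '' E) ≠ ⊤) :
    HasDerivAt (fun ε => (nonlocalPerimeter K (Φ ε '' E)).toReal)
      (∫ x in frontier E, kernelPotential K E x *
        inner ℝ (deriv (fun ε => Φ ε x) 0) (outerNormal E x) ∂μHE[n]) 0 := by
  have hEm := hE.isClosed.measurableSet
  have hA : ∀ ε, MeasurableSet (Φ ε '' E) := fun ε => (hE.image (Φ ε)).isClosed.measurableSet
  have hVc : ∀ ε, Continuous (kernelPotential K (Φ ε '' E)) := fun ε =>
    continuous_kernelPotential hKi (hA ε) (hE.image (Φ ε)).volume_frontier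
  have hVE : Continuous (kernelPotential K E) :=
    continuous_kernelPotential hKi hEm hE.volume_frontier
  obtain ⟨C, hC, hvol⟩ := hE.exists_volume_symmDiff_le hΦ
  set h : ℝ → Space (n + 1) → ℝ := fun ε x => (Φ ε '' E).indicator 1 x - E.indicator 1 x with hh
  set R : ℝ → ℝ := fun ε => ∫ x, h ε x *
    ((kernelPotential K (Φ ε '' E) x - kernelPotential K E x) / 2) with hR
  -- The average of the two potentials is `V_E` plus half their difference; the first part is
  -- handled by transport, and the second is the remainder `R`.
  have hsplit : ∀ᶠ ε in 𝓝 (0 : ℝ), (nonlocalPerimeter K (Φ ε '' E)).toReal =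
      (nonlocalPerimeter K E).toReal + (∫ x, h ε x * kernelPotential K E x) + R ε := by
    filter_upwards [hvol] with ε hε
    have hne : volume (symmDiff (Φ ε '' E) E) ≠ ⊤ := ne_top_of_le_ne_top ENNReal.ofReal_ne_top hε
    have hhi : Integrable (h ε) := integrable_indicator_sub_indicator hEm (hA ε) hne
    have hfinE : nonlocalPerimeter K E ≠ ⊤ := by simpa [hΦ.coe_zero] using hfin 0
    have hbd : ∀ S, Continuous (kernelPotential K S) →
        Integrable fun x => h ε x * kernelPotential K S x := fun S hS =>
      hhi.mul_bdd (c := ∫ z, ‖K z‖) hS.aestronglyMeasurable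
        (Eventually.of_forall fun x => abs_kernelPotential_le S x)
    have hsub := toReal_nonlocalPerimeter_sub hK hK0 hKs hKi hEm (hA ε) hfinE (hfin ε) hne
    have hRi : Integrable fun x => h ε x *
        ((kernelPotential K (Φ ε '' E) x - kernelPotential K E x) / 2) := by
      refine (((hbd _ (hVc ε)).sub (hbd _ hVE)).div_const 2).congr
        (Eventually.of_forall fun x => ?_)
      simp only [Pi.sub_apply]
      ring
    have hadd : (∫ x, h ε x * kernelPotential K E x) + R ε = ∫ x, h ε x *
        ((kernelPotential K E x + kernelPotential K (Φ ε '' E) x) / 2) := by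
      rw [hR]
      simp only
      rw [← integral_add (hbd _ hVE) hRi]
      refine integral_congr_ae (Eventually.of_forall fun x => ?_)
      simp only
      ring
    rw [add_assoc, hadd, ← hsub]
    ring
  have hR0 : R 0 = 0 := by
    simp [hR, hh, hΦ.coe_zero]
  have hRd : HasDerivAt R 0 0 := by
    rw [hasDerivAt_iff_isLittleO, Asymptotics.isLittleO_iff]
    intro c hc
    -- Half of this threshold times the volume bound `C|ε|` is at most `c|ε|`; the `+ 1` covers `C =
    -- 0`.
    have hs : 0 < 2 * c / (C + 1) := by positivity
    obtain ⟨δ, hδ, hunif⟩ := exists_abs_kernelPotential_sub_lt hKi hs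
    have hlim : Tendsto (fun ε : ℝ => ENNReal.ofReal (C * |ε|)) (𝓝 0) (𝓝 0) := by
      have h1 : Continuous fun ε : ℝ => ENNReal.ofReal (C * |ε|) :=
        ENNReal.continuous_ofReal.comp (by fun_prop)
      simpa using h1.tendsto 0
    filter_upwards [hvol, hlim.eventually (gt_mem_nhds hδ)] with ε h1 h2
    have hne : volume (symmDiff (Φ ε '' E) E) ≠ ⊤ := ne_top_of_le_ne_top ENNReal.ofReal_ne_top h1
    have hle : ‖R ε‖ ≤ ∫ x, (symmDiff (Φ ε '' E) E).indicator (fun _ => c / (C + 1)) x := by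
      refine norm_integral_le_of_norm_le ((integrable_indicator_iff ((hA ε).symmDiff hEm)).2
        (integrableOn_const hne)) (Eventually.of_forall fun x => ?_)
      by_cases hx : x ∈ symmDiff (Φ ε '' E) E
      · rw [Set.indicator_of_mem hx, norm_mul]
        have h3 : ‖h ε x‖ ≤ 1 := by
          by_cases m1 : x ∈ Φ ε '' E <;> by_cases m2 : x ∈ E <;> simp only [hh] <;>
            simp only [Set.indicator_of_mem, Set.indicator_of_notMem, m1, m2, not_false_eq_true,
              Pi.one_apply] <;> norm_num
        have h4 := (hunif E (Φ ε '' E) hEm (hA ε) (h1.trans_lt h2) x).le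
        have h5 : ‖(kernelPotential K (Φ ε '' E) x - kernelPotential K E x) / 2‖ ≤ c / (C + 1) := by
          rw [norm_div, Real.norm_eq_abs, Real.norm_two, div_le_iff₀ two_pos]
          refine h4.trans (le_of_eq ?_)
          ring
        calc _ ≤ 1 * (c / (C + 1)) := by gcongr
          _ = _ := one_mul _
      · have h3 : h ε x = 0 := by
          rw [Set.mem_symmDiff] at hx
          simp only [hh]
          by_cases m1 : x ∈ Φ ε '' E <;> by_cases m2 : x ∈ E
          · rw [Set.indicator_of_mem m1, Set.indicator_of_mem m2, sub_self]
          · exact absurd (Or.inl ⟨m1, m2⟩) hx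
          · exact absurd (Or.inr ⟨m2, m1⟩) hx
          · rw [Set.indicator_of_notMem m1, Set.indicator_of_notMem m2, sub_self]
        rw [Set.indicator_of_notMem hx, h3, zero_mul, norm_zero]
    have hvr : volume.real (symmDiff (Φ ε '' E) E) ≤ C * |ε| :=
      ENNReal.toReal_le_of_le_ofReal (by positivity) h1
    rw [integral_indicator_const _ ((hA ε).symmDiff hEm), smul_eq_mul] at hle
    rw [hR0, sub_zero, sub_zero, smul_zero, sub_zero, Real.norm_eq_abs ε]
    calc ‖R ε‖ ≤ C * |ε| * (c / (C + 1)) := hle.trans (by gcongr)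
      _ = c * |ε| * (C / (C + 1)) := by ring
      _ ≤ c * |ε| * 1 := by
        gcongr
        rw [div_le_one (by positivity)]
        linarith
      _ = _ := mul_one _
  have hmain := ((hE.hasDerivAt_integral_indicator_sub hΦ hVE).const_add
    (nonlocalPerimeter K E).toReal).add hRd
  rw [add_zero] at hmain
  exact hmain.congr_of_eventuallyEq hsplit

/-- The first variation at a later time. -/
theorem IsC2Domain.hasDerivAt_nonlocalPerimeter_of_mem (hE : IsC2Domain E) (hΦ : IsC2Family ε₀ Φ)
    (hK : Measurable K) (hK0 : ∀ z, 0 ≤ K z) (hKs : ∀ z, K (-z) = K z) (hKi : Integrable K)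
    (hfin : ∀ ε, nonlocalPerimeter K (Φ ε '' E) ≠ ⊤) {ε : ℝ} (hε : ε ∈ Set.Ioo (-ε₀) ε₀) :
    HasDerivAt (fun ε => (nonlocalPerimeter K (Φ ε '' E)).toReal)
      (∫ x in frontier (Φ ε '' E), kernelPotential K (Φ ε '' E) x *
        inner ℝ (deriv (fun η => ((Φ ε).symm.trans (Φ (ε + η))) x) 0) (outerNormal (Φ ε '' E) x)
          ∂μHE[n]) ε := by
  have himg : ∀ η, ((Φ ε).symm.trans (Φ (ε + η))) '' (Φ ε '' E) = Φ (ε + η) '' E := fun η => by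
    rw [Set.image_image]
    refine Set.image_congr fun x _ => ?_
    simp
  have h := (hE.image (Φ ε)).hasDerivAt_nonlocalPerimeter (hΦ.shift hε) hK hK0 hKs hKi
    (fun η => by rw [himg]; exact hfin _)
  simp only [himg] at h
  -- Writing the base point `0` as `ε - ε` lets the derivative be translated back to time `ε`.
  rw [← sub_self ε] at h
  have h2 := h.comp_sub_const ε ε
  simpa using h2

end FirstVariation


/-! ### Removing the truncation -/

section Limit

variable {n : ℕ} {φ j : Space (n + 1) → ℝ} {E : Set (Space (n + 1))}

theorem IsAdmissibleKernel.continuous_truncatedCurvature (hφ : IsAdmissibleKernel φ j)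
    (hE : IsC2Domain E) {r : ℝ} (hr : 0 < r) : Continuous fun x => truncatedCurvature φ x E r := by
  simp_rw [truncatedCurvature_eq]
  exact continuous_kernelPotential (hφ.integrable_truncKernel hr) hE.isClosed.measurableSet
    hE.volume_frontier

theorem IsC2Domain.exists_abs_truncatedCurvature_sub_le (hE : IsC2Domain E)
    (hφ : IsAdmissibleKernel φ j) : ∃ C ρ : ℝ, 0 < ρ ∧ ∀ r, 0 < r → r ≤ ρ → ∀ x ∈ frontier E,
      |truncatedCurvature φ x E r - pvCurvature φ x E| ≤ (flatModulus j C r).toReal := by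
  obtain ⟨C, r₀, hC, hr₀, h⟩ := hE.exists_flatAt
  exact ⟨C, min r₀ 1, lt_min hr₀ one_pos, fun r hr hr' x hx =>
    hφ.abs_truncatedCurvature_sub_pvCurvature_le hE.isClosed.measurableSet hC hr₀ (h x hx) hr
      (hr'.trans (min_le_left _ _)) (hr'.trans (min_le_right _ _))⟩

theorem IsC2Domain.tendsto_truncatedCurvature (hE : IsC2Domain E) (hφ : IsAdmissibleKernel φ j)
    {x : Space (n + 1)} (hx : x ∈ frontier E) :
    Tendsto (truncatedCurvature φ x E) (𝓝[>] 0) (𝓝 (pvCurvature φ x E)) := by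
  obtain ⟨C, r₀, hC, hr₀, h⟩ := hE.exists_flatAt
  exact hφ.tendsto_truncatedCurvature hE.isClosed.measurableSet hC hr₀ (h x hx)

/-- The principal value is continuous on the boundary, as a uniform limit. -/
theorem IsC2Domain.continuousOn_pvCurvature (hE : IsC2Domain E) (hφ : IsAdmissibleKernel φ j) :
    ContinuousOn (fun x => pvCurvature φ x E) (frontier E) := by
  obtain ⟨C, ρ, hρ, h⟩ := hE.exists_abs_truncatedCurvature_sub_le hφ
  have hu : TendstoUniformlyOn (fun r x => truncatedCurvature φ x E r)
      (fun x => pvCurvature φ x E) (𝓝[>] 0) (frontier E) := by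
    rw [Metric.tendstoUniformlyOn_iff]
    intro c hc
    filter_upwards [Ioo_mem_nhdsGT hρ, (hφ.tendsto_flatModulus C).eventually (gt_mem_nhds hc)]
      with r hr hrc x hx
    rw [dist_comm, Real.dist_eq]
    exact (h r hr.1 hr.2.le x hx).trans_lt hrc
  refine hu.continuousOn (Eventually.frequently ?_)
  filter_upwards [self_mem_nhdsWithin] with r hr
  exact (hφ.continuous_truncatedCurvature hE hr).continuousOn

variable {ε₀ : ℝ}
  {Φ : ℝ → (Space (n + 1) ≃ₘ^2⟮𝓘(ℝ, Space (n + 1)), 𝓘(ℝ, Space (n + 1))⟯ Space (n + 1))}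

/-- The first variation of the nonlocal perimeter, with the curvature as a principal value. -/
theorem IsC2Domain.hasDerivAt_nonlocalPerimeter_of_isAdmissibleKernel (hn : 1 ≤ n)
    (hE : IsC2Domain E) (hΦ : IsC2Family ε₀ Φ) (hφ : IsAdmissibleKernel φ j) :
    HasDerivAt (fun ε => (nonlocalPerimeter φ (Φ ε '' E)).toReal)
      (∫ x in frontier E, pvCurvature φ x E *
        inner ℝ (deriv (fun ε => Φ ε x) 0) (outerNormal E x) ∂μHE[n]) 0 := by
  have hA : ∀ ε, IsC2Domain (Φ ε '' E) := fun ε => hE.image (Φ ε)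
  have hfin : ∀ ε, nonlocalPerimeter φ (Φ ε '' E) ≠ ⊤ := fun ε =>
    (hA ε).nonlocalPerimeter_ne_top hn hφ
  obtain ⟨L, η, hL, hη, hηε, hflow⟩ := hΦ.exists_flow_bound hE.isCompact_frontier
  obtain ⟨C, r₀, hC, hr₀, hflat⟩ := hE.exists_eventually_flatAt hΦ
  set v : ℝ → Space (n + 1) → ℝ := fun ε x =>
    inner ℝ (deriv (fun η => ((Φ ε).symm.trans (Φ (ε + η))) x) 0) (outerNormal (Φ ε '' E) x) with hv
  have hIoo : ∀ ε : ℝ, |ε| ≤ η → ε ∈ Set.Ioo (-ε₀) ε₀ := fun ε hε => by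
    rw [Set.mem_Ioo, ← abs_lt]
    linarith
  have hvb : ∀ ε, |ε| ≤ η → ∀ x ∈ frontier (Φ ε '' E), |v ε x| ≤ L := by
    intro ε hε x hx
    rw [frontier_image_diffeo] at hx
    obtain ⟨y, hy, rfl⟩ := hx
    -- At `Φ_ε(y)` the restarted flow has the velocity of the original trajectory of `y` at time
    -- `ε`.
    have h1 : deriv (fun η => ((Φ ε).symm.trans (Φ (ε + η))) (Φ ε y)) 0 =
        deriv (fun s => Φ s y) ε := by
      have := deriv_comp_const_add (fun s => Φ s y) ε 0
      simpa using this
    have h2 := abs_real_inner_le_norm (deriv (fun s => Φ s y) ε) (outerNormal (Φ ε '' E) (Φ ε y))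
    simp only [hv, h1]
    refine h2.trans ?_
    calc _ ≤ L * 1 := mul_le_mul ((hflow ε hε).2.2 y hy) (norm_outerNormal_le _ _)
          (norm_nonneg _) hL.le
      _ = L := mul_one L
  -- A bound for the area of the moving boundary, uniform in `ε`: each `Φ_ε` is `L`-Lipschitz on
  -- `∂E`.
  set M : ℝ≥0∞ := ENNReal.ofReal L ^ n * μHE[n] (frontier E) with hM
  have hMfin : M ≠ ⊤ := ENNReal.mul_ne_top (ENNReal.pow_ne_top ENNReal.ofReal_ne_top)
    hE.hausdorff_frontier_lt_top.ne
  have hMle : ∀ ε, |ε| ≤ η → μHE[n] (frontier (Φ ε '' E)) ≤ M := by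
    intro ε hε
    rw [frontier_image_diffeo]
    have h1 := euclideanHausdorffMeasure_image_le (F := Φ ε) (L := id) (S := frontier E)
      (K := L.toNNReal) (fun a ha b hb => by
        rw [dist_eq_norm, dist_eq_norm, Real.coe_toNNReal _ hL.le]
        exact (hflow ε hε).2.1 a ha b hb) n
    rwa [Set.image_id] at h1
  have hvc : ∀ ε, |ε| ≤ η → ContinuousOn (v ε) (frontier (Φ ε '' E)) := fun ε hε =>
    (hA ε).continuousOn_normalSpeed (hΦ.shift (hIoo ε hε))
  set f' : ℝ → ℝ → ℝ := fun r ε => ∫ x in frontier (Φ ε '' E),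
    truncatedCurvature φ x (Φ ε '' E) r * v ε x ∂μHE[n] with hf'
  set g' : ℝ → ℝ := fun ε => ∫ x in frontier (Φ ε '' E),
    pvCurvature φ x (Φ ε '' E) * v ε x ∂μHE[n] with hg'
  have hη_mem : ∀ᶠ ε in 𝓝 (0 : ℝ), |ε| ≤ η := by
    filter_upwards [Metric.ball_mem_nhds (0 : ℝ) hη] with ε hε
    rw [mem_ball_zero_iff, Real.norm_eq_abs] at hε
    exact hε.le
  have hdiff : ∀ r, 0 < r → r ≤ min r₀ 1 → ∀ ε, |ε| ≤ η →
      (∀ x ∈ frontier E, FlatAt (Φ ε '' E) (Φ ε x) C r₀) →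
      |f' r ε - g' ε| ≤ (flatModulus j C r).toReal * L * M.toReal := by
    intro r hr hr' ε hε hfl
    have h1 : IntegrableOn (fun x => truncatedCurvature φ x (Φ ε '' E) r * v ε x)
        (frontier (Φ ε '' E)) μHE[n] := (hA ε).integrableOn_frontier
      ((hφ.continuous_truncatedCurvature (hA ε) hr).continuousOn.mul (hvc ε hε))
    have h2 : IntegrableOn (fun x => pvCurvature φ x (Φ ε '' E) * v ε x)
        (frontier (Φ ε '' E)) μHE[n] := (hA ε).integrableOn_frontier
      (((hA ε).continuousOn_pvCurvature hφ).mul (hvc ε hε))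
    simp only [hf', hg']
    rw [← integral_sub h1 h2, ← Real.norm_eq_abs]
    refine (norm_setIntegral_le_of_norm_le_const (C := (flatModulus j C r).toReal * L)
      (hA ε).hausdorff_frontier_lt_top fun x hx => ?_).trans ?_
    · rw [← sub_mul, norm_mul]
      have hx' := hx
      rw [frontier_image_diffeo] at hx'
      obtain ⟨y, hy, rfl⟩ := hx'
      exact mul_le_mul (hφ.abs_truncatedCurvature_sub_pvCurvature_le
        (hA ε).isClosed.measurableSet hC hr₀ (hfl y hy) hr (hr'.trans (min_le_left _ _))
        (hr'.trans (min_le_right _ _))) (hvb ε hε _ hx) (norm_nonneg _) ENNReal.toReal_nonneg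
    · refine mul_le_mul_of_nonneg_left (ENNReal.toReal_mono hMfin (hMle ε hε)) ?_
      exact mul_nonneg ENNReal.toReal_nonneg hL.le
  have hunif : TendstoUniformlyOnFilter f' g' (𝓝[>] 0) (𝓝 0) := by
    rw [Metric.tendstoUniformlyOnFilter_iff]
    intro c hc
    have hlim : Tendsto (fun r => (flatModulus j C r).toReal * L * M.toReal) (𝓝[>] 0) (𝓝 0) := by
      simpa using ((hφ.tendsto_flatModulus C).mul_const L).mul_const M.toReal
    have hr_ev : ∀ᶠ r in 𝓝[>] (0 : ℝ), r ∈ Set.Ioo 0 (min r₀ 1) ∧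
        (flatModulus j C r).toReal * L * M.toReal < c :=
      Filter.Eventually.and (Ioo_mem_nhdsGT (lt_min hr₀ one_pos)) (hlim.eventually (gt_mem_nhds hc))
    filter_upwards [hr_ev.prod_mk (hη_mem.and hflat)] with q hq
    rw [dist_comm, Real.dist_eq]
    exact (hdiff q.1 hq.1.1.1 hq.1.1.2.le q.2 hq.2.1 hq.2.2).trans_lt hq.1.2
  have hder : ∀ᶠ q : ℝ × ℝ in (𝓝[>] 0) ×ˢ 𝓝 0,
      HasDerivAt (fun ε => (nonlocalPerimeter (truncKernel φ q.1) (Φ ε '' E)).toReal)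
        (f' q.1 q.2) q.2 := by
    have hpos : ∀ᶠ r in 𝓝[>] (0 : ℝ), 0 < r := self_mem_nhdsWithin
    filter_upwards [hpos.prod_mk hη_mem] with q hq
    simp only [hf', truncatedCurvature_eq]
    exact hE.hasDerivAt_nonlocalPerimeter_of_mem hΦ (hφ.measurable_truncKernel _)
      (hφ.truncKernel_nonneg _) (hφ.truncKernel_neg _) (hφ.integrable_truncKernel hq.1)
      (fun ε => ne_top_of_le_ne_top (hfin ε) (hφ.nonlocalPerimeter_truncKernel_le _ _))
      (hIoo _ hq.2)
  -- The truncated perimeters converge at each `ε`, and their derivatives converge uniformly for `ε`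
  -- near zero, so the derivative of the limit is the limit of the derivatives.
  have hmain := hasDerivAt_of_tendstoUniformlyOnFilter hunif hder
    (Eventually.of_forall fun ε =>
      hφ.tendsto_nonlocalPerimeter (hA ε).isClosed.measurableSet (hfin ε))
  have hg0 : g' 0 = ∫ x in frontier E, pvCurvature φ x E *
      inner ℝ (deriv (fun ε => Φ ε x) 0) (outerNormal E x) ∂μHE[n] := by
    simp [hg', hv, hΦ.coe_zero, hΦ.symm_zero]
  rwa [hg0] at hmain

end Limit

/-! ### The normalizing constant -/

section Sphere

theorem isC2Domain_closedBall (n : ℕ) : IsC2Domain (Metric.closedBall (0 : Space (n + 1)) 1) := by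
  have hfr : frontier (Metric.closedBall (0 : Space (n + 1)) 1) = Metric.sphere 0 1 :=
    frontier_closedBall _ one_ne_zero
  refine ⟨Metric.isClosed_closedBall, ?_, fun p hp => ?_⟩
  · rw [hfr]
    exact isCompact_sphere _ _
  · rw [hfr, mem_sphere_zero_iff_norm] at hp
    have hd : HasFDerivAt (fun x : Space (n + 1) => ‖x‖ ^ 2 - 1) (2 • innerSL ℝ p) p :=
      (hasStrictFDerivAt_norm_sq p).hasFDerivAt.sub_const 1
    refine ⟨fun x => ‖x‖ ^ 2 - 1, ((contDiff_norm_sq ℝ).sub contDiff_const).contDiffAt,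
      by simp [hp], fun h0 => ?_, Eventually.of_forall fun y => ?_⟩
    · rw [hd.fderiv] at h0
      have := congrArg (fun l : Space (n + 1) →L[ℝ] ℝ => l p) h0
      simp [hp] at this
    · rw [mem_closedBall_zero_iff, sub_nonpos, sq_le_one_iff_abs_le_one, abs_norm]

theorem hausdorff_sphere_lt_top (n : ℕ) :
    μHE[n] (Metric.sphere (0 : Space (n + 1)) 1) < ⊤ := by
  rw [← frontier_closedBall (0 : Space (n + 1)) one_ne_zero]
  exact (isC2Domain_closedBall n).hausdorff_frontier_lt_top

/-- Orthogonal projection to a hyperplane is 1-Lipschitz and maps the sphere onto a set containing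
the open unit ball. -/
theorem hausdorff_sphere_pos (n : ℕ) : 0 < μHE[n] (Metric.sphere (0 : Space (n + 1)) 1) := by
  obtain ⟨e, he, -⟩ := exists_isSplitting (EuclideanSpace.single (0 : Fin (n + 1)) (1 : ℝ))
    (by simp)
  have h := euclideanHausdorffMeasure_image_le (F := fun x : Space (n + 1) => (e.symm x).1)
    (L := id) (S := Metric.sphere (0 : Space (n + 1)) 1) (K := 1) (fun a _ b _ => by
      rw [NNReal.coe_one, one_mul, dist_eq_norm, dist_eq_norm]
      have := he.norm_fst_le (e.symm (a - b))
      simpa using this) n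
  rw [Set.image_id, ENNReal.coe_one, one_pow, one_mul] at h
  refine lt_of_lt_of_le ?_ h
  have hsub : Metric.ball (0 : Space n) 1 ⊆
      (fun x : Space (n + 1) => (e.symm x).1) '' Metric.sphere (0 : Space (n + 1)) 1 := by
    intro y hy
    rw [mem_ball_zero_iff] at hy
    refine ⟨e (y, √(1 - ‖y‖ ^ 2)), ?_, by simp⟩
    have h1 : 0 ≤ 1 - ‖y‖ ^ 2 := by nlinarith [norm_nonneg y]
    have h2 := he.norm_sq (y, √(1 - ‖y‖ ^ 2))
    rw [Real.sq_sqrt h1, add_sub_cancel] at h2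
    rw [mem_sphere_zero_iff_norm]
    exact (pow_eq_one_iff_of_nonneg (norm_nonneg _) two_ne_zero).1 h2
  refine lt_of_lt_of_le ?_ (measure_mono hsub)
  rw [EuclideanSpace.euclideanHausdorffMeasure_eq_volume]
  exact Metric.measure_ball_pos _ _ one_pos

theorem kappa_ne_zero (m : ℕ) : kappa m ≠ 0 :=
  (ENNReal.toReal_pos (hausdorff_sphere_pos m).ne' (hausdorff_sphere_lt_top m).ne).ne'

end Sphere

end NonlocalCurvature

/-! ### The main theorem -/

theorem mainTheorem8 (d : ℕ) (hd : 2 ≤ d)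
    (φ j : NonlocalCurvature.Space d → ℝ)
    (hφ : NonlocalCurvature.IsAdmissibleKernel φ j) :
    (∀ E ∈ NonlocalCurvature.ClassC d, ∀ x ∈ frontier E,
      (∀ r : ℝ, 0 < r →
        IntegrableOn (fun y => NonlocalCurvature.signedIndicator E y * φ (x - y))
          (Metric.ball x r)ᶜ volume) ∧
      Tendsto
        (fun r : ℝ => (NonlocalCurvature.kappa (d - 2))⁻¹ *
          NonlocalCurvature.truncatedCurvature φ x E r)
        (𝓝[>] 0) (𝓝 (NonlocalCurvature.nonlocalMeanCurvature φ x E))) ∧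
    NonlocalCurvature.IsFirstVariation (NonlocalCurvature.nonlocalPerimeter φ)
      (fun x E => NonlocalCurvature.kappa (d - 2) *
        NonlocalCurvature.nonlocalMeanCurvature φ x E) := by
  -- Two successors are split off: one for the vertical direction of the splittings, and one so that
  -- the base has dimension at least one, as the finiteness of the perimeter requires.
  obtain ⟨n, rfl⟩ : ∃ n, d = n + 1 + 1 := ⟨d - 2, by omega⟩
  have hH : ∀ E x, NonlocalCurvature.nonlocalMeanCurvature φ x E =
      (NonlocalCurvature.kappa (n + 1 + 1 - 2))⁻¹ * NonlocalCurvature.pvCurvature φ x E :=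
    fun E x => rfl
  have hκH : ∀ E x, NonlocalCurvature.kappa (n + 1 + 1 - 2) *
      NonlocalCurvature.nonlocalMeanCurvature φ x E = NonlocalCurvature.pvCurvature φ x E :=
    fun E x => by rw [hH, mul_inv_cancel_left₀ (NonlocalCurvature.kappa_ne_zero _)]
  refine ⟨fun E hE x hx => ⟨fun r hr => ?_, ?_⟩, fun E hE ε₀ Φ hΦ => ?_⟩
  · have hE' := NonlocalCurvature.isC2Domain_of_mem_classC hE
    rw [← integrable_indicator_iff Metric.isOpen_ball.measurableSet.compl,
      ← NonlocalCurvature.signedIndicator_mul_truncKernel]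
    exact NonlocalCurvature.integrable_signedIndicator_mul (hφ.integrable_truncKernel hr)
      hE'.isClosed.measurableSet x
  · rw [hH]
    exact ((NonlocalCurvature.isC2Domain_of_mem_classC hE).tendsto_truncatedCurvature hφ
      hx).const_mul _
  · have hE' := NonlocalCurvature.isC2Domain_of_mem_classC hE
    simp only [hκH, Nat.add_sub_cancel]
    exact ⟨fun ε _ => (hE'.image (Φ ε)).nonlocalPerimeter_ne_top (Nat.le_add_left 1 n) hφ,
      hE'.integrableOn_frontier ((hE'.continuousOn_pvCurvature hφ).mul
        (hE'.continuousOn_normalSpeed hΦ)),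
      hE'.hasDerivAt_nonlocalPerimeter_of_isAdmissibleKernel (Nat.le_add_left 1 n) hΦ hφ⟩
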